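/- Let $(R,\mathfrak m)$ and $(S,\mathfrak n)$ be one-dimensional Cohen–Macaulay local rings with a common infinite residue class field $k=R/\mathfrak m=S/\mathfrak n$, and let $f:R\to k$, $g:S\to k$ be the canonical surjections. Let $A=R\times_kS=\{(a,b)\in R\times S\mid f(a)=g(b)\}$, which is a one-dimensional Cohen–Macaulay local ring with maximal ideal $\mathfrak m\times\mathfrak n$. Suppose that the total ring of fractions $\mathrm Q(A)$ is a Gorenstein ring and that $A$ possesses a canonical module $\mathrm K_A$. Then the following conditions are equivalent. 1. $A=R\times_kS$ is an almost Gorenstein ring. 2. $A=R\times_kS$ is a generalized Gorenstein ring. 3. $R$ and $S$ are almost Gorenstein rings. Here a one-dimensional Cohen–Macaulay local ring $(R,\mathfrak m)$ is called *almost Gorenstein* if it possesses a canonical module $\mathrm K_R$ and there is an exact sequence $0\to R\to\mathrm K_R\to C\to0$ of $R$-modules such that $\mu_R(C)=\mathrm e^0_{\mathfrak m}(C)$, where $\mu_R(C)$ is the minimal number of generators of $C$ and $\mathrm e^0_{\mathfrak m}(C)=\lim_{n\to\infty}\ell_R(C/\mathfrak m^{n+1}C)$. It is called *generalized Gorenstein*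 if it possesses a fractional canonical ideal $K$, that is, an $R$-submodule $K$ of $\mathrm Q(R)$ with $R\subseteq K\subseteq\overline R$ and $K\cong\mathrm K_R$, where $\overline R$ is the integral closure of $R$ in $\mathrm Q(R)$, and either $R$ is Gorenstein, or $R$ is not Gorenstein and $K/R$ is a free $R/\mathfrak a$-module for $\mathfrak a=R:R[K]$. -/

import Mathlib

open CategoryTheory IsLocalRing Filter Topology

universe u v

noncomputable section

/-! ### Fiber products -/

/-- The fiber product `R ×_T S = {(a, b) ∈ R × S | f a = g b}`, a subring of `R × S`. -/
def fiberProduct {R S T : Type*} [CommRing R] [CommRing S] [CommRing T]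
    (f : R →+* T) (g : S →+* T) : Subring (R × S) :=
  (f.comp (RingHom.fst R S)).eqLocus (g.comp (RingHom.snd R S))

/-- The surjection `R → R/𝔪 ≅ k` of a local ring `R` onto a field `k` identified with its
residue field. -/
def residueMap {R : Type*} [CommRing R] [IsLocalRing R] {k : Type*} [Field k]
    (e : ResidueField R ≃+* k) : R →+* k :=
  e.toRingHom.comp (residue R)

/-- The fiber product `A = R ×_k S` of two local rings over their common residue field `k`. -/
abbrev residueFiberProduct {R S : Type*} [CommRing R] [IsLocalRing R] [CommRing S]
    [IsLocalRing S] {k : Type*} [Field k] (eR : ResidueField R ≃+* k)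
    (eS : ResidueField S ≃+* k) : Subring (R × S) :=
  fiberProduct (residueMap eR) (residueMap eS)

instance residueMap.instIsLocalHom {R : Type*} [CommRing R] [IsLocalRing R] {k : Type*} [Field k]
    (e : ResidueField R ≃+* k) : IsLocalHom (residueMap e) := by
  constructor
  intro a ha
  have h : e (residue R a) ≠ 0 := ha.ne_zero
  have h' : residue R a ≠ 0 := fun h0 => h (by rw [h0, map_zero])
  exact (residue_ne_zero_iff_isUnit a).1 h'

/-- A fiber product of local rings along local homomorphisms is a local ring. -/
instance fiberProduct.instIsLocalRing {R S T : Type*} [CommRing R] [CommRing S] [CommRing T]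
    [IsLocalRing R] [IsLocalRing S] (f : R →+* T) (g : S →+* T) [IsLocalHom f] [IsLocalHom g] :
    IsLocalRing (fiberProduct f g) := by
  have key : ∀ x : fiberProduct f g, IsUnit x.1.1 → IsUnit x := by
    rintro ⟨⟨a, b⟩, hx⟩ ha
    have hab : f a = g b := hx
    have hb : IsUnit b := by
      have h1 : IsUnit (g b) := hab ▸ IsUnit.map f ha
      exact isUnit_of_map_unit g b h1
    obtain ⟨a', haa'⟩ := IsUnit.exists_right_inv (a := a) ha
    obtain ⟨b', hbb'⟩ := hb.exists_right_inv
    have hy : f a' = g b' := by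
      have hu : IsUnit (f a) := IsUnit.map f ha
      refine hu.mul_left_cancel ?_
      rw [← map_mul, haa', hab, ← map_mul, hbb', map_one, map_one]
    refine IsUnit.of_mul_eq_one (⟨(a', b'), hy⟩ : fiberProduct f g) ?_
    exact Subtype.ext (Prod.ext haa' hbb')
  have : Nontrivial (fiberProduct f g) :=
    ⟨⟨0, 1, fun h => zero_ne_one (congrArg (fun z : fiberProduct f g => z.1.1) h)⟩⟩
  refine IsLocalRing.of_isUnit_or_isUnit_one_sub_self ?_
  intro x
  rcases IsLocalRing.isUnit_or_isUnit_one_sub_self x.1.1 with h | h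
  · exact Or.inl (key x h)
  · exact Or.inr (key (1 - x) h)

/-! ### Cohen-Macaulay and Gorenstein rings, canonical modules -/

/-- A maximal Cohen-Macaulay module over the local ring `R`: a finitely generated module with a
regular sequence, contained in the maximal ideal, whose length is the Krull dimension of `R`
(`RingTheory.Sequence.IsRegular` includes that the module is nonzero). -/
def IsMaximalCohenMacaulay (R : Type*) [CommRing R] [IsLocalRing R]
    (M : Type*) [AddCommGroup M] [Module R M] : Prop :=
  Module.Finite R M ∧
    ∃ rs : List R, (∀ r ∈ rs, r ∈ maximalIdeal R) ∧ RingTheory.Sequence.IsRegular M rs ∧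
      ringKrullDim R = (rs.length : ℕ)

/-- A Cohen-Macaulay local ring. -/
def IsCohenMacaulayLocal (R : Type*) [CommRing R] [IsLocalRing R] : Prop :=
  IsNoetherianRing R ∧ IsMaximalCohenMacaulay R R

/-- `M` is of finite injective dimension over `R`. -/
def HasFiniteInjectiveDimension (R : Type u) [CommRing R]
    (M : Type u) [AddCommGroup M] [Module R M] : Prop :=
  ∃ n : ℕ, HasInjectiveDimensionLE (ModuleCat.of R M) n

/-- A Gorenstein local ring: Noetherian and of finite injective dimension over itself. -/
def IsGorensteinLocal (R : Type u) [CommRing R] [IsLocalRing R] : Prop :=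
  IsNoetherianRing R ∧ HasFiniteInjectiveDimension R R

/-- A Gorenstein ring: Noetherian, with Gorenstein localizations at all primes. -/
def IsGorensteinRing (R : Type u) [CommRing R] : Prop :=
  IsNoetherianRing R ∧
    ∀ (P : Ideal R) [P.IsPrime], IsGorensteinLocal (Localization.AtPrime P)

/-- `M` is a canonical module of the Cohen-Macaulay local ring `R` (with residue field `k`): a
maximal Cohen-Macaulay module of finite injective dimension and of type one, that is,
`Ext^d_R(k, M)` is one-dimensional over `k`, where `d = dim R`. -/
structure IsCanonicalModule (R : Type u) [CommRing R] [IsLocalRing R]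
    (M : Type u) [AddCommGroup M] [Module R M] : Prop where
  maximalCohenMacaulay : IsMaximalCohenMacaulay R M
  finiteInjectiveDimension : HasFiniteInjectiveDimension R M
  type_one : ∀ d : ℕ, ringKrullDim R = d →
    Module.length R
      (Abelian.Ext.{u} (ModuleCat.of R (ResidueField R)) (ModuleCat.of R M) d) = 1

/-- `R` possesses a canonical module. -/
def HasCanonicalModule (R : Type u) [CommRing R] [IsLocalRing R] : Prop :=
  ∃ (K : Type u) (_ : AddCommGroup K) (_ : Module R K), IsCanonicalModule R K

/-! ### Almost Gorenstein and generalized Gorenstein rings of dimension one -/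

/-- `e` is the multiplicity `e⁰_𝔪(C)` relative to a one-dimensional local ring `R`, that is the
limit of `ℓ_R(C / 𝔪ⁿ⁺¹ C)`. (In dimension `d` one takes the limit of
`ℓ_R(C / 𝔪ⁿ⁺¹ C) * (d-1)! / n^(d-1)`; for `d = 1` the extra factors are `1`.) -/
def IsMultiplicity (R : Type*) [CommRing R] [IsLocalRing R]
    (C : Type*) [AddCommGroup C] [Module R C] (e : ℕ∞) : Prop :=
  Tendsto (fun n : ℕ =>
      Module.length R (C ⧸ ((maximalIdeal R) ^ (n + 1) • (⊤ : Submodule R C)))) atTop (𝓝 e)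

/-- A one-dimensional almost Gorenstein local ring: a one-dimensional Cohen-Macaulay local ring
with a canonical module `K` and an exact sequence `0 → R → K → C → 0` such that the minimal
number of generators of `C` equals the multiplicity of `C` with respect to the maximal ideal. -/
def IsAlmostGorenstein (R : Type u) [CommRing R] [IsLocalRing R] : Prop :=
  IsCohenMacaulayLocal R ∧ ringKrullDim R = 1 ∧
    ∃ (K : Type u) (_ : AddCommGroup K) (_ : Module R K), IsCanonicalModule R K ∧
      ∃ φ : R →ₗ[R] K, Function.Injective φ ∧
        IsMultiplicity R (K ⧸ LinearMap.range φ)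
          (((⊤ : Submodule R (K ⧸ LinearMap.range φ)).spanFinrank : ℕ) : ℕ∞)

/-- A fractional canonical ideal of `R`: an `R`-submodule `K` of the total ring of fractions `Q(R)`
with `R ⊆ K ⊆ R̄`, where `R̄` is the integral closure of `R` in `Q(R)`, which is a canonical
module of `R`. Here `(1 : Submodule R _)` is the image of `R` in `Q(R)`. -/
structure IsFractionalCanonicalIdeal (R : Type u) [CommRing R] [IsLocalRing R]
    (K : Submodule R (FractionRing R)) : Prop where
  one_le : 1 ≤ K
  le_integralClosure : K ≤ Subalgebra.toSubmodule (integralClosure R (FractionRing R))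
  isCanonicalModule : IsCanonicalModule R K

/-- The ideal `𝔞 = R : R[K]` of `R`. As `1 ∈ R[K]`, all elements `x` of `Q(R)` with
`x R[K] ⊆ R` belong to `R`. -/
def canonicalConductor (R : Type u) [CommRing R] (K : Submodule R (FractionRing R)) : Ideal R :=
  (1 : Submodule R (FractionRing R)).colon
    (Algebra.adjoin R (K : Set (FractionRing R)) : Set (FractionRing R))

/-- A one-dimensional generalized Gorenstein ring: a one-dimensional Cohen-Macaulay local ring with
a fractional canonical ideal `K` which is either Gorenstein, or is not Gorenstein and such that
`K / R` is a free `R/𝔞`-module, where `𝔞 = R : R[K]` (i.e. `K / R` is isomorphic to a direct sum of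
copies of `R/𝔞`). -/
def IsGeneralizedGorenstein (R : Type u) [CommRing R] [IsLocalRing R] : Prop :=
  IsCohenMacaulayLocal R ∧ ringKrullDim R = 1 ∧
    ∃ K : Submodule R (FractionRing R), IsFractionalCanonicalIdeal R K ∧
      (IsGorensteinLocal R ∨
        (¬ IsGorensteinLocal R ∧
          ∃ ι : Type u, Nonempty
            ((K ⧸ (1 : Submodule R (FractionRing R)).submoduleOf K) ≃ₗ[R]
              (ι →₀ R ⧸ canonicalConductor R K))))

end

/-!
The proof is carried out with fractional ideals. Let `R` be a one-dimensional Cohen-Macaulay local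
ring with maximal ideal `𝔪`, and let `L` be a finitely generated `R`-submodule of `Q(R)` containing
a unit. Multiplication identifies `Ext¹(k, L)` with `(L : 𝔪) / L`, and `L` is a canonical module if
and only if this quotient is simple, written `L ⋖ colonMax L` (`IsCanonicalModule.covBy`,
`isCanonicalModule_of_covBy`). For such an `L`, counting lengths gives the duality `L : (L : X) = X`
(`div_div_cancel_of_covBy`), in particular `L : L = R`. As `μ(C) = e⁰(C)` means `𝔪 C = 0`, the ring
`R` is almost Gorenstein if and only if there is a canonical `L ∋ 1` with `𝔪 L ⊆ R`
(`isAlmostGorenstein_iff`). Over an infinite residue field one may move `L` by a unit of `𝔪 : 𝔪`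
chosen outside its maximal ideals, and obtains the equivalent condition that there is a canonical
`L` with `𝔪 ⊆ L ⊆ 𝔪 : 𝔪` and `1 ∉ L` (`HasCanonicalBelowEndMax`).

For the fiber product `A` of `R` and `S`, with maximal ideal `J = 𝔪 × 𝔫`, one has
`Q(A) = Q(R) × Q(S)`, and `A : J = J : J` because `A` is not a discrete valuation ring. If `L` and
`M` are canonical ideals of `R` and `S` as in the last condition, then `K = A + L × M` is a canonical
ideal of `A` with `J K ⊆ A`. Conversely, if `K ∋ 1` is a canonical ideal of `A` with `J K ⊆ A`, then
`L = {l | (l, 0) ∈ K}` is canonical, since `(L : 𝔪) / L` embeds into `(K : J) / K`, and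
`𝔪 ⊆ L ⊆ 𝔪 : 𝔪`. This shows that `A` is almost Gorenstein if and only if `R` and `S` are.

If `A` is almost Gorenstein, the ideal `K` lies in `J : J`, so that it is integral over `A` and
`A : A[K]` is `J` unless `A` is Gorenstein; the vector space `K / A` over `A / J` is free. If `A` is
generalized Gorenstein but not Gorenstein, suppose that `𝔞 = A : A[K]`, the largest ideal of `A`
stable under `K`, does not contain `J`. Then the socle of `K / A` lies in `J (K / A)`, so that the
idempotent `(1, 0)`, being outside `A + J A[K]`, is not in `K`. This forces `K = A + L × M` with `L`
and `M` canonical, and duality gives `J ⊆ J (L × M) + 𝔞`, where a factor that is a discrete valuation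
ring contributes to `𝔞`. By Nakayama's lemma `L × M` is generated modulo `𝔞` by lifts of a basis of
`K / A`, and the relations of this basis show `J ⊆ 𝔞` after all (`maximalIdeal_le_of_free`). Hence
`J K ⊆ A`.
-/

noncomputable section

set_option linter.unusedSectionVars false

/-! ### Relative lengths -/

section RelLength

variable {R : Type*} [CommRing R] {M : Type*} [AddCommGroup M] [Module R M]
  {M' : Type*} [AddCommGroup M'] [Module R M']

/-- The length of `Y / X` for submodules `X ≤ Y` of a common module (for arbitrary `X` and `Y`,
the length of `Y / (X ⊓ Y)`). -/
def relLength (X Y : Submodule R M) : ℕ∞ :=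
  Module.length R (Y ⧸ X.submoduleOf Y)

lemma relLength_le_of_map {X Y : Submodule R M} {X' Y' : Submodule R M'} (f : M →ₗ[R] M')
    (hY : ∀ y ∈ Y, f y ∈ Y') (hX : ∀ y ∈ Y, (f y ∈ X' ↔ y ∈ X)) :
    relLength X Y ≤ relLength X' Y' := by
  refine Module.length_le_of_injective
    (Submodule.mapQ (X.submoduleOf Y) (X'.submoduleOf Y') (f.restrict hY) ?_) ?_
  · rintro ⟨y, hy⟩ h
    exact (hX y hy).2 h
  · rw [← LinearMap.ker_eq_bot, Submodule.ker_mapQ, Submodule.eq_bot_iff]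
    rintro _ ⟨⟨y, hy⟩, h, rfl⟩
    rw [Submodule.mkQ_apply, Submodule.Quotient.mk_eq_zero]
    exact (hX y hy).1 h

lemma relLength_eq_add {X Y Z : Submodule R M} (hXY : X ≤ Y) (hYZ : Y ≤ Z) :
    relLength X Z = relLength X Y + relLength Y Z := by
  have h1 : X.submoduleOf Y ≤ (X.submoduleOf Z).comap (Submodule.inclusion hYZ) := fun _ h => h
  have h2 : X.submoduleOf Z ≤ Y.submoduleOf Z := fun _ h => hXY h
  refine Module.length_eq_add_of_exact
    (Submodule.mapQ (X.submoduleOf Y) (X.submoduleOf Z) (Submodule.inclusion hYZ) h1)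
    (Submodule.factor h2) ?_ (Submodule.factor_surjective h2) ?_
  · rw [← LinearMap.ker_eq_bot, Submodule.ker_mapQ, Submodule.eq_bot_iff]
    rintro _ ⟨⟨y, hy⟩, h, rfl⟩
    rw [Submodule.mkQ_apply, Submodule.Quotient.mk_eq_zero]
    exact h
  · intro z
    obtain ⟨⟨z, hz⟩, rfl⟩ := Submodule.Quotient.mk_surjective _ z
    constructor
    · intro h
      have hzY : z ∈ Y := by
        have h' : (Submodule.Quotient.mk ⟨z, hz⟩ : Z ⧸ Y.submoduleOf Z) = 0 := h
        rw [Submodule.Quotient.mk_eq_zero] at h'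
        exact h'
      exact ⟨Submodule.Quotient.mk ⟨z, hzY⟩, rfl⟩
    · rintro ⟨y, hy⟩
      obtain ⟨⟨y, hyY⟩, rfl⟩ := Submodule.Quotient.mk_surjective _ y
      rw [← hy]
      exact (Submodule.Quotient.mk_eq_zero _).2 hyY

lemma relLength_eq_zero_iff {X Y : Submodule R M} : relLength X Y = 0 ↔ Y ≤ X := by
  rw [relLength, Module.length_eq_zero_iff, Submodule.Quotient.subsingleton_iff,
    Submodule.submoduleOf, Submodule.comap_subtype_eq_top]

lemma relLength_eq_one_iff {X Y : Submodule R M} (h : X ≤ Y) : relLength X Y = 1 ↔ X ⋖ Y := by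
  rw [covBy_iff_quot_is_simple h, relLength, Module.length_eq_one_iff]
  rfl

lemma relLength_mono_right {X Y Z : Submodule R M} (h : Y ≤ Z) :
    relLength X Y ≤ relLength X Z :=
  relLength_le_of_map LinearMap.id (fun _ hy => h hy) (fun _ _ => Iff.rfl)

/-- A nonzero module `Y / X` of finite length over a local ring has a nonzero socle. -/
lemma exists_smul_mem_of_relLength_ne_top [IsLocalRing R] {X Y : Submodule R M}
    (hfin : relLength X Y ≠ ⊤) (h : ¬ Y ≤ X) :
    ∃ y ∈ Y, y ∉ X ∧ ∀ a ∈ maximalIdeal R, a • y ∈ X := by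
  rw [relLength, Module.length_ne_top_iff, isFiniteLength_iff_isNoetherian_isArtinian] at hfin
  obtain ⟨_, _⟩ := hfin
  have hnt : Nontrivial (Y ⧸ X.submoduleOf Y) := by
    rw [← not_subsingleton_iff_nontrivial, Submodule.Quotient.subsingleton_iff,
      Submodule.submoduleOf, Submodule.comap_subtype_eq_top]
    exact h
  obtain ⟨S, hS, -⟩ := (eq_bot_or_exists_atom_le
    (⊤ : Submodule R (Y ⧸ X.submoduleOf Y))).resolve_left top_ne_bot
  have : IsSimpleModule R S := isSimpleModule_iff_isAtom.2 hS
  have hann : Module.annihilator R S = maximalIdeal R :=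
    eq_maximalIdeal IsSimpleModule.annihilator_isMaximal
  obtain ⟨s, hs, hs0⟩ := S.ne_bot_iff.1 hS.1
  obtain ⟨⟨y, hy⟩, rfl⟩ := Submodule.Quotient.mk_surjective _ s
  refine ⟨y, hy, fun hyX => hs0 ((Submodule.Quotient.mk_eq_zero _).2 hyX), fun a ha => ?_⟩
  rw [← hann, Module.mem_annihilator] at ha
  have := congrArg Subtype.val (ha ⟨_, hs⟩)
  rw [Submodule.coe_smul, Submodule.coe_zero, ← Submodule.Quotient.mk_smul,
    Submodule.Quotient.mk_eq_zero] at this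
  exact this

lemma isFiniteLength_of_smul_eq_zero [IsNoetherianRing R] [Ring.KrullDimLE 1 R] {x : R}
    (hx : x ∈ nonZeroDivisors R) [Module.Finite R M] (h : ∀ m : M, x • m = 0) :
    IsFiniteLength R M := by
  obtain ⟨n, f, hf⟩ := Module.Finite.exists_fin' R M
  have hfl : IsFiniteLength R (Fin n → R ⧸ Ideal.span {x}) := by
    obtain ⟨_, _⟩ := isFiniteLength_iff_isNoetherian_isArtinian.1
      (isFiniteLength_quotient_span_singleton R hx)
    exact isFiniteLength_iff_isNoetherian_isArtinian.2 ⟨inferInstance, inferInstance⟩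
  -- `Rⁿ → M` factors through `(R / x)ⁿ`
  let g : (Fin n → R ⧸ Ideal.span {x}) →ₗ[R] M :=
    LinearMap.lsum R (fun _ : Fin n => R ⧸ Ideal.span {x}) ℕ fun i =>
      Submodule.liftQ (Ideal.span {x}) (f ∘ₗ LinearMap.single R (fun _ => R) i) (by
        rw [Ideal.span, Submodule.span_le, Set.singleton_subset_iff]
        have : (Pi.single i x : Fin n → R) = x • Pi.single i 1 := by
          rw [← Pi.single_smul]; simp
        simp [this, h])
  refine hfl.of_surjective (f := g) fun m => ?_
  obtain ⟨v, rfl⟩ := hf m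
  refine ⟨fun i => Submodule.Quotient.mk (v i), ?_⟩
  have : v = ∑ i, Pi.single i (v i) := (Finset.univ_sum_single v).symm
  conv_rhs => rw [this, map_sum]
  simp only [g, LinearMap.lsum_apply, LinearMap.sum_apply, LinearMap.comp_apply,
    LinearMap.proj_apply]
  exact Finset.sum_congr rfl fun i _ => Submodule.liftQ_apply _ _ _

end RelLength

/-! ### Fractional ideals and duality -/

section ColonMax

variable {R : Type*} [CommRing R] [IsLocalRing R]

/-- The submodule `(N :_M 𝔪) = {q ∈ M | 𝔪 q ⊆ N}` of `M`. -/
def colonMax {M : Type*} [AddCommGroup M] [Module R M] (N : Submodule R M) : Submodule R M where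
  carrier := {q | ∀ a ∈ maximalIdeal R, a • q ∈ N}
  add_mem' hp hq a ha := by rw [smul_add]; exact N.add_mem (hp a ha) (hq a ha)
  zero_mem' a _ := by rw [smul_zero]; exact N.zero_mem
  smul_mem' r q hq a ha := by rw [smul_comm]; exact N.smul_mem r (hq a ha)

lemma mem_colonMax {M : Type*} [AddCommGroup M] [Module R M] {N : Submodule R M} {q : M} :
    q ∈ colonMax N ↔ ∀ a ∈ maximalIdeal R, a • q ∈ N := Iff.rfl

lemma le_colonMax {M : Type*} [AddCommGroup M] [Module R M] (N : Submodule R M) :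
    N ≤ colonMax N := fun _ hq a _ => N.smul_mem a hq

end ColonMax

section Fractional

variable {R : Type*} [CommRing R]

variable {Q : Type*} [CommRing Q] [Algebra R Q]

/-- A regular fractional ideal: a finitely generated `R`-submodule of `Q` containing a unit of
`Q`. -/
structure IsRegularFractional (X : Submodule R Q) : Prop where
  fg : X.FG
  exists_unit : ∃ w : Qˣ, (w : Q) ∈ X

/-- The fractional ideal `w X` for a unit `w` of `Q`. -/
def scale (w : Qˣ) (X : Submodule R Q) : Submodule R Q :=
  X.map (LinearMap.mulLeft R (w : Q))

lemma mem_scale {w : Qˣ} {X : Submodule R Q} {q : Q} : q ∈ scale w X ↔ ↑w⁻¹ * q ∈ X := by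
  constructor
  · rintro ⟨p, hp, rfl⟩
    simpa using hp
  · intro h
    exact ⟨_, h, by simp⟩

lemma mul_mem_scale {w : Qˣ} {X : Submodule R Q} {q : Q} (hq : q ∈ X) : ↑w * q ∈ scale w X :=
  ⟨q, hq, rfl⟩

lemma scale_mono {w : Qˣ} {X Y : Submodule R Q} (h : X ≤ Y) : scale w X ≤ scale w Y :=
  Submodule.map_mono h

lemma scale_inv_scale (w : Qˣ) (X : Submodule R Q) : scale w⁻¹ (scale w X) = X := by
  ext q; simp [mem_scale]

lemma scale_inv_scale' (w : Qˣ) (X : Submodule R Q) : scale w (scale w⁻¹ X) = X := by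
  ext q; simp [mem_scale]

lemma colonMax_scale [IsLocalRing R] (w : Qˣ) (X : Submodule R Q) :
    colonMax (scale w X) = scale w (colonMax X) := by
  ext q; simp [mem_scale, mem_colonMax]

lemma IsRegularFractional.scale {X : Submodule R Q} (hX : IsRegularFractional X) (w : Qˣ) :
    IsRegularFractional (scale w X) :=
  ⟨hX.fg.map _, let ⟨v, hv⟩ := hX.exists_unit; ⟨w * v, by simpa [mem_scale] using hv⟩⟩

lemma relLength_scale (w : Qˣ) (X Y : Submodule R Q) :
    relLength (scale w X) (scale w Y) = relLength X Y := by
  apply le_antisymm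
  · exact relLength_le_of_map (LinearMap.mulLeft R ((w⁻¹ : Qˣ) : Q))
      (fun y hy => mem_scale.1 hy) (fun y _ => mem_scale.symm)
  · exact relLength_le_of_map (LinearMap.mulLeft R (w : Q))
      (fun y hy => mul_mem_scale hy) (fun y _ => by simp [mem_scale])

lemma scale_covBy_scale {w : Qˣ} {X Y : Submodule R Q} (h : X ⋖ Y) : scale w X ⋖ scale w Y := by
  rw [← relLength_eq_one_iff (scale_mono h.le), relLength_scale, relLength_eq_one_iff h.le]
  exact h

lemma div_scale (w : Qˣ) (L X : Submodule R Q) : L / scale w X = scale w⁻¹ (L / X) := by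
  ext q
  simp only [mem_scale, Submodule.mem_div_iff_forall_mul_mem, inv_inv]
  constructor
  · intro h y hy
    rw [show ↑w * q * y = q * (↑w * y) by ring]
    exact h _ (by simpa using hy)
  · intro h y hy
    rw [show q * y = (↑w * ↑w⁻¹) * (q * y) by simp,
      show (↑w * ↑w⁻¹) * (q * y) = ↑w * q * (↑w⁻¹ * y) by ring]
    exact h _ hy

lemma div_antitone {L X Y : Submodule R Q} (h : X ≤ Y) : L / Y ≤ L / X := fun _ hq =>
  Submodule.mem_div_iff_forall_mul_mem.2 fun y hy =>
    Submodule.mem_div_iff_forall_mul_mem.1 hq y (h hy)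

lemma le_div_div (L X : Submodule R Q) : X ≤ L / (L / X) := fun x hx =>
  Submodule.mem_div_iff_forall_mul_mem.2 fun y hy => by
    rw [mul_comm]; exact Submodule.mem_div_iff_forall_mul_mem.1 hy x hx

lemma div_mul_eq (L X Y : Submodule R Q) : L / (X * Y) = (L / X) / Y := by
  apply le_antisymm
  · intro q hq
    simp only [Submodule.mem_div_iff_forall_mul_mem] at hq ⊢
    intro y hy x hx
    rw [mul_assoc, mul_comm y x]
    exact hq _ (Submodule.mul_mem_mul hx hy)
  · rw [Submodule.le_div_iff_mul_le, mul_comm X Y, ← mul_assoc, ← Submodule.le_div_iff_mul_le,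
      ← Submodule.le_div_iff_mul_le]

lemma submodule_div_one (L : Submodule R Q) : L / 1 = L := by
  ext q
  rw [Submodule.mem_div_iff_forall_mul_mem]
  constructor
  · intro h; simpa using h 1 (Submodule.one_le.1 le_rfl)
  · rintro h y hy
    obtain ⟨r, rfl⟩ := Submodule.mem_one.1 hy
    rw [mul_comm, ← Algebra.smul_def]
    exact L.smul_mem r h

variable [IsFractionRing R Q]

/-- The unit of the total ring of fractions given by a regular element of `R`. -/
def regUnit (Q : Type*) [CommRing Q] [Algebra R Q] [IsFractionRing R Q] {x : R}
    (hx : x ∈ nonZeroDivisors R) : Qˣ :=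
  (IsLocalization.map_units Q (⟨x, hx⟩ : nonZeroDivisors R)).unit

@[simp] lemma coe_regUnit {x : R} (hx : x ∈ nonZeroDivisors R) :
    (regUnit Q hx : Q) = algebraMap R Q x := rfl

variable (R Q) in
/-- `R` as a fractional ideal. -/
def oneEquiv : R ≃ₗ[R] (1 : Submodule R Q) :=
  (LinearEquiv.ofInjective (Algebra.linearMap R Q) (IsFractionRing.injective R Q)).trans
    (LinearEquiv.ofEq _ _ Submodule.one_eq_range.symm)

/-- Every finitely generated submodule of `Q` is carried into `R` by a regular element. -/
lemma exists_smul_mem_one {Y : Submodule R Q} (hY : Y.FG) :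
    ∃ d ∈ nonZeroDivisors R, ∀ y ∈ Y, d • y ∈ (1 : Submodule R Q) := by
  obtain ⟨s, rfl⟩ := hY
  obtain ⟨d, hd⟩ := IsLocalization.exist_integer_multiples_of_finset (nonZeroDivisors R) s
  refine ⟨d, d.2, fun y hy => ?_⟩
  induction hy using Submodule.span_induction with
  | mem y hy => obtain ⟨r, hr⟩ := hd y hy; exact Submodule.mem_one.2 ⟨r, hr⟩
  | zero => rw [smul_zero]; exact zero_mem _
  | add y z _ _ h1 h2 => rw [smul_add]; exact add_mem h1 h2
  | smul r y _ h => rw [smul_comm]; exact Submodule.smul_mem _ r h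

lemma exists_smul_mem {X Y : Submodule R Q} (hX : IsRegularFractional X) (hY : Y.FG) :
    ∃ d ∈ nonZeroDivisors R, ∀ y ∈ Y, d • y ∈ X := by
  obtain ⟨w, hw⟩ := hX.exists_unit
  obtain ⟨d, hd, h⟩ := exists_smul_mem_one (hY.map (LinearMap.mulLeft R ((w⁻¹ : Qˣ) : Q)))
  refine ⟨d, hd, fun y hy => ?_⟩
  obtain ⟨r, hr⟩ := Submodule.mem_one.1 (h _ ⟨y, hy, rfl⟩)
  have : d • y = r • (w : Q) := by
    rw [Algebra.smul_def r, hr, smul_mul_assoc, LinearMap.mulLeft_apply, mul_right_comm]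
    simp
  rw [this]
  exact X.smul_mem r hw

variable [IsNoetherianRing R]

lemma fg_of_le {X Y : Submodule R Q} (hY : Y.FG) (h : X ≤ Y) : X.FG := by
  have := Module.Finite.iff_fg.2 hY
  have := isNoetherian_of_isNoetherianRing_of_finite R Y
  exact Module.Finite.iff_fg.1
    (Module.Finite.of_injective (Submodule.inclusion h) (Submodule.inclusion_injective h))

lemma IsRegularFractional.div {L X : Submodule R Q} (hL : IsRegularFractional L)
    (hX : IsRegularFractional X) : IsRegularFractional (L / X) := by
  constructor
  · obtain ⟨w, hw⟩ := hX.exists_unit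
    refine fg_of_le (hL.scale w⁻¹).fg fun q hq => ?_
    rw [mem_scale, inv_inv, mul_comm]
    exact Submodule.mem_div_iff_forall_mul_mem.1 hq _ hw
  · obtain ⟨d, hd, h⟩ := exists_smul_mem hL hX.fg
    refine ⟨regUnit Q hd, Submodule.mem_div_iff_forall_mul_mem.2 fun y hy => ?_⟩
    rw [coe_regUnit, ← Algebra.smul_def]
    exact h y hy

lemma IsRegularFractional.sup {X Y : Submodule R Q} (hX : IsRegularFractional X)
    (hY : IsRegularFractional Y) : IsRegularFractional (X ⊔ Y) :=
  ⟨hX.fg.sup hY.fg, let ⟨w, hw⟩ := hX.exists_unit; ⟨w, Submodule.mem_sup_left hw⟩⟩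

lemma IsRegularFractional.mul {X Y : Submodule R Q} (hX : IsRegularFractional X)
    (hY : IsRegularFractional Y) : IsRegularFractional (X * Y) :=
  ⟨hX.fg.mul hY.fg, let ⟨w, hw⟩ := hX.exists_unit; let ⟨v, hv⟩ := hY.exists_unit
    ⟨w * v, Submodule.mul_mem_mul hw hv⟩⟩

lemma isRegularFractional_one : IsRegularFractional (1 : Submodule R Q) :=
  ⟨by rw [Submodule.one_eq_span]; exact Submodule.fg_span_singleton _,
    1, (Submodule.one_le.1 le_rfl)⟩

variable [Ring.KrullDimLE 1 R]

lemma relLength_ne_top {X Y : Submodule R Q} (hX : IsRegularFractional X) (hY : Y.FG) :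
    relLength X Y ≠ ⊤ := by
  obtain ⟨d, hd, h⟩ := exists_smul_mem hX hY
  have := Module.Finite.iff_fg.2 hY
  rw [relLength, Module.length_ne_top_iff]
  refine isFiniteLength_of_smul_eq_zero hd fun m => ?_
  obtain ⟨⟨y, hy⟩, rfl⟩ := Submodule.Quotient.mk_surjective _ m
  rw [← Submodule.Quotient.mk_smul, Submodule.Quotient.mk_eq_zero]
  exact h y hy

lemma scale_le_self {w : Qˣ} {r : R} (hw : (w : Q) = algebraMap R Q r) (X : Submodule R Q) :
    scale w X ≤ X := by
  rintro _ ⟨q, hq, rfl⟩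
  rw [LinearMap.mulLeft_apply, hw, ← Algebra.smul_def]
  exact X.smul_mem r hq

/-- The length of `X / x X` is the same for all regular fractional ideals `X`. -/
lemma relLength_scale_self_eq {X Y : Submodule R Q} (hX : IsRegularFractional X)
    (hY : IsRegularFractional Y) {x : R} (hx : x ∈ nonZeroDivisors R) :
    relLength (scale (regUnit Q hx) X) X = relLength (scale (regUnit Q hx) Y) Y := by
  set w := regUnit Q hx
  have key : ∀ {X Y : Submodule R Q}, IsRegularFractional X → IsRegularFractional Y → X ≤ Y →
      relLength (scale w X) X = relLength (scale w Y) Y := by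
    intro X Y hX hY h
    have h1 := relLength_eq_add (scale_le_self (coe_regUnit hx) X) h
    have h2 := relLength_eq_add (scale_mono (w := w) h) (scale_le_self (coe_regUnit hx) Y)
    rw [relLength_scale, h1, add_comm] at h2
    exact WithTop.add_left_cancel (relLength_ne_top hX hY.fg) h2
  rw [key hX (hX.sup hY) le_sup_left, key hY (hX.sup hY) le_sup_right]

variable [IsLocalRing R]

/-- Dualizing into a fractional ideal `L` with `(L : 𝔪) / L` simple does not increase lengths. -/
lemma relLength_div_le {L : Submodule R Q} (hL : L ⋖ colonMax L) (n : ℕ) :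
    ∀ {X Y : Submodule R Q}, X ≤ Y → relLength X Y ≤ n → relLength (L / Y) (L / X) ≤ n := by
  induction n with
  | zero =>
    intro X Y _ h
    rw [Nat.cast_zero, nonpos_iff_eq_zero, relLength_eq_zero_iff] at h ⊢
    exact div_antitone h
  | succ n ih =>
    intro X Y hXY h
    by_cases hYX : Y ≤ X
    · rw [relLength_eq_zero_iff.2 (div_antitone hYX)]
      exact bot_le
    obtain ⟨y, hyY, hyX, hy⟩ := exists_smul_mem_of_relLength_ne_top
      (ne_top_of_le_ne_top (ENat.natCast_ne_top _) h) hYX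
    let Z := X ⊔ Submodule.span R {y}
    have hXZ : X ≤ Z := le_sup_left
    have hyZ : y ∈ Z := Submodule.mem_sup_right (Submodule.mem_span_singleton_self y)
    have hZY : Z ≤ Y := sup_le hXY (by simpa using hyY)
    have hpos : 1 ≤ relLength X Z := by
      rw [Order.one_le_iff_ne_zero, Ne, relLength_eq_zero_iff]
      exact fun h' => hyX (h' hyZ)
    have hZ : relLength Z Y ≤ n := by
      rw [relLength_eq_add hXZ hZY, Nat.cast_add, Nat.cast_one, add_comm] at h
      exact (ENat.add_le_add_iff_right ENat.one_ne_top).1 ((add_le_add_right hpos _).trans h)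
    have h1 : relLength (L / Z) (L / X) ≤ 1 := by
      rw [← (relLength_eq_one_iff hL.le).2 hL]
      refine relLength_le_of_map (LinearMap.mulRight R y) (fun z hz a ha => ?_) (fun z hz => ?_)
      · rw [LinearMap.mulRight_apply, ← mul_smul_comm]
        exact Submodule.mem_div_iff_forall_mul_mem.1 hz _ (hy a ha)
      · rw [LinearMap.mulRight_apply]
        refine ⟨fun hzy => Submodule.mem_div_iff_forall_mul_mem.2 fun q hq => ?_,
          fun h' => Submodule.mem_div_iff_forall_mul_mem.1 h' y hyZ⟩
        obtain ⟨p, hp, _, hr, rfl⟩ := Submodule.mem_sup.1 hq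
        obtain ⟨r, rfl⟩ := Submodule.mem_span_singleton.1 hr
        rw [mul_add, mul_smul_comm]
        exact add_mem (Submodule.mem_div_iff_forall_mul_mem.1 hz p hp) (L.smul_mem r hzy)
    calc relLength (L / Y) (L / X)
        = relLength (L / Y) (L / Z) + relLength (L / Z) (L / X) :=
          relLength_eq_add (div_antitone hZY) (div_antitone hXZ)
      _ ≤ n + 1 := add_le_add (ih hZY hZ) h1
      _ = (n + 1 : ℕ) := by simp

/-- Biduality for regular fractional ideals. The lengths of `X'' / X` and of its dual
`X' / X''' = 0` agree, since both sides of the inequality `relLength_div_le` add up to the same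
number along `x X'' ≤ X ≤ X''`. -/
lemma div_div_cancel_of_covBy {L X : Submodule R Q} (hLr : IsRegularFractional L)
    (hL : L ⋖ colonMax L) (hX : IsRegularFractional X) : L / (L / X) = X := by
  set Y := L / (L / X) with hYdef
  have hY : IsRegularFractional Y := hLr.div (hLr.div hX)
  have hXY : X ≤ Y := le_div_div L X
  have hLY : L / Y = L / X := le_antisymm (div_antitone hXY) (le_div_div L (L / X))
  obtain ⟨d, hd, h⟩ := exists_smul_mem hX hY.fg
  set w := regUnit Q hd
  have hwX : scale w Y ≤ X := by
    rintro _ ⟨q, hq, rfl⟩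
    rw [LinearMap.mulLeft_apply, coe_regUnit, ← Algebra.smul_def]
    exact h q hq
  have hle : ∀ {X Y : Submodule R Q}, IsRegularFractional X → Y.FG → X ≤ Y →
      relLength (L / Y) (L / X) ≤ relLength X Y := by
    intro X Y hX hY hXY
    have := relLength_div_le hL (relLength X Y).toNat hXY
    rw [ENat.natCast_toNat (relLength_ne_top hX hY)] at this
    exact this le_rfl
  have htot : relLength (scale w Y) Y = relLength (L / Y) (L / scale w Y) := by
    rw [div_scale, ← relLength_scale w (L / Y), scale_inv_scale' w]
    exact relLength_scale_self_eq hY (hLr.div hY) hd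
  refine le_antisymm ?_ hXY
  rw [← relLength_eq_zero_iff, ← nonpos_iff_eq_zero,
    ← ENat.add_le_add_iff_left (relLength_ne_top (hY.scale w) hX.fg), add_zero,
    ← relLength_eq_add hwX hXY, htot, hLY]
  exact hle (hY.scale w) hX.fg hwX

lemma div_self_of_covBy {L : Submodule R Q} (hLr : IsRegularFractional L)
    (hL : L ⋖ colonMax L) : L / L = 1 := by
  have := div_div_cancel_of_covBy hLr hL isRegularFractional_one
  rwa [submodule_div_one] at this

end Fractional

/-! ### Canonical modules as fractional ideals -/

section ExtOne

variable {R : Type u} [CommRing R] [IsLocalRing R] {Q : Type u} [CommRing Q] [Algebra R Q]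
  [IsFractionRing R Q]

/-- Multiplication by `q ∈ (L : 𝔪)` as a homomorphism `𝔪 → L`. -/
def colonMaxToHom (L : Submodule R Q) :
    colonMax L →ₗ[R] (LinearMap.ker (Algebra.linearMap R (ResidueField R)) →ₗ[R] L) where
  toFun q :=
    { toFun := fun a => ⟨(a : R) • (q : Q), q.2 a (by
        have := a.2
        rwa [LinearMap.mem_ker, Algebra.linearMap_apply, ResidueField.algebraMap_eq,
          residue_eq_zero_iff] at this)⟩
      map_add' := fun a b => Subtype.ext (add_smul _ _ _)
      map_smul' := fun r a => Subtype.ext (mul_smul _ _ _) }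
  map_add' p q := LinearMap.ext fun a => Subtype.ext (smul_add _ _ _)
  map_smul' r q := LinearMap.ext fun a => Subtype.ext (smul_comm _ _ _)

/-- `Ext¹(k, L) ≅ (L : 𝔪) / L` for a fractional ideal `L`: the long exact sequence of
`0 → 𝔪 → R → k → 0` presents `Ext¹(k, L)` as the cokernel of `L → Hom(𝔪, L)`, and every
homomorphism `𝔪 → L` is multiplication by an element of `Q`. -/
lemma length_ext_one_eq (L : Submodule R Q)
    (hreg : ∃ x ∈ maximalIdeal R, x ∈ nonZeroDivisors R) :
    Module.length R (Abelian.Ext.{u} (ModuleCat.of R (ResidueField R)) (ModuleCat.of R L) 1) =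
      relLength L (colonMax L) := by
  let f := Algebra.linearMap R (ResidueField R)
  have hf : Function.Surjective f := residue_surjective
  let S := LinearMap.shortComplexKer f
  have hS : S.ShortExact := LinearMap.shortExact_shortComplexKer hf
  have : Projective S.X₂ := inferInstanceAs (Projective (ModuleCat.of R R))
  let δ : Abelian.Ext.{u} S.X₁ (ModuleCat.of R L) 0 →ₗ[R]
      Abelian.Ext.{u} S.X₃ (ModuleCat.of R L) 1 :=
    hS.extClass.precompOfLinear R (ModuleCat.of R L) (add_comm 1 0)
  have hδ : Function.Surjective δ := precomp_extClass_surjective_of_projective_X₂ _ hS 0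
  let e : (LinearMap.ker f →ₗ[R] L) ≃ₗ[R] Abelian.Ext.{u} S.X₁ (ModuleCat.of R L) 0 :=
    (Abelian.Ext.linearEquiv₀.trans ModuleCat.homLinearEquiv).symm
  have hmul : Function.Surjective (colonMaxToHom L) := by
    intro g
    obtain ⟨x, hxm, hx⟩ := hreg
    have hmem : ∀ {a : R}, a ∈ maximalIdeal R → a ∈ LinearMap.ker f := fun {a} ha => by
      rwa [LinearMap.mem_ker, Algebra.linearMap_apply, ResidueField.algebraMap_eq,
        residue_eq_zero_iff]
    let q : Q := ↑(regUnit Q hx)⁻¹ * (g ⟨x, hmem hxm⟩ : Q)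
    have hq : ∀ a (ha : a ∈ LinearMap.ker f), a • q = (g ⟨a, ha⟩ : Q) := by
      intro a ha
      have h1 : a • g ⟨x, hmem hxm⟩ = x • g ⟨a, ha⟩ := by
        rw [← map_smul, ← map_smul]
        exact congrArg g (Subtype.ext (mul_comm a x))
      have h2 := congrArg (Subtype.val) h1
      rw [Submodule.coe_smul, Submodule.coe_smul] at h2
      rw [show a • q = ↑(regUnit Q hx)⁻¹ * (a • (g ⟨x, hmem hxm⟩ : Q)) from
        (mul_smul_comm _ _ _).symm, h2, Algebra.smul_def, ← coe_regUnit hx, Units.inv_mul_cancel_left]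
    refine ⟨⟨q, fun a ha => ?_⟩, LinearMap.ext fun a => Subtype.ext (hq a a.2)⟩
    rw [hq a (hmem ha)]
    exact (g _).2
  let G : colonMax L →ₗ[R] Abelian.Ext.{u} S.X₃ (ModuleCat.of R L) 1 :=
    δ ∘ₗ e.toLinearMap ∘ₗ colonMaxToHom L
  have hG : Function.Surjective G := hδ.comp (e.surjective.comp hmul)
  have hker : LinearMap.ker G = L.submoduleOf (colonMax L) := by
    ext q
    rw [LinearMap.mem_ker]
    constructor
    · intro h
      obtain ⟨y, hy⟩ := Abelian.Ext.contravariant_sequence_exact₁ hS (ModuleCat.of R L)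
        (e (colonMaxToHom L q)) (add_comm 1 0) h
      obtain ⟨y, rfl⟩ := Abelian.Ext.homEquiv₀.symm.surjective y
      simp only [e, Abelian.Ext.homEquiv₀_symm_apply, Abelian.Ext.mk₀_comp_mk₀] at hy
      have hy' : S.f ≫ y = ModuleCat.ofHom (colonMaxToHom L q) :=
        Abelian.Ext.homEquiv₀.symm.injective hy
      obtain ⟨x, hxm, hx⟩ := hreg
      have hxk : x ∈ LinearMap.ker f := by
        rwa [LinearMap.mem_ker, Algebra.linearMap_apply, ResidueField.algebraMap_eq,
          residue_eq_zero_iff]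
      have h1 : y.hom x = (colonMaxToHom L q) ⟨x, hxk⟩ :=
        congrArg (fun t => t.hom ⟨x, hxk⟩) hy'
      have h2 : y.hom x = x • y.hom (1 : R) := by
        have := (y.hom.map_smul x (1 : R))
        rwa [smul_eq_mul, mul_one] at this
      have h3 : x • (y.hom (1 : R) : Q) = x • (q : Q) :=
        congrArg Subtype.val (h2.symm.trans h1)
      rw [Algebra.smul_def, Algebra.smul_def, ← coe_regUnit hx, Units.mul_right_inj] at h3
      change (q : Q) ∈ L
      rw [← h3]
      exact Subtype.mem _
    · intro h
      let g : S.X₂ ⟶ ModuleCat.of R L := ModuleCat.ofHom (LinearMap.toSpanSingleton R L ⟨q, h⟩)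
      have hg : e (colonMaxToHom L q) = (Abelian.Ext.mk₀ (S.f ≫ g)) := rfl
      change hS.extClass.comp (e (colonMaxToHom L q)) (add_comm 1 0) = 0
      rw [hg, ← Abelian.Ext.mk₀_comp_mk₀]
      exact hS.extClass_comp_assoc _
  rw [relLength, ← hker]
  exact (G.quotKerEquivOfSurjective hG).length_eq.symm

end ExtOne

section Transport

variable {R : Type u} [CommRing R] [IsLocalRing R] {M N : Type u} [AddCommGroup M] [Module R M]
  [AddCommGroup N] [Module R N]

lemma length_ext_congr (X : ModuleCat.{u} R) (e : M ≃ₗ[R] N) (n : ℕ) :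
    Module.length R (Abelian.Ext.{u} X (ModuleCat.of R M) n) =
      Module.length R (Abelian.Ext.{u} X (ModuleCat.of R N) n) := by
  let i := e.toModuleIso
  let F := (Abelian.Ext.mk₀ i.hom).postcompOfLinear R X (add_zero n)
  let G := (Abelian.Ext.mk₀ i.inv).postcompOfLinear R X (add_zero n)
  refine (LinearEquiv.ofLinearMap F G ?_ ?_).length_eq
  · ext y
    simp [F, G]
  · ext y
    simp [F, G]

lemma IsCanonicalModule.of_linearEquiv (h : IsCanonicalModule R M) (e : M ≃ₗ[R] N) :
    IsCanonicalModule R N where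
  maximalCohenMacaulay := by
    obtain ⟨hfin, rs, hrs, hreg, hdim⟩ := h.maximalCohenMacaulay
    exact ⟨Module.Finite.equiv e, rs, hrs, (e.isRegular_congr rs).1 hreg, hdim⟩
  finiteInjectiveDimension := by
    obtain ⟨n, hn⟩ := h.finiteInjectiveDimension
    exact ⟨n, hasInjectiveDimensionLT_of_iso e.toModuleIso (n + 1)⟩
  type_one d hd := by
    rw [← length_ext_congr _ e]
    exact h.type_one d hd

end Transport

section Injective

variable {R : Type*} [CommRing R] [IsLocalRing R]

lemma length_hom_quotient_le {V M : Type*} [AddCommGroup V] [Module R V] [AddCommGroup M]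
    [Module R M] (N : Submodule R M) :
    Module.length R (M →ₗ[R] V) ≤ Module.length R ((M ⧸ N) →ₗ[R] V) +
      Module.length R (LinearMap.range (LinearMap.lcomp R V N.subtype)) := by
  let res := LinearMap.lcomp R V N.subtype
  rw [Module.length_eq_add_of_exact (LinearMap.ker res).subtype res.rangeRestrict
    (Submodule.injective_subtype _) res.surjective_rangeRestrict
    (LinearMap.exact_iff.2 (by simp))]
  gcongr
  let F : ((M ⧸ N) →ₗ[R] V) →ₗ[R] LinearMap.ker res :=
    (LinearMap.lcomp R V N.mkQ).codRestrict _ fun g => by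
      ext n
      have : (Submodule.Quotient.mk (n : M) : M ⧸ N) = 0 :=
        (Submodule.Quotient.mk_eq_zero N).2 n.2
      simp [res, this]
  refine Module.length_le_of_surjective F fun g => ?_
  refine ⟨N.liftQ g.1 fun n hn => ?_, ?_⟩
  · exact LinearMap.congr_fun g.2 ⟨n, hn⟩
  · ext m
    rfl

/-- If `Hom(k, V)` has length at most one, then `Hom(-, V)` does not increase lengths. -/
lemma length_hom_le {V : Type*} [AddCommGroup V] [Module R V]
    (hV : Module.length R (ResidueField R →ₗ[R] V) ≤ 1) {M : Type*} [AddCommGroup M] [Module R M]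
    (hM : IsFiniteLength R M) : Module.length R (M →ₗ[R] V) ≤ Module.length R M := by
  induction hM with
  | @of_subsingleton M =>
    have : Subsingleton (M →ₗ[R] V) :=
      ⟨fun f g => LinearMap.ext fun m => by rw [Subsingleton.elim m 0, map_zero, map_zero]⟩
    rw [Module.length_eq_zero]
    exact bot_le
  | @of_simple_quotient M _ _ N hs _ ih =>
    obtain ⟨I, hI, ⟨e⟩⟩ := isSimpleModule_iff_quot_maximal.1 hs
    obtain rfl := eq_maximalIdeal hI
    have h1 : Module.length R ((M ⧸ N) →ₗ[R] V) ≤ Module.length R (M ⧸ N) := by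
      rw [Module.length_eq_one R (M ⧸ N)]
      exact (LinearEquiv.congrLeft V R e).length_eq.trans_le hV
    rw [Module.length_eq_add_of_exact N.subtype N.mkQ N.injective_subtype N.mkQ_surjective
      (LinearMap.exact_subtype_mkQ N), add_comm]
    refine (length_hom_quotient_le N).trans (add_le_add h1 (le_trans ?_ ih))
    exact Module.length_le_of_injective _ (Submodule.injective_subtype _)

/-- Counting lengths: if `Hom(-, V)` preserves the length of `Y`, then homomorphisms to `V` extend
from submodules of `Y` to `Y`. -/
lemma exists_extend_of_length_hom_eq {V : Type*} [AddCommGroup V] [Module R V]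
    (hV : Module.length R (ResidueField R →ₗ[R] V) ≤ 1) {Y : Type*} [AddCommGroup Y] [Module R Y]
    (hY : IsFiniteLength R Y) (hlen : Module.length R Y ≤ Module.length R (Y →ₗ[R] V))
    (N : Submodule R Y) (f : N →ₗ[R] V) : ∃ g : Y →ₗ[R] V, g ∘ₗ N.subtype = f := by
  let res := LinearMap.lcomp R V N.subtype
  suffices LinearMap.range res = ⊤ from LinearMap.range_eq_top.1 this f
  have hN : IsFiniteLength R N := hY.of_injective N.injective_subtype
  have hQ : IsFiniteLength R (Y ⧸ N) := hY.of_surjective N.mkQ_surjective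
  have h1 := hlen.trans (length_hom_quotient_le (V := V) N)
  rw [Module.length_eq_add_of_exact N.subtype N.mkQ N.injective_subtype N.mkQ_surjective
      (LinearMap.exact_subtype_mkQ N), add_comm] at h1
  have h2 := (ENat.add_le_add_iff_left (Module.length_ne_top_iff.2 hQ)).1
    (h1.trans (add_le_add_left (length_hom_le hV hQ) _))
  have h3 := length_hom_le hV hN
  have hfl : IsFiniteLength R (N →ₗ[R] V) :=
    Module.length_ne_top_iff.1 (ne_top_of_le_ne_top (Module.length_ne_top_iff.2 hN) h3)
  obtain ⟨_, _⟩ := isFiniteLength_iff_isNoetherian_isArtinian.1 hfl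
  by_contra hne
  exact absurd (Submodule.length_lt hne) (not_lt.2 (h3.trans h2))

variable [IsNoetherianRing R] [Ring.KrullDimLE 1 R]

/-- Let `x` be regular, `x V = 0`, `length V = length (R / x)` and `length Hom(k, V) ≤ 1`. Then
`V` is injective relative to `Z / x Z ⊆ F / x F` for `F` free. -/
lemma exists_extend_of_smul_eq_zero {V : Type*} [AddCommGroup V] [Module R V]
    (hV : Module.length R (ResidueField R →ₗ[R] V) ≤ 1) {x : R} (hx : x ∈ nonZeroDivisors R)
    (hxV : ∀ v : V, x • v = 0) (hlen : Module.length R (R ⧸ Ideal.span {x}) ≤ Module.length R V)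
    {n : ℕ} (Z : Submodule R (Fin n → R)) (hZ : ∀ v, x • v ∈ Z → v ∈ Z) (f : Z →ₗ[R] V) :
    ∃ g : (Fin n → R) →ₗ[R] V, g ∘ₗ Z.subtype = f := by
  let B := R ⧸ Ideal.span {x}
  let p : (Fin n → R) →ₗ[R] (Fin n → B) := LinearMap.pi fun i =>
    (Ideal.span {x}).mkQ ∘ₗ LinearMap.proj i
  have hp : ∀ v, p v = 0 → ∃ w, v = x • w := by
    intro v hv
    have : ∀ i, ∃ r, v i = x * r := fun i => by
      have h := congrFun hv i
      exact Ideal.mem_span_singleton.1 ((Submodule.Quotient.mk_eq_zero _).1 h)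
    choose w hw using this
    exact ⟨w, funext hw⟩
  have hB : IsFiniteLength R B := isFiniteLength_quotient_span_singleton R hx
  have hY : IsFiniteLength R (Fin n → B) := by
    obtain ⟨_, _⟩ := isFiniteLength_iff_isNoetherian_isArtinian.1 hB
    exact isFiniteLength_iff_isNoetherian_isArtinian.2 ⟨inferInstance, inferInstance⟩
  -- `Hom(R / x, V) = V`
  let ev : V →ₗ[R] (B →ₗ[R] V) :=
    { toFun := fun v => (Ideal.span {x}).liftQ (LinearMap.toSpanSingleton R V v) (by
        rw [Ideal.span, Submodule.span_le, Set.singleton_subset_iff]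
        simp [hxV])
      map_add' := fun v w =>
        Submodule.linearMap_qext _ (LinearMap.ext fun r => smul_add r v w)
      map_smul' := fun r v =>
        Submodule.linearMap_qext _ (LinearMap.ext fun s => smul_comm s r v) }
  have hev : Function.Injective ev := fun v w h => by
    have : (1 : R) • v = (1 : R) • w := LinearMap.congr_fun h (Submodule.Quotient.mk 1)
    simpa using this
  have hlenY : Module.length R (Fin n → B) ≤ Module.length R ((Fin n → B) →ₗ[R] V) := by
    rw [← (LinearMap.lsum R (fun _ : Fin n => B) R (M := V)).length_eq,
      Module.length_pi_of_fintype, Module.length_pi_of_fintype]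
    exact Finset.sum_le_sum fun i _ => hlen.trans (Module.length_le_of_injective ev hev)
  let q : Z →ₗ[R] Z.map p := p.submoduleMap Z
  have hq : Function.Surjective q := p.submoduleMap_surjective Z
  have hker : LinearMap.ker q ≤ LinearMap.ker f := by
    rintro ⟨z, hz⟩ h
    obtain ⟨w, rfl⟩ := hp z (congrArg Subtype.val h)
    have : (⟨x • w, hz⟩ : Z) = x • ⟨w, hZ w hz⟩ := rfl
    rw [LinearMap.mem_ker, this, map_smul, hxV]
  let f' : Z.map p →ₗ[R] V :=
    (LinearMap.ker q).liftQ f hker ∘ₗ (q.quotKerEquivOfSurjective hq).symm.toLinearMap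
  obtain ⟨g, hg⟩ := exists_extend_of_length_hom_eq hV hY hlenY (Z.map p) f'
  refine ⟨g ∘ₗ p, LinearMap.ext fun z => ?_⟩
  have h1 : g (p z) = f' (q z) := LinearMap.congr_fun hg (q z)
  have h2 : (q.quotKerEquivOfSurjective hq).symm (q z) = Submodule.Quotient.mk z := by
    rw [LinearEquiv.symm_apply_eq]
    rfl
  change g (p z) = f z
  rw [h1]
  change (LinearMap.ker q).liftQ f hker ((q.quotKerEquivOfSurjective hq).symm (q z)) = f z
  rw [h2]
  rfl

end Injective

section InjectiveDimension

variable {R : Type u} [CommRing R] [IsLocalRing R] [IsNoetherianRing R] [Ring.KrullDimLE 1 R]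

lemma isRegular_singleton {R M : Type*} [CommRing R] [IsLocalRing R] [AddCommGroup M] [Module R M]
    [Module.Finite R M] [Nontrivial M] {x : R} (hxm : x ∈ maximalIdeal R) (hx : IsSMulRegular M x) :
    RingTheory.Sequence.IsRegular M [x] := by
  refine (RingTheory.Sequence.isRegular_cons_iff M x []).2 ⟨hx, ?_⟩
  have : Nontrivial (QuotSMulTop x M) := by
    refine Submodule.Quotient.nontrivial_iff.2 fun h => ?_
    refine (Submodule.top_ne_pointwise_smul_of_mem_jacobson_annihilator (r := x) (M := M) ?_) h.symm
    exact maximalIdeal_le_jacobson _ hxm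
  exact RingTheory.Sequence.IsRegular.nil R _

/-- The relative injectivity of `L / x L` lifts to `L` along Nakayama's lemma. -/
lemma exists_extend_of_quotient {L : Type*} [AddCommGroup L] [Module R L] [Module.Finite R L]
    {x : R} (hxm : x ∈ maximalIdeal R) (hx : x ∈ nonZeroDivisors R) (hxL : IsSMulRegular L x)
    {V : Type*} [AddCommGroup V] [Module R V] (π : L →ₗ[R] V) (hπ : Function.Surjective π)
    (hker : ∀ l, π l = 0 ↔ ∃ l', l = x • l')
    (hV : Module.length R (ResidueField R →ₗ[R] V) ≤ 1)
    (hlen : Module.length R (R ⧸ Ideal.span {x}) ≤ Module.length R V)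
    {n : ℕ} (Z : Submodule R (Fin n → R)) (hZ : ∀ v, x • v ∈ Z → v ∈ Z) (f : Z →ₗ[R] L) :
    ∃ g : (Fin n → R) →ₗ[R] L, g ∘ₗ Z.subtype = f := by
  have hxV : ∀ v : V, x • v = 0 := fun v => by
    obtain ⟨l, rfl⟩ := hπ v
    rw [← map_smul]
    exact (hker _).2 ⟨l, rfl⟩
  let res := LinearMap.lcomp R L Z.subtype
  suffices h : (⊤ : Submodule R (Z →ₗ[R] L)) ≤ LinearMap.range res from h (Submodule.mem_top (x := f))
  have hfg : (⊤ : Submodule R (Z →ₗ[R] L)).FG := Module.Finite.fg_top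
  refine Submodule.le_of_le_smul_of_le_jacobson_bot hfg
    (maximalIdeal_le_jacobson ⊥) fun f _ => ?_
  obtain ⟨g, hg⟩ := exists_extend_of_smul_eq_zero hV hx hxV hlen Z hZ (π ∘ₗ f)
  obtain ⟨g', rfl⟩ := Module.projective_lifting_property π g hπ
  have h1 : ∀ z : Z, ∃ l', (f - res g') z = x • l' := fun z => by
    rw [← hker, LinearMap.sub_apply, map_sub, sub_eq_zero]
    exact (LinearMap.congr_fun hg z).symm
  choose h hh using h1
  let h' : Z →ₗ[R] L :=
    { toFun := h
      map_add' := fun a b => hxL (by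
        change x • h (a + b) = x • (h a + h b)
        rw [← hh, map_add, smul_add, ← hh, ← hh])
      map_smul' := fun r a => hxL (by
        change x • h (r • a) = x • r • h a
        rw [← hh, map_smul, smul_comm, ← hh]) }
  have h2 : f = res g' + x • h' := by
    rw [← sub_eq_iff_eq_add']
    exact LinearMap.ext hh
  rw [h2]
  exact add_mem (Submodule.mem_sup_left ⟨g', rfl⟩)
    (Submodule.mem_sup_right (Submodule.smul_mem_smul hxm Submodule.mem_top))

/-- `L` has injective dimension at most one as soon as it is injective relative to all inclusions
`Z ⊆ F` with `F` free of finite rank and `F / Z` torsion-free. -/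
lemma hasInjectiveDimensionLE_one_of_exists_extend {L : Type u} [AddCommGroup L] [Module R L]
    {x : R} (hx : x ∈ nonZeroDivisors R)
    (hext : ∀ (n : ℕ) (Z : Submodule R (Fin n → R)), (∀ v, x • v ∈ Z → v ∈ Z) →
      ∀ f : Z →ₗ[R] L, ∃ g : (Fin n → R) →ₗ[R] L, g ∘ₗ Z.subtype = f) :
    HasInjectiveDimensionLE (ModuleCat.of R L) 1 := by
  let ⟨E, _, ι, _⟩ := EnoughInjectives.presentation (ModuleCat.of R L)
  have hι : Function.Injective ι.hom := (ModuleCat.mono_iff_injective ι).mp ‹_›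
  let S : ShortComplex (ModuleCat.{u} R) :=
    ModuleCat.shortComplexOfCompEqZero _ _ ι.hom.exact_map_mkQ_range.linearMap_comp_eq_zero
  have hS : S.ShortExact := ModuleCat.shortComplex_shortExact S
    ι.hom.exact_map_mkQ_range hι (Submodule.mkQ_surjective _)
  refine (hS.hasInjectiveDimensionLT_X₃_iff 0 ‹_›).1 ?_
  rw [zero_add, ← injective_iff_hasInjectiveDimensionLT_one]
  have hE : Module.Injective R E := Module.injective_module_of_injective_object R E
  have hEB : Module.Baer R E := Module.Baer.of_injective hE
  change Injective (ModuleCat.of R (E ⧸ LinearMap.range ι.hom))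
  rw [← Module.injective_iff_injective_object]
  refine Module.Baer.injective fun I f => ?_
  obtain ⟨n, p, hp⟩ := Module.Finite.exists_fin' R I
  -- lift `Rⁿ → I → E / L` to `Rⁿ → E`, and correct it to vanish on the relations of `I`
  obtain ⟨φ, hφ⟩ := Module.projective_lifting_property (LinearMap.range ι.hom).mkQ (f ∘ₗ p)
    (Submodule.mkQ_surjective _)
  have hφ' : ∀ v, (LinearMap.range ι.hom).mkQ (φ v) = f (p v) := LinearMap.congr_fun hφ
  have hmem : ∀ z ∈ LinearMap.ker p, φ z ∈ LinearMap.range ι.hom := fun z hz => by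
    rw [← (Submodule.Quotient.mk_eq_zero (LinearMap.range ι.hom)), ← Submodule.mkQ_apply, hφ',
      LinearMap.mem_ker.1 hz, map_zero]
  let e := LinearEquiv.ofInjective ι.hom hι
  let ψ : LinearMap.ker p →ₗ[R] L := e.symm.toLinearMap ∘ₗ φ.restrict hmem
  have hψ : ∀ z, ι.hom (ψ z) = φ z := fun z =>
    congrArg Subtype.val (e.apply_symm_apply (φ.restrict hmem z))
  obtain ⟨Ψ, hΨ⟩ := hext n (LinearMap.ker p) (fun v hv => by
    rw [LinearMap.mem_ker, map_smul] at hv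
    have h : x * (p v : R) = 0 := congrArg Subtype.val hv
    rw [mul_comm] at h
    exact LinearMap.mem_ker.2 (Subtype.ext ((mem_nonZeroDivisors_iff_right.1 hx) _ h))) ψ
  have hΨ' : ∀ z : LinearMap.ker p, Ψ z = ψ z := LinearMap.congr_fun hΨ
  let χ : (Fin n → R) →ₗ[R] E := φ - ι.hom ∘ₗ Ψ
  have hχ : LinearMap.ker p ≤ LinearMap.ker χ := fun z hz => by
    have h1 := hΨ' ⟨z, hz⟩
    have h2 := hψ ⟨z, hz⟩
    rw [LinearMap.mem_ker, LinearMap.sub_apply, sub_eq_zero, LinearMap.comp_apply]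
    change φ z = ι.hom (Ψ z)
    rw [← h2, ← h1]
  let χ' : I →ₗ[R] E :=
    (LinearMap.ker p).liftQ χ hχ ∘ₗ (p.quotKerEquivOfSurjective hp).symm.toLinearMap
  have hχ' : ∀ v, χ' (p v) = χ v := fun v => by
    have : (p.quotKerEquivOfSurjective hp).symm (p v) = Submodule.Quotient.mk v := by
      rw [LinearEquiv.symm_apply_eq]
      rfl
    change (LinearMap.ker p).liftQ χ hχ ((p.quotKerEquivOfSurjective hp).symm (p v)) = _
    rw [this]
    rfl
  obtain ⟨G, hG⟩ := hEB I χ'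
  refine ⟨(LinearMap.range ι.hom).mkQ ∘ₗ G, fun a ha => ?_⟩
  obtain ⟨v, hv⟩ := hp ⟨a, ha⟩
  rw [LinearMap.comp_apply, hG a ha, ← hv, hχ', LinearMap.sub_apply, map_sub, hφ', hv,
    LinearMap.comp_apply]
  have : (LinearMap.range ι.hom).mkQ (ι.hom (Ψ v)) = 0 :=
    (Submodule.Quotient.mk_eq_zero _).2 ⟨_, rfl⟩
  rw [this, sub_zero]

variable {Q : Type u} [CommRing Q] [Algebra R Q] [IsFractionRing R Q]

lemma isSMulRegular_of_nonZeroDivisors {x : R} (hx : x ∈ nonZeroDivisors R)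
    (L : Submodule R Q) : IsSMulRegular L x := fun a b h => by
  have h' : x • (a : Q) = x • (b : Q) := congrArg Subtype.val h
  rw [Algebra.smul_def, Algebra.smul_def, ← coe_regUnit hx, Units.mul_right_inj] at h'
  exact Subtype.ext h'

/-- A regular fractional ideal `L` with `(L : 𝔪) / L` simple is a canonical module. -/
lemma isCanonicalModule_of_covBy (hdim : ringKrullDim R = 1) {x : R}
    (hxm : x ∈ maximalIdeal R) (hx : x ∈ nonZeroDivisors R) {L : Submodule R Q}
    (hLr : IsRegularFractional L) (hL : L ⋖ colonMax L) : IsCanonicalModule R L := by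
  have hfin : Module.Finite R L := Module.Finite.iff_fg.2 hLr.fg
  have hxreg := isSMulRegular_of_nonZeroDivisors hx L
  have hnt : Nontrivial L := by
    have hcov := hL.lt.ne
    refine (Submodule.nontrivial_iff_ne_bot).2 fun h0 => hcov ?_
    subst h0
    refine le_antisymm (le_colonMax _) fun q hq => ?_
    have h1 : x • q = 0 := (Submodule.mem_bot R).1 (hq x hxm)
    rw [Algebra.smul_def, ← coe_regUnit hx, Units.mul_right_eq_zero] at h1
    exact h1
  refine ⟨⟨hfin, [x], by simpa using hxm, isRegular_singleton hxm hxreg, by rw [hdim]; simp⟩,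
    ⟨1, ?_⟩, fun d hd => ?_⟩
  · let w := regUnit Q hx
    let V := L ⧸ (scale w L).submoduleOf L
    let π : L →ₗ[R] V := Submodule.mkQ _
    refine hasInjectiveDimensionLE_one_of_exists_extend hx fun n Z hZ f =>
      exists_extend_of_quotient hxm hx hxreg π (Submodule.mkQ_surjective _) (fun l => ?_) ?_ ?_ Z hZ f
    · rw [Submodule.mkQ_apply, Submodule.Quotient.mk_eq_zero]
      change (l : Q) ∈ scale w L ↔ _
      constructor
      · rintro ⟨q, hq, h⟩
        refine ⟨⟨q, hq⟩, Subtype.ext ?_⟩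
        rw [← h, LinearMap.mulLeft_apply, coe_regUnit, ← Algebra.smul_def]
        rfl
      · rintro ⟨l', rfl⟩
        refine ⟨l', l'.2, ?_⟩
        rw [LinearMap.mulLeft_apply, coe_regUnit, ← Algebra.smul_def]
        rfl
    · -- the socle of `L / x L` lies in `x (L : 𝔪) / x L`
      have h1 : Module.length R (ResidueField R →ₗ[R] V) ≤
          Module.length R (colonMax (⊥ : Submodule R V)) := by
        let ev : (ResidueField R →ₗ[R] V) →ₗ[R] colonMax (⊥ : Submodule R V) :=
          (LinearMap.applyₗ (1 : ResidueField R)).codRestrict _ fun g a ha => by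
            rw [LinearMap.applyₗ_apply_apply, ← map_smul, Algebra.smul_def,
              ResidueField.algebraMap_eq, (residue_eq_zero_iff a).2 ha, zero_mul, map_zero]
            exact zero_mem _
        refine Module.length_le_of_injective ev fun g h hgh => LinearMap.ext fun c => ?_
        obtain ⟨r, rfl⟩ := residue_surjective c
        have h1 : g 1 = h 1 := congrArg Subtype.val hgh
        rw [← mul_one (residue R r), ← ResidueField.algebraMap_eq, ← Algebra.smul_def, map_smul,
          map_smul, h1]
      refine h1.trans ?_
      let A := L ⊓ colonMax (scale w L)
      have h2 : Module.length R (colonMax (⊥ : Submodule R V)) ≤ relLength (scale w L) A := by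
        let p : A →ₗ[R] colonMax (⊥ : Submodule R V) :=
          (π ∘ₗ Submodule.inclusion inf_le_left).codRestrict _ fun q a ha => by
            rw [Submodule.mem_bot, ← map_smul]
            exact (Submodule.Quotient.mk_eq_zero _).2 (q.2.2 a ha)
        refine Module.length_le_of_surjective
          (((scale w L).submoduleOf A).liftQ p fun q hq => ?_) fun v => ?_
        · exact Subtype.ext ((Submodule.Quotient.mk_eq_zero _).2 hq)
        · obtain ⟨v, hv⟩ := v
          obtain ⟨l, rfl⟩ := Submodule.mkQ_surjective _ v
          refine ⟨Submodule.Quotient.mk ⟨l, l.2, fun a ha => ?_⟩, rfl⟩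
          have := (Submodule.mem_bot R).1 (hv a ha)
          rw [← map_smul, Submodule.mkQ_apply, Submodule.Quotient.mk_eq_zero] at this
          exact this
      refine h2.trans ((relLength_mono_right inf_le_right).trans ?_)
      rw [colonMax_scale, relLength_scale, (relLength_eq_one_iff hL.le).2 hL]
    · have h1 := relLength_scale_self_eq hLr (isRegularFractional_one (R := R) (Q := Q)) hx
      change _ ≤ relLength (scale w L) L
      rw [h1]
      refine Module.length_le_of_injective ((Ideal.span {x}).mapQ
        ((scale w 1).submoduleOf (1 : Submodule R Q))
        ((Algebra.linearMap R Q).codRestrict 1 fun r => Submodule.mem_one.2 ⟨r, rfl⟩) ?_) ?_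
      · rw [Ideal.span, Submodule.span_le, Set.singleton_subset_iff]
        change algebraMap R Q x ∈ scale w 1
        rw [mem_scale, ← coe_regUnit hx, Units.inv_mul]
        exact Submodule.one_le.1 le_rfl
      · rw [← LinearMap.ker_eq_bot, Submodule.ker_mapQ, Submodule.eq_bot_iff]
        rintro _ ⟨r, h, rfl⟩
        rw [Submodule.mkQ_apply, Submodule.Quotient.mk_eq_zero]
        obtain ⟨q, hq, hqr⟩ := (show algebraMap R Q r ∈ scale w 1 from h)
        obtain ⟨s, rfl⟩ := Submodule.mem_one.1 hq
        rw [LinearMap.mulLeft_apply, coe_regUnit, ← map_mul] at hqr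
        exact Ideal.mem_span_singleton.2 ⟨s, (IsFractionRing.injective R Q hqr).symm⟩
  · rw [hdim] at hd
    obtain rfl : d = 1 := by exact_mod_cast hd.symm
    rw [length_ext_one_eq L ⟨x, hxm, hx⟩, (relLength_eq_one_iff hL.le).2 hL]

lemma IsCanonicalModule.covBy (hdim : ringKrullDim R = 1)
    (hreg : ∃ x ∈ maximalIdeal R, x ∈ nonZeroDivisors R) {L : Submodule R Q}
    (h : IsCanonicalModule R L) : L ⋖ colonMax L := by
  rw [← relLength_eq_one_iff (le_colonMax L), ← length_ext_one_eq L hreg]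
  exact h.type_one 1 hdim

end InjectiveDimension

/-! ### Gorenstein rings -/

section Gorenstein

/-- The short exact sequence of modules given by linear maps `f` and `g`. -/
lemma shortExact_of_linearMap {R : Type u} [CommRing R] {A B C : Type u} [AddCommGroup A] [Module R A]
    [AddCommGroup B] [Module R B] [AddCommGroup C] [Module R C] (f : A →ₗ[R] B) (g : B →ₗ[R] C)
    (h : Function.Exact f g) (hf : Function.Injective f) (hg : Function.Surjective g) :
    (ModuleCat.shortComplexOfCompEqZero f g h.linearMap_comp_eq_zero).ShortExact :=
  ModuleCat.shortComplex_shortExact _ h hf hg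

variable {R : Type u} [CommRing R] [IsLocalRing R] [IsNoetherianRing R] [Ring.KrullDimLE 1 R]

/-- For a regular nonunit `x`, the residue field embeds into `R / x`. -/
lemma exists_residueField_injective {x : R} (hxm : x ∈ maximalIdeal R)
    (hx : x ∈ nonZeroDivisors R) :
    ∃ j : ResidueField R →ₗ[R] (R ⧸ Ideal.span {x}), Function.Injective j := by
  have hle : ¬ (⊤ : Submodule R R) ≤ Ideal.span {x} := fun h =>
    (mem_maximalIdeal x).1 hxm (Ideal.span_singleton_eq_top.1 (top_le_iff.1 h))
  have hfin : relLength (Ideal.span {x}) (⊤ : Submodule R R) ≠ ⊤ := by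
    have h1 := relLength_le_of_map (X := Ideal.span {x}) (Y := (⊤ : Submodule R R))
      (X' := (⊥ : Submodule R (R ⧸ Ideal.span {x}))) (Y' := ⊤) (Ideal.span {x}).mkQ
      (fun _ _ => Submodule.mem_top) (fun y _ => by
        rw [Submodule.mem_bot, Submodule.mkQ_apply, Submodule.Quotient.mk_eq_zero])
    refine ne_top_of_le_ne_top ?_ h1
    rw [relLength, Module.length_ne_top_iff]
    exact ((Submodule.topEquiv.symm.isFiniteLength
      (isFiniteLength_quotient_span_singleton R hx))).of_surjective (Submodule.mkQ_surjective _)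
  obtain ⟨y, -, hyx, hy⟩ := exists_smul_mem_of_relLength_ne_top hfin hle
  let j : (R ⧸ maximalIdeal R) →ₗ[R] (R ⧸ Ideal.span {x}) :=
    (maximalIdeal R).liftQ (LinearMap.toSpanSingleton R _ (Submodule.Quotient.mk y)) fun a ha =>
      (Submodule.Quotient.mk_eq_zero _).2 (hy a ha)
  refine ⟨j, (injective_iff_map_eq_zero j).2 fun c hc => ?_⟩
  obtain ⟨r, rfl⟩ := Submodule.mkQ_surjective _ c
  have h1 : r • y ∈ Ideal.span {x} := (Submodule.Quotient.mk_eq_zero _).1 hc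
  refine (Submodule.Quotient.mk_eq_zero _).2 ?_
  by_contra hr
  have hu : IsUnit r := not_not.1 fun h => hr ((mem_maximalIdeal r).2 h)
  obtain ⟨u, rfl⟩ := hu
  apply hyx
  have := (Ideal.span {x}).mul_mem_left (↑u⁻¹ : R) h1
  rwa [smul_eq_mul, Units.inv_mul_cancel_left] at this

/-- If `R` has finite injective dimension, then `Extⁱ(Y, R) = 0` for `i ≥ 2` and `Y` of finite
length, by descending induction on `i`: the embedding `k ⊆ R / x` reduces the vanishing of
`Extⁱ(k, R)` to that of `Extⁱ⁺¹`. -/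
lemma ext_eq_zero_of_isFiniteLength {x : R} (hxm : x ∈ maximalIdeal R)
    (hx : x ∈ nonZeroDivisors R) {n : ℕ} (hn : HasInjectiveDimensionLE (ModuleCat.of R R) n)
    (d : ℕ) : ∀ i, 2 ≤ i → n + 1 ≤ i + d → ∀ (Y : Type u) [AddCommGroup Y] [Module R Y],
      IsFiniteLength R Y → ∀ e : Abelian.Ext.{u} (ModuleCat.of R Y) (ModuleCat.of R R) i, e = 0 := by
  induction d with
  | zero =>
    intro i _ hi Y _ _ _ e
    exact e.eq_zero_of_hasInjectiveDimensionLT (n + 1) hi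
  | succ d ih =>
    intro i h2 hi Y _ _ hY
    have hB : IsFiniteLength R (R ⧸ Ideal.span {x}) := isFiniteLength_quotient_span_singleton R hx
    obtain ⟨i, rfl⟩ : ∃ j, i = j + 2 := ⟨i - 2, by omega⟩
    -- `R / x` has projective dimension one
    have hRx : ∀ e : Abelian.Ext.{u} (ModuleCat.of R (R ⧸ Ideal.span {x})) (ModuleCat.of R R) (i + 2),
        e = 0 := by
      intro e
      have hS := shortExact_of_linearMap (LinearMap.lsmul R R x) (Ideal.span {x}).mkQ
        (LinearMap.exact_iff.2 (by
          rw [Submodule.ker_mkQ]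
          ext r
          rw [Ideal.mem_span_singleton', LinearMap.mem_range]
          simp [mul_comm]))
        (fun a b h => by
          rw [LinearMap.lsmul_apply, LinearMap.lsmul_apply, smul_eq_mul, smul_eq_mul] at h
          exact (mul_cancel_left_mem_nonZeroDivisors hx).1 h)
        (Submodule.mkQ_surjective _)
      have hproj : Projective (ModuleCat.of R R) := inferInstance
      obtain ⟨y, rfl⟩ := Abelian.Ext.contravariant_sequence_exact₃ hS _ e
        (Abelian.Ext.eq_zero_of_projective (P := ModuleCat.of R R) (n := i + 1) _)
        (show 1 + (i + 1) = i + 2 by omega)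
      rw [Abelian.Ext.eq_zero_of_projective (P := ModuleCat.of R R) (n := i) y, Abelian.Ext.comp_zero]
    have hk : ∀ e : Abelian.Ext.{u} (ModuleCat.of R (ResidueField R)) (ModuleCat.of R R) (i + 2),
        e = 0 := by
      intro e
      obtain ⟨j, hj⟩ := exists_residueField_injective hxm hx
      have hS := shortExact_of_linearMap j (LinearMap.range j).mkQ (LinearMap.exact_iff.2 (by simp)) hj
        (Submodule.mkQ_surjective _)
      have h3 := ih (i + 3) (by omega) (by omega) ((R ⧸ Ideal.span {x}) ⧸ LinearMap.range j)
        (hB.of_surjective (Submodule.mkQ_surjective _))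
      obtain ⟨y, rfl⟩ := Abelian.Ext.contravariant_sequence_exact₁ hS _ e
        (show 1 + (i + 2) = i + 3 by omega) (h3 _)
      rw [hRx y, Abelian.Ext.comp_zero]
    induction hY with
    | @of_subsingleton Y =>
      intro e
      have hz : Limits.IsZero (ModuleCat.of R Y) := ModuleCat.isZero_of_subsingleton _
      rw [← e.mk₀_id_comp, hz.eq_zero_of_src (𝟙 _), Abelian.Ext.mk₀_zero, Abelian.Ext.zero_comp]
    | @of_simple_quotient Y _ _ N hs _ ihN =>
      intro e
      obtain ⟨I, hI, ⟨e'⟩⟩ := isSimpleModule_iff_quot_maximal.1 hs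
      obtain rfl := eq_maximalIdeal hI
      have hS := shortExact_of_linearMap N.subtype (e'.toLinearMap ∘ₗ N.mkQ) (LinearMap.exact_iff.2 (by
        rw [LinearEquiv.ker_comp, Submodule.ker_mkQ, Submodule.range_subtype]))
        N.injective_subtype (e'.surjective.comp N.mkQ_surjective)
      obtain ⟨y, rfl⟩ := Abelian.Ext.contravariant_sequence_exact₂ hS _ e (ihN _)
      have hy : y = 0 := hk y
      rw [hy, Abelian.Ext.comp_zero]

lemma ext_smul_eq_zero {M : Type u} [AddCommGroup M] [Module R M] {n : ℕ} {a : R}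
    (ha : a ∈ maximalIdeal R)
    (e : Abelian.Ext.{u} (ModuleCat.of R (ResidueField R)) (ModuleCat.of R M) n) : a • e = 0 := by
  have h : a • 𝟙 (ModuleCat.of R (ResidueField R)) = 0 := by
    ext c
    change a • (c : ResidueField R) = 0
    rw [Algebra.smul_def, ResidueField.algebraMap_eq, (residue_eq_zero_iff a).2 ha, zero_mul]
  rw [← e.mk₀_id_comp, ← Abelian.Ext.smul_comp, ← Abelian.Ext.mk₀_smul, h, Abelian.Ext.mk₀_zero,
    Abelian.Ext.zero_comp]

/-- If `R` has finite injective dimension, then `Ext¹(k, R)` is a quotient of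
`Ext¹(R / x, R)`, hence cyclic. -/
lemma length_ext_one_le_of_hasInjectiveDimensionLE {x : R} (hxm : x ∈ maximalIdeal R)
    (hx : x ∈ nonZeroDivisors R) {n : ℕ} (hn : HasInjectiveDimensionLE (ModuleCat.of R R) n) :
    Module.length R
      (Abelian.Ext.{u} (ModuleCat.of R (ResidueField R)) (ModuleCat.of R R) 1) ≤ 1 := by
  have hB : IsFiniteLength R (R ⧸ Ideal.span {x}) := isFiniteLength_quotient_span_singleton R hx
  obtain ⟨j, hj⟩ := exists_residueField_injective hxm hx
  have hS := shortExact_of_linearMap j (LinearMap.range j).mkQ (LinearMap.exact_iff.2 (by simp)) hj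
    (Submodule.mkQ_surjective _)
  have hT := shortExact_of_linearMap (LinearMap.lsmul R R x) (Ideal.span {x}).mkQ
    (LinearMap.exact_iff.2 (by
      rw [Submodule.ker_mkQ]
      ext r
      rw [Ideal.mem_span_singleton', LinearMap.mem_range]
      simp [mul_comm]))
    (fun a b h => by
      rw [LinearMap.lsmul_apply, LinearMap.lsmul_apply, smul_eq_mul, smul_eq_mul] at h
      exact (mul_cancel_left_mem_nonZeroDivisors hx).1 h)
    (Submodule.mkQ_surjective _)
  let e₀ : (R →ₗ[R] R) ≃ₗ[R] Abelian.Ext.{u} (ModuleCat.of R R) (ModuleCat.of R R) 0 :=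
    (Abelian.Ext.linearEquiv₀.trans ModuleCat.homLinearEquiv).symm
  let α : R →ₗ[R] Abelian.Ext.{u} (ModuleCat.of R R) (ModuleCat.of R R) 0 :=
    e₀.toLinearMap ∘ₗ LinearMap.lsmul R R
  have hα : Function.Surjective α := by
    have h : Function.Surjective (LinearMap.lsmul R R) := fun f =>
      ⟨f 1, LinearMap.ext_ring (by simp)⟩
    exact e₀.surjective.comp h
  let β : Abelian.Ext.{u} (ModuleCat.of R R) (ModuleCat.of R R) 0 →ₗ[R]
      Abelian.Ext.{u} (ModuleCat.of R (R ⧸ Ideal.span {x})) (ModuleCat.of R R) 1 :=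
    hT.extClass.precompOfLinear R (ModuleCat.of R R) (add_comm 1 0)
  have hβ : Function.Surjective β := fun e =>
    Abelian.Ext.contravariant_sequence_exact₃ hT _ e
      (Abelian.Ext.eq_zero_of_projective (P := ModuleCat.of R R) (n := 0) _) (add_comm 1 0)
  let γ : Abelian.Ext.{u} (ModuleCat.of R (R ⧸ Ideal.span {x})) (ModuleCat.of R R) 1 →ₗ[R]
      Abelian.Ext.{u} (ModuleCat.of R (ResidueField R)) (ModuleCat.of R R) 1 :=
    (Abelian.Ext.mk₀ (ModuleCat.ofHom j)).precompOfLinear R (ModuleCat.of R R) (zero_add 1)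
  have hγ : Function.Surjective γ := fun e =>
    Abelian.Ext.contravariant_sequence_exact₁ hS _ e (show 1 + 1 = 2 from rfl)
      (ext_eq_zero_of_isFiniteLength hxm hx hn (n + 1) 2 le_rfl (by omega) _
        (hB.of_surjective (Submodule.mkQ_surjective _)) _)
  let F := γ ∘ₗ β ∘ₗ α
  have hF : Function.Surjective F := hγ.comp (hβ.comp hα)
  let G := (maximalIdeal R).liftQ F fun a ha => by
    rw [LinearMap.mem_ker, ← mul_one a, ← smul_eq_mul, map_smul]
    exact ext_smul_eq_zero ha _
  have hG : Function.Surjective G := fun e => by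
    obtain ⟨r, rfl⟩ := hF e
    exact ⟨Submodule.Quotient.mk r, rfl⟩
  refine (Module.length_le_of_surjective G hG).trans ?_
  have : IsSimpleModule R (R ⧸ maximalIdeal R) :=
    isSimpleModule_iff_quot_maximal.2 ⟨_, inferInstance, ⟨LinearEquiv.refl _ _⟩⟩
  rw [Module.length_eq_one R (R ⧸ maximalIdeal R)]

variable {Q : Type u} [CommRing Q] [Algebra R Q] [IsFractionRing R Q]

/-- `L ≠ (L : 𝔪)` for regular fractional ideals `L`. -/
lemma not_colonMax_le {x : R} (hxm : x ∈ maximalIdeal R) (hx : x ∈ nonZeroDivisors R)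
    {L : Submodule R Q} (hL : IsRegularFractional L) : ¬ colonMax L ≤ L := by
  intro hle
  let w := regUnit Q hx
  have hne : ¬ scale w⁻¹ L ≤ L := by
    intro h
    have h1 : L ≤ maximalIdeal R • L := fun l hl => by
      have h2 : ↑w⁻¹ * l ∈ L := h (mul_mem_scale hl)
      have h3 : l = x • (↑w⁻¹ * l) := by
        rw [Algebra.smul_def, ← coe_regUnit hx, Units.mul_inv_cancel_left]
      rw [h3]
      exact Submodule.smul_mem_smul hxm h2
    have h2 := Submodule.eq_bot_of_le_smul_of_le_jacobson_bot _ L hL.fg h1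
      (maximalIdeal_le_jacobson ⊥)
    obtain ⟨v, hv⟩ := hL.exists_unit
    have : Nontrivial Q := (IsFractionRing.injective R Q).nontrivial
    rw [h2, Submodule.mem_bot] at hv
    exact v.ne_zero hv
  obtain ⟨y, -, hy, h⟩ := exists_smul_mem_of_relLength_ne_top
    (relLength_ne_top hL (hL.scale w⁻¹).fg) hne
  exact hy (hle h)

/-- A one-dimensional Gorenstein local ring is a canonical module over itself. -/
lemma isCanonicalModule_self (hCM : IsCohenMacaulayLocal R) (hdim : ringKrullDim R = 1)
    (hG : HasFiniteInjectiveDimension R R) {x : R} (hxm : x ∈ maximalIdeal R)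
    (hx : x ∈ nonZeroDivisors R) : IsCanonicalModule R R := by
  refine ⟨hCM.2, hG, fun d hd => ?_⟩
  obtain ⟨n, hn⟩ := hG
  rw [hdim] at hd
  obtain rfl : d = 1 := by exact_mod_cast hd.symm
  refine le_antisymm (length_ext_one_le_of_hasInjectiveDimensionLE hxm hx hn) ?_
  rw [length_ext_congr _ (oneEquiv R (FractionRing R)), length_ext_one_eq _ ⟨x, hxm, hx⟩,
    Order.one_le_iff_ne_zero, Ne, relLength_eq_zero_iff]
  exact not_colonMax_le hxm hx isRegularFractional_one

end Gorenstein

/-! ### Almost Gorenstein rings -/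

section SpanFinrank

variable {R : Type*} [CommRing R] [IsLocalRing R] {M : Type*} [AddCommGroup M] [Module R M]

lemma length_eq_spanFinrank_of_smul_eq_zero [Module.Finite R M]
    (h : ∀ a ∈ maximalIdeal R, ∀ m : M, a • m = 0) :
    Module.length R M = (⊤ : Submodule R M).spanFinrank := by
  have htors : Module.IsTorsionBySet R M (maximalIdeal R) := fun m a => h a a.2 m
  let : Module (R ⧸ maximalIdeal R) M := htors.module
  let : Field (R ⧸ maximalIdeal R) := Ideal.Quotient.field _
  have : IsScalarTower R (R ⧸ maximalIdeal R) M := htors.isScalarTower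
  have : Module.Finite (R ⧸ maximalIdeal R) M := Module.Finite.of_restrictScalars_finite R _ M
  have hsurj : Function.Surjective (algebraMap R (R ⧸ maximalIdeal R)) :=
    Ideal.Quotient.mk_surjective
  rw [Module.length_eq_of_surjective (R := R ⧸ maximalIdeal R) hsurj, Module.length_eq_finrank,
    Module.finrank_eq_spanFinrank_of_free, Submodule.spanFinrank, Submodule.spanFinrank,
    ← Submodule.spanRank_restrictScalars_eq hsurj]
  rfl

lemma spanFinrank_le_spanFinrank_quotient [Module.Finite R M] :
    (⊤ : Submodule R M).spanFinrank ≤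
      (⊤ : Submodule R (M ⧸ (maximalIdeal R • (⊤ : Submodule R M)))).spanFinrank := by
  classical
  set N := maximalIdeal R • (⊤ : Submodule R M)
  obtain ⟨s, hs, hspan⟩ := Submodule.FG.exists_span_finset_card_eq_spanFinrank
    (Module.Finite.fg_top (R := R) (M := M ⧸ N))
  choose l hl using N.mkQ_surjective
  have htop : Submodule.span R (l '' s) = ⊤ := by
    refine top_le_iff.1 (Submodule.le_of_le_smul_of_le_jacobson_bot Module.Finite.fg_top
      (maximalIdeal_le_jacobson ⊥) ?_)
    change ⊤ ≤ _ ⊔ N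
    rw [top_le_iff, sup_comm, ← Submodule.map_mkQ_eq_top, Submodule.map_span, ← Set.image_comp]
    have : (N.mkQ ∘ l) = id := funext hl
    rw [this, Set.image_id, hspan]
  rw [← htop, ← hs]
  refine (Submodule.spanFinrank_span_le_ncard_of_finite (s.finite_toSet.image l)).trans ?_
  exact (Set.ncard_image_le s.finite_toSet).trans (by rw [Set.ncard_coe_finset])

lemma spanFinrank_le_length_quotient_smul_top [Module.Finite R M] :
    (⊤ : Submodule R M).spanFinrank ≤
      Module.length R (M ⧸ (maximalIdeal R • (⊤ : Submodule R M))) := by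
  rw [length_eq_spanFinrank_of_smul_eq_zero fun a ha m => ?_, Nat.cast_le]
  · exact spanFinrank_le_spanFinrank_quotient
  · obtain ⟨m, rfl⟩ := Submodule.mkQ_surjective _ m
    rw [← map_smul]
    exact (Submodule.Quotient.mk_eq_zero _).2 (Submodule.smul_mem_smul ha Submodule.mem_top)

/-- The number of generators of `C` equals its multiplicity (relative to a one-dimensional ring)
if and only if `𝔪 C = 0`. -/
lemma isMultiplicity_spanFinrank_iff [IsNoetherianRing R] [Module.Finite R M] :
    IsMultiplicity R M ((⊤ : Submodule R M).spanFinrank : ℕ∞) ↔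
      ∀ a ∈ maximalIdeal R, ∀ m : M, a • m = 0 := by
  set J := maximalIdeal R
  constructor
  · intro h
    let N : ℕ → Submodule R M := fun n => J ^ (n + 1) • (⊤ : Submodule R M)
    have hanti : ∀ n, N (n + 1) ≤ N n := fun n =>
      Submodule.smul_mono_left (Ideal.pow_le_pow_right (by omega))
    suffices hN : N 0 ≤ N 1 by
      have h0 : N 0 = J • (⊤ : Submodule R M) := by simp [N]
      have h1 : N 1 = J • N 0 := by
        rw [h0, ← Submodule.mul_smul]; simp [N, pow_two]
      have hbot : N 0 = ⊥ := Submodule.eq_bot_of_le_smul_of_le_jacobson_bot J (N 0)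
        (IsNoetherian.noetherian _) (h1 ▸ hN) (maximalIdeal_le_jacobson ⊥)
      intro a ha m
      have : a • m ∈ N 0 := h0 ▸ Submodule.smul_mem_smul ha Submodule.mem_top
      rwa [hbot, Submodule.mem_bot] at this
    by_contra hN
    let s := (⊤ : Submodule R M).spanFinrank
    have hs : (s : ℕ∞) ≤ Module.length R (M ⧸ N 0) := by
      have : N 0 = J • (⊤ : Submodule R M) := by simp [N]
      rw [this]
      exact spanFinrank_le_length_quotient_smul_top
    -- the lengths are at least `s + 1` from the second one on
    have hge : ∀ n, 1 ≤ n → (s : ℕ∞) + 1 ≤ Module.length R (M ⧸ N n) := by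
      intro n hn
      have hle : N n ≤ N 1 := Submodule.smul_mono_left (Ideal.pow_le_pow_right (by omega))
      refine le_trans ?_ (Module.length_le_of_surjective _ (Submodule.factor_surjective hle))
      have hlen : Module.length R (M ⧸ N 1) = relLength (N 1) (N 0) + Module.length R (M ⧸ N 0) := by
        have h1 := relLength_eq_add (hanti 0) (le_top (a := N 0))
        have h2 : ∀ K : Submodule R M, relLength K ⊤ = Module.length R (M ⧸ K) := fun K =>
          (Submodule.Quotient.equiv _ _ Submodule.topEquiv (by
            ext m; simp [Submodule.submoduleOf])).length_eq
        rwa [h2, h2] at h1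
      rw [hlen, add_comm]
      refine add_le_add ?_ hs
      rw [Order.one_le_iff_ne_zero, Ne, relLength_eq_zero_iff]
      exact hN
    have hlim : (s : ℕ∞) + 1 ≤ s := ge_of_tendsto h
      (eventually_atTop.2 ⟨1, fun n hn => hge n hn⟩)
    have : ((s + 1 : ℕ) : ℕ∞) ≤ (s : ℕ) := by simpa using hlim
    exact absurd (Nat.cast_le.1 this) (by omega)
  · intro h
    have hbot : ∀ n : ℕ, J ^ (n + 1) • (⊤ : Submodule R M) = ⊥ := fun n => by
      rw [eq_bot_iff, pow_succ, Submodule.mul_smul]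
      have : J • (⊤ : Submodule R M) = ⊥ := by
        rw [eq_bot_iff, Submodule.smul_le]
        intro a ha m _
        exact h a ha m
      rw [this, Submodule.smul_bot]
    refine tendsto_const_nhds.congr fun n => ?_
    rw [← length_eq_spanFinrank_of_smul_eq_zero h]
    exact (Submodule.quotEquivOfEqBot _ (hbot n)).length_eq.symm

end SpanFinrank

section AlmostGorenstein

variable {R : Type u} [CommRing R] [IsLocalRing R]

/-- In a one-dimensional Cohen-Macaulay local ring the maximal ideal contains a regular element. -/
lemma IsCohenMacaulayLocal.exists_nonZeroDivisor (hCM : IsCohenMacaulayLocal R)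
    (hdim : ringKrullDim R = 1) : ∃ x ∈ maximalIdeal R, x ∈ nonZeroDivisors R := by
  obtain ⟨-, -, rs, hrs, hreg, hlen⟩ := hCM
  rw [hdim] at hlen
  have hlen' : rs.length = 1 := by exact_mod_cast hlen.symm
  obtain ⟨x, rfl⟩ := List.length_eq_one_iff.1 hlen'
  have h := ((RingTheory.Sequence.isRegular_cons_iff R x []).1 hreg).1
  refine ⟨x, hrs x (by simp), mem_nonZeroDivisors_iff_right.2 fun a ha => ?_⟩
  exact h (by simpa [mul_comm] using ha)

lemma krullDimLE_one_of_eq (hdim : ringKrullDim R = 1) : Ring.KrullDimLE 1 R := by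
  rw [Ring.krullDimLE_iff, hdim]
  rfl

variable {Q : Type u} [CommRing Q] [Algebra R Q] [IsFractionRing R Q]

/-- `R` is almost Gorenstein if and only if it has a canonical fractional ideal `L ∋ 1` with
`𝔪 L ⊆ R`. An embedding `φ : R → K` whose cokernel is killed by the regular element `x` identifies
`K` with the fractional ideal `{φ⁻¹(x κ) / x | κ ∈ K}`. -/
lemma isAlmostGorenstein_iff (hCM : IsCohenMacaulayLocal R) (hdim : ringKrullDim R = 1) :
    IsAlmostGorenstein R ↔ ∃ L : Submodule R Q, IsRegularFractional L ∧ L ⋖ colonMax L ∧ 1 ∈ L ∧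
      L ≤ colonMax 1 := by
  have := hCM.1
  have := krullDimLE_one_of_eq hdim
  obtain ⟨x, hxm, hx⟩ := hCM.exists_nonZeroDivisor hdim
  constructor
  · rintro ⟨-, -, K, _, _, hK, φ, hφ, hmult⟩
    have hfin : Module.Finite R K := hK.maximalCohenMacaulay.1
    rw [isMultiplicity_spanFinrank_iff] at hmult
    have hrange : ∀ a ∈ maximalIdeal R, ∀ κ : K, a • κ ∈ LinearMap.range φ := fun a ha κ =>
      (Submodule.Quotient.mk_eq_zero _).1 (hmult a ha (Submodule.Quotient.mk κ))
    -- a `K`-regular element is regular, as `R` embeds into `K`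
    obtain ⟨y, hym, hyK⟩ : ∃ y ∈ maximalIdeal R, IsSMulRegular K y := by
      obtain ⟨-, rs, hrs, hreg, hlen⟩ := hK.maximalCohenMacaulay
      rw [hdim] at hlen
      have hlen' : rs.length = 1 := by exact_mod_cast hlen.symm
      obtain ⟨y, rfl⟩ := List.length_eq_one_iff.1 hlen'
      exact ⟨y, hrs y (by simp), ((RingTheory.Sequence.isRegular_cons_iff K y []).1 hreg).1⟩
    have hy : y ∈ nonZeroDivisors R := mem_nonZeroDivisors_iff_right.2 fun a ha => by
      apply hφ
      apply hyK
      change y • φ a = y • φ 0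
      rw [← map_smul, smul_eq_mul, mul_comm, ha, map_zero, smul_zero]
    let e := LinearEquiv.ofInjective φ hφ
    let m : K →ₗ[R] LinearMap.range φ :=
      { toFun := fun κ => ⟨y • κ, hrange y hym κ⟩
        map_add' := fun a b => Subtype.ext (smul_add y a b)
        map_smul' := fun r a => Subtype.ext (smul_comm y r a) }
    let F : K →ₗ[R] Q := LinearMap.mulLeft R ((regUnit Q hy)⁻¹ : Qˣ) ∘ₗ Algebra.linearMap R Q ∘ₗ
      e.symm.toLinearMap ∘ₗ m
    have hF : Function.Injective F := by
      have hm : Function.Injective m := fun a b h => hyK (congrArg Subtype.val h)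
      have hw : Function.Injective (LinearMap.mulLeft R (((regUnit Q hy)⁻¹ : Qˣ) : Q)) :=
        fun a b h => (Units.mul_right_inj _).1 h
      exact hw.comp ((IsFractionRing.injective R Q).comp (e.symm.injective.comp hm))
    have hFφ : ∀ r, F (φ r) = algebraMap R Q r := fun r => by
      have : e.symm (m (φ r)) = y * r := by
        rw [LinearEquiv.symm_apply_eq]
        exact Subtype.ext (φ.map_smul y r).symm
      change ↑(regUnit Q hy)⁻¹ * algebraMap R Q (e.symm (m (φ r))) = _
      rw [this, map_mul, ← coe_regUnit hy, Units.inv_mul_cancel_left]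
    let E : K ≃ₗ[R] LinearMap.range F := LinearEquiv.ofInjective F hF
    have hcan := hK.of_linearEquiv E
    have h1 : (1 : Q) ∈ LinearMap.range F := ⟨φ 1, by rw [hFφ, map_one]⟩
    refine ⟨LinearMap.range F, ⟨Module.Finite.iff_fg.1 (Module.Finite.equiv E), 1, h1⟩,
      hcan.covBy hdim ⟨x, hxm, hx⟩, h1, ?_⟩
    rintro _ ⟨κ, rfl⟩ a ha
    obtain ⟨r, hr⟩ := hrange a ha κ
    rw [← map_smul, ← hr, hFφ]
    exact Submodule.mem_one.2 ⟨r, rfl⟩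
  · rintro ⟨L, hLr, hL, h1, hle⟩
    have hfin : Module.Finite R L := Module.Finite.iff_fg.2 hLr.fg
    refine ⟨hCM, hdim, L, inferInstance, inferInstance,
      isCanonicalModule_of_covBy hdim hxm hx hLr hL, LinearMap.toSpanSingleton R L ⟨1, h1⟩, ?_, ?_⟩
    · intro r s h
      have := congrArg Subtype.val h
      simp only [LinearMap.toSpanSingleton_apply, Submodule.coe_smul, ← Algebra.algebraMap_eq_smul_one]
        at this
      exact IsFractionRing.injective R Q this
    · rw [isMultiplicity_spanFinrank_iff]
      intro a ha c
      obtain ⟨l, rfl⟩ := Submodule.mkQ_surjective _ c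
      rw [← map_smul]
      refine (Submodule.Quotient.mk_eq_zero _).2 ?_
      obtain ⟨r, hr⟩ := Submodule.mem_one.1 (hle l.2 a ha)
      refine ⟨r, Subtype.ext ?_⟩
      rw [LinearMap.toSpanSingleton_apply, Submodule.coe_smul, ← Algebra.algebraMap_eq_smul_one, hr]
      rfl

end AlmostGorenstein

/-! ### The endomorphism ring of the maximal ideal -/

section Avoidance

variable {R : Type*} [CommRing R] [IsLocalRing R] [Infinite (ResidueField R)]
  {M : Type*} [AddCommGroup M] [Module R M]

/-- Over a local ring with infinite residue field, a line `l + R w` not contained in any of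
finitely many submodules has a point outside all of them. -/
lemma exists_add_smul_notMem {s : Set (Submodule R M)} (hs : s.Finite) {l w : M}
    (h : ∀ P ∈ s, l ∉ P ∨ w ∉ P) : ∃ a : R, ∀ P ∈ s, l + a • w ∉ P := by
  let bad : Submodule R M → Set (ResidueField R) := fun P =>
    {c | ∃ a, residue R a = c ∧ l + a • w ∈ P}
  have hbad : ∀ P ∈ s, (bad P).Subsingleton := by
    rintro P hP _ ⟨a, rfl, ha⟩ _ ⟨b, rfl, hb⟩
    by_contra hab
    have hu : IsUnit (a - b) := by
      rw [← residue_ne_zero_iff_isUnit, map_sub, sub_ne_zero]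
      exact hab
    have h1 : (a - b) • w ∈ P := by
      have := P.sub_mem ha hb
      rwa [add_sub_add_left_eq_sub, ← sub_smul] at this
    have hw : w ∈ P := by
      obtain ⟨c, hc⟩ := hu.exists_left_inv
      have := P.smul_mem c h1
      rwa [smul_smul, hc, one_smul] at this
    have hl : l ∈ P := by
      have := P.sub_mem ha (P.smul_mem a hw)
      rwa [add_sub_cancel_right] at this
    exact (h P hP).elim (· hl) (· hw)
  have hfin : (⋃ P ∈ s, bad P).Finite := hs.biUnion fun P hP => (hbad P hP).finite
  obtain ⟨c, hc⟩ := hfin.exists_notMem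
  obtain ⟨a, rfl⟩ := residue_surjective c
  exact ⟨a, fun P hP hmem => hc (Set.mem_biUnion hP ⟨a, rfl, hmem⟩)⟩

lemma exists_mem_notMem {s : Set (Submodule R M)} (hs : s.Finite) {L : Submodule R M}
    (h : ∀ P ∈ s, ¬ L ≤ P) : ∃ l ∈ L, ∀ P ∈ s, l ∉ P := by
  induction s, hs using Set.Finite.induction_on with
  | empty => exact ⟨0, L.zero_mem, by simp⟩
  | @insert P s hPs hs ih =>
    obtain ⟨l, hl, hls⟩ := ih fun P' hP' => h P' (Set.mem_insert_of_mem P hP')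
    obtain ⟨w, hw, hwP⟩ := SetLike.not_le_iff_exists.1 (h P (Set.mem_insert P s))
    obtain ⟨a, ha⟩ := exists_add_smul_notMem (hs.insert P) (l := l) (w := w) (by
      rintro P' (rfl | hP')
      · exact Or.inr hwP
      · exact Or.inl (hls P' hP'))
    exact ⟨_, L.add_mem hl (L.smul_mem a hw), ha⟩

end Avoidance

lemma finite_setOf_isMaximal (R : Type*) [CommRing R] [IsLocalRing R] [IsNoetherianRing R]
    (C : Type*) [CommRing C] [Algebra R C] [Module.Finite R C] :
    {P : Ideal C | P.IsMaximal}.Finite := by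
  have : IsNoetherianRing C := isNoetherian_of_isNoetherianRing_of_finite R C |> fun _ =>
    isNoetherian_of_tower R inferInstance
  refine ((maximalIdeal R).map (algebraMap R C)).finite_minimalPrimes_of_isNoetherianRing.subset ?_
  intro P (hP : P.IsMaximal)
  have hover : ∀ q : Ideal C, q.IsPrime → (maximalIdeal R).map (algebraMap R C) ≤ q →
      q.comap (algebraMap R C) = maximalIdeal R := fun q hq hle =>
    ((maximalIdeal.isMaximal R).eq_of_le (Ideal.comap_ne_top _ hq.ne_top)
      (Ideal.map_le_iff_le_comap.1 hle)).symm
  have hPm : P.comap (algebraMap R C) = maximalIdeal R :=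
    eq_maximalIdeal (Ideal.isMaximal_comap_of_isIntegral_of_isMaximal P)
  refine ⟨⟨hP.isPrime, Ideal.map_le_iff_le_comap.2 hPm.ge⟩, fun q hq hqP => ?_⟩
  have := hq.1
  have hqmax : q.IsMaximal := Ideal.isMaximal_of_isIntegral_of_isMaximal_comap (R := R) q (by
    rw [hover q hq.1 hq.2]; exact maximalIdeal.isMaximal R)
  exact (hqmax.eq_of_le hP.ne_top hqP).ge

section EndMax

variable {R : Type u} [CommRing R] [IsLocalRing R] {Q : Type u} [CommRing Q] [Algebra R Q]

/-- The maximal ideal of `R` as an `R`-submodule of `Q`. -/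
def maxFrac (R Q : Type*) [CommRing R] [IsLocalRing R] [CommRing Q] [Algebra R Q] :
    Submodule R Q :=
  Submodule.map (Algebra.linearMap R Q) (maximalIdeal R)

lemma algebraMap_mem_maxFrac {a : R} (ha : a ∈ maximalIdeal R) : algebraMap R Q a ∈ maxFrac R Q :=
  ⟨a, ha, rfl⟩

lemma maxFrac_le_one : maxFrac R Q ≤ 1 := by
  rintro _ ⟨a, -, rfl⟩
  exact Submodule.mem_one.2 ⟨a, rfl⟩

lemma one_mem_colonMax {X : Submodule R Q} (h : maxFrac R Q ≤ X) : (1 : Q) ∈ colonMax X :=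
  fun a ha => by
    rw [← Algebra.algebraMap_eq_smul_one]
    exact h (algebraMap_mem_maxFrac (R := R) (Q := Q) ha)

/-- The endomorphism ring `𝔪 : 𝔪` of the maximal ideal of `R`. -/
def endMax (R Q : Type u) [CommRing R] [IsLocalRing R] [CommRing Q] [Algebra R Q] :
    Subalgebra R Q where
  __ := colonMax (maxFrac R Q)
  mul_mem' {p q} hp hq a ha := by
    obtain ⟨b, hb, h⟩ := hp a ha
    rw [← smul_mul_assoc, ← h, Algebra.linearMap_apply, ← Algebra.smul_def]
    exact hq b hb
  algebraMap_mem' r a ha := by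
    rw [Algebra.smul_def, ← map_mul]
    exact algebraMap_mem_maxFrac (Q := Q) (Ideal.mul_mem_right r _ ha)

lemma mem_endMax_of_isUnit {c : endMax R Q} (hc : IsUnit c) :
    ∃ w : Qˣ, (w : Q) = c ∧ ((w⁻¹ : Qˣ) : Q) ∈ endMax R Q := by
  obtain ⟨c, rfl⟩ := hc
  exact ⟨Units.map (endMax R Q).val.toMonoidHom c, rfl, ((c⁻¹ : (endMax R Q)ˣ) : endMax R Q).2⟩

variable [IsFractionRing R Q]

lemma one_notMem_maxFrac : (1 : Q) ∉ maxFrac R Q := by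
  rintro ⟨a, ha, h⟩
  rw [Algebra.linearMap_apply, ← map_one (algebraMap R Q)] at h
  rw [IsFractionRing.injective R Q h] at ha
  exact (Ideal.ne_top_iff_one _).1 (maximalIdeal.isMaximal R).ne_top ha

lemma maxFrac_covBy_one : maxFrac R Q ⋖ 1 := by
  refine ⟨lt_of_le_not_ge maxFrac_le_one fun h => one_notMem_maxFrac (h (Submodule.one_le.1 le_rfl)),
    fun N h1 h2 => h2.not_ge ?_⟩
  obtain ⟨q, hqN, hq⟩ := SetLike.exists_of_lt h1
  obtain ⟨r, rfl⟩ := Submodule.mem_one.1 (h2.le hqN)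
  have hu : IsUnit r := not_not.1 fun h => hq (algebraMap_mem_maxFrac ((mem_maximalIdeal r).2 h))
  obtain ⟨u, rfl⟩ := hu
  have := N.smul_mem (↑u⁻¹ : R) hqN
  rw [Algebra.smul_def, ← map_mul, Units.inv_mul, map_one] at this
  exact Submodule.one_le.2 this

variable (Q) in
/-- Either `𝔪` is generated by a regular element, that is `R` is a discrete valuation ring, or
`R : 𝔪 = 𝔪 : 𝔪`. -/
lemma exists_scale_eq_or_colonMax_one_eq :
    (∃ w : Qˣ, maxFrac R Q = scale w 1) ∨ colonMax (1 : Submodule R Q) = colonMax (maxFrac R Q) := by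
  by_cases h : colonMax (1 : Submodule R Q) ≤ colonMax (maxFrac R Q)
  · exact Or.inr (le_antisymm h fun q hq a ha => maxFrac_le_one (hq a ha))
  · left
    obtain ⟨z, hz, hz'⟩ := SetLike.not_le_iff_exists.1 h
    rw [mem_colonMax] at hz'
    push Not at hz'
    obtain ⟨b, hb, hbz⟩ := hz'
    obtain ⟨r, hr⟩ := Submodule.mem_one.1 (hz b hb)
    have hu : IsUnit r := not_not.1 fun h =>
      hbz (hr ▸ algebraMap_mem_maxFrac ((mem_maximalIdeal r).2 h))
    obtain ⟨u, rfl⟩ := hu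
    -- `a = u⁻¹ b` has inverse `z ∈ R : 𝔪`
    have haz : algebraMap R Q (↑u⁻¹ * b) * z = 1 := by
      rw [map_mul, mul_assoc, ← Algebra.smul_def b, ← hr, ← map_mul, Units.inv_mul, map_one]
    refine ⟨Units.mkOfMulEqOne _ _ haz, le_antisymm ?_ ?_⟩
    · rintro _ ⟨c, hc, rfl⟩
      rw [mem_scale]
      have := hz c hc
      rwa [Algebra.smul_def, mul_comm] at this
    · rintro _ ⟨q, hq, rfl⟩
      obtain ⟨s, rfl⟩ := Submodule.mem_one.1 hq
      exact ⟨↑u⁻¹ * b * s, Ideal.mul_mem_right _ _ (Ideal.mul_mem_left _ _ hb),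
        map_mul (algebraMap R Q) _ _⟩

lemma endMax_eq_one_of_scale {w : Qˣ} (h : maxFrac R Q = scale w 1) :
    colonMax (1 : Submodule R Q) = scale w⁻¹ 1 ∧ colonMax (maxFrac R Q) = 1 := by
  have h1 : colonMax (1 : Submodule R Q) = scale w⁻¹ 1 := by
    ext q
    rw [mem_scale, inv_inv]
    constructor
    · intro hq
      have hw : (w : Q) ∈ maxFrac R Q := by
        rw [h, mem_scale, Units.inv_mul]
        exact Submodule.one_le.1 le_rfl
      obtain ⟨a, ha, haw⟩ := hw
      rw [← haw, Algebra.linearMap_apply, ← Algebra.smul_def]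
      exact hq a ha
    · intro hq a ha
      have : algebraMap R Q a ∈ scale w 1 := h ▸ algebraMap_mem_maxFrac ha
      rw [mem_scale] at this
      have h2 := Submodule.mul_mem_mul this hq
      rw [Submodule.one_mul] at h2
      rw [Algebra.smul_def]
      convert h2 using 1
      rw [show ↑w⁻¹ * (algebraMap R Q) a * (↑w * q) = (↑w⁻¹ * ↑w) * ((algebraMap R Q) a * q) by ring,
        Units.inv_mul, one_mul]
  refine ⟨h1, ?_⟩
  rw [h, colonMax_scale, h1, scale_inv_scale']

variable [IsNoetherianRing R]

lemma isRegularFractional_maxFrac {x : R} (hxm : x ∈ maximalIdeal R)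
    (hx : x ∈ nonZeroDivisors R) : IsRegularFractional (maxFrac R Q) :=
  ⟨(IsNoetherian.noetherian (maximalIdeal R)).map _, regUnit Q hx, algebraMap_mem_maxFrac hxm⟩

lemma colonMax_fg {x : R} (hxm : x ∈ maximalIdeal R) (hx : x ∈ nonZeroDivisors R)
    {L : Submodule R Q} (hL : IsRegularFractional L) : (colonMax L).FG := by
  refine fg_of_le (hL.scale (regUnit Q hx)⁻¹).fg fun q hq => ?_
  rw [mem_scale, inv_inv, coe_regUnit, ← Algebra.smul_def]
  exact hq x hxm

variable [Ring.KrullDimLE 1 R]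

/-- If `R` is not a discrete valuation ring, no canonical fractional ideal is stable under
`𝔪 : 𝔪`, because `L : L = R`. -/
lemma not_stable_of_covBy {x : R} (hxm : x ∈ maximalIdeal R) (hx : x ∈ nonZeroDivisors R)
    (hC : colonMax (1 : Submodule R Q) = colonMax (maxFrac R Q)) {L : Submodule R Q}
    (hLr : IsRegularFractional L) (hL : L ⋖ colonMax L) :
    ¬ ∀ c ∈ endMax R Q, ∀ l ∈ L, c * l ∈ L := by
  intro h
  refine not_colonMax_le hxm hx (isRegularFractional_one (R := R) (Q := Q)) ?_
  rw [hC, ← div_self_of_covBy hLr hL]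
  exact fun c hc => Submodule.mem_div_iff_forall_mul_mem.2 (h c hc)

variable (R Q) in
/-- The existence of a canonical fractional ideal `L` with `𝔪 ⊆ L ⊆ 𝔪 : 𝔪` and `1 ∉ L`. -/
def HasCanonicalBelowEndMax : Prop :=
  ∃ L : Submodule R Q, IsRegularFractional L ∧ L ⋖ colonMax L ∧ maxFrac R Q ≤ L ∧ (1 : Q) ∉ L ∧
    L ≤ colonMax (maxFrac R Q)

variable (Q) in
/-- A discrete valuation ring is almost Gorenstein. -/
lemma isAlmostGorenstein_of_scale (hCM : IsCohenMacaulayLocal R) (hdim : ringKrullDim R = 1)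
    {w : Qˣ} (h : maxFrac R Q = scale w 1) : IsAlmostGorenstein R := by
  refine (isAlmostGorenstein_iff (Q := Q) hCM hdim).2
    ⟨1, isRegularFractional_one, ?_, Submodule.one_le.1 le_rfl, le_colonMax 1⟩
  have := scale_covBy_scale (w := w⁻¹) (maxFrac_covBy_one (R := R) (Q := Q))
  rwa [h, scale_inv_scale, ← (endMax_eq_one_of_scale h).1] at this

lemma moduleFinite_endMax {x : R} (hxm : x ∈ maximalIdeal R) (hx : x ∈ nonZeroDivisors R) :
    Module.Finite R (endMax R Q) :=
  Module.Finite.iff_fg.2 (colonMax_fg hxm hx (isRegularFractional_maxFrac hxm hx))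

/-- The maximal ideals of `𝔪 : 𝔪`, as `R`-submodules. -/
def maximalSubmodules (R Q : Type u) [CommRing R] [IsLocalRing R] [CommRing Q] [Algebra R Q] :
    Set (Submodule R (endMax R Q)) :=
  (Submodule.restrictScalars R) '' {P : Ideal (endMax R Q) | P.IsMaximal}

lemma isUnit_of_notMem_maximalSubmodules {c : endMax R Q}
    (h : ∀ P ∈ maximalSubmodules R Q, c ∉ P) : IsUnit c := by
  by_contra hc
  obtain ⟨P, hP, hcP⟩ := exists_max_ideal_of_mem_nonunits hc
  exact h _ ⟨P, hP, rfl⟩ hcP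

/-- An almost Gorenstein ring has a canonical fractional ideal between `𝔪` and `𝔪 : 𝔪` that does
not contain `1`: if `R` is not a discrete valuation ring, take a canonical ideal
`R ⊆ L ⊆ 𝔪 : 𝔪` and divide it by a unit of `𝔪 : 𝔪` outside `L`. -/
lemma IsAlmostGorenstein.hasCanonicalBelowEndMax [Infinite (ResidueField R)]
    (h : IsAlmostGorenstein R) : HasCanonicalBelowEndMax R Q := by
  have hCM := h.1
  have hdim := h.2.1
  obtain ⟨x, hxm, hx⟩ := hCM.exists_nonZeroDivisor hdim
  obtain ⟨w, hw⟩ | hC := exists_scale_eq_or_colonMax_one_eq (R := R) Q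
  · refine ⟨maxFrac R Q, isRegularFractional_maxFrac hxm hx, ?_, le_rfl, one_notMem_maxFrac,
      le_colonMax _⟩
    rw [(endMax_eq_one_of_scale hw).2]
    exact maxFrac_covBy_one
  · obtain ⟨L, hLr, hL, h1, hLC⟩ := (isAlmostGorenstein_iff (Q := Q) hCM hdim).1 h
    rw [hC] at hLC
    have hRL : (1 : Submodule R Q) ≤ L := Submodule.one_le.2 h1
    have hCL : ¬ colonMax (maxFrac R Q) ≤ L := fun hle =>
      not_stable_of_covBy hxm hx hC hLr hL fun c hc l hl =>
        hle ((endMax R Q).mul_mem hc (hLC hl))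
    obtain ⟨y, hy, hyL⟩ := SetLike.not_le_iff_exists.1 hCL
    have := moduleFinite_endMax (Q := Q) hxm hx
    obtain ⟨a, ha⟩ := exists_add_smul_notMem (s := maximalSubmodules R Q)
      ((finite_setOf_isMaximal R (endMax R Q)).image _) (l := ⟨y, hy⟩) (w := 1) (by
        rintro _ ⟨P, hP, rfl⟩
        exact Or.inr ((Ideal.ne_top_iff_one P).1 (Ideal.IsMaximal.ne_top hP)))
    obtain ⟨w, hw, hwC⟩ := mem_endMax_of_isUnit (isUnit_of_notMem_maximalSubmodules ha)
    have hw' : (w : Q) = y + a • 1 := hw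
    have hwL : (w : Q) ∉ L := fun h' => hyL (by
      rw [hw'] at h'
      have := L.sub_mem h' (L.smul_mem a h1)
      rwa [add_sub_cancel_right] at this)
    have hwC' : (w : Q) ∈ endMax R Q := hw ▸ Subtype.mem _
    refine ⟨scale w⁻¹ L, hLr.scale _, ?_, ?_, ?_, ?_⟩
    · rw [colonMax_scale]
      exact scale_covBy_scale hL
    · rintro _ ⟨b, hb, rfl⟩
      rw [mem_scale, inv_inv, Algebra.linearMap_apply, mul_comm, ← Algebra.smul_def]
      exact hRL (maxFrac_le_one (hwC' b hb))
    · rwa [mem_scale, inv_inv, mul_one]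
    · intro q hq
      rw [mem_scale, inv_inv] at hq
      have := (endMax R Q).mul_mem hwC (hLC hq)
      rwa [Units.inv_mul_cancel_left] at this

/-- Conversely, a canonical fractional ideal `L` with `𝔪 ⊆ L ⊆ 𝔪 : 𝔪` and `1 ∉ L` is a hyperplane
of `𝔪 : 𝔪`. If `R` is not a discrete valuation ring, `L` is not an ideal of `𝔪 : 𝔪`, so that it
contains a unit of `𝔪 : 𝔪`. -/
lemma HasCanonicalBelowEndMax.isAlmostGorenstein [Infinite (ResidueField R)]
    (hCM : IsCohenMacaulayLocal R) (hdim : ringKrullDim R = 1)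
    (h : HasCanonicalBelowEndMax R Q) : IsAlmostGorenstein R := by
  obtain ⟨x, hxm, hx⟩ := hCM.exists_nonZeroDivisor hdim
  obtain ⟨w, hw⟩ | hC := exists_scale_eq_or_colonMax_one_eq (R := R) Q
  · exact isAlmostGorenstein_of_scale Q hCM hdim hw
  · obtain ⟨L, hLr, hL, hmL, h1, hLC⟩ := h
    have hCL : colonMax (maxFrac R Q) ≤ colonMax L := fun q hq a ha => hmL (hq a ha)
    have h1C : (1 : Q) ∈ colonMax (maxFrac R Q) := one_mem_colonMax le_rfl
    have hlt : L < colonMax (maxFrac R Q) :=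
      lt_of_le_of_ne hLC fun h' => h1 (h' ▸ h1C)
    have := moduleFinite_endMax (Q := Q) hxm hx
    obtain ⟨l, hl, hlP⟩ := exists_mem_notMem (s := maximalSubmodules R Q)
      ((finite_setOf_isMaximal R (endMax R Q)).image _)
      (L := L.comap (endMax R Q).val.toLinearMap) (by
        rintro _ ⟨P, hP, rfl⟩ hle
        -- a maximal ideal of `𝔪 : 𝔪` containing `L` would be equal to `L`
        have hPL : ∀ c ∈ P, (c : Q) ∈ L := by
          let N : Submodule R Q := (P.restrictScalars R).map (endMax R Q).val.toLinearMap
          have hLN : L ≤ N := fun q hq => ⟨⟨q, hLC hq⟩, hle hq, rfl⟩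
          have hNC : N < colonMax L := by
            refine lt_of_lt_of_le (lt_of_le_of_ne ?_ ?_) hCL
            · rintro _ ⟨c, -, rfl⟩
              exact c.2
            · intro h'
              obtain ⟨c, hc, hc1⟩ := (h' ▸ h1C : (1 : Q) ∈ N)
              have : c = 1 := Subtype.ext hc1
              exact (Ideal.ne_top_iff_one P).1 (Ideal.IsMaximal.ne_top hP) (this ▸ hc)
          intro c hc
          have hN : N = L := by
            by_contra hne
            exact hL.2 (lt_of_le_of_ne hLN (Ne.symm hne)) hNC
          exact hN ▸ ⟨c, hc, rfl⟩
        exact not_stable_of_covBy hxm hx hC hLr hL fun c hc q hq =>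
          hPL _ (Ideal.mul_mem_left P ⟨c, hc⟩ (hle (show (⟨q, hLC hq⟩ : endMax R Q) ∈ _ from hq))))
    obtain ⟨w, hw, hwC⟩ := mem_endMax_of_isUnit (isUnit_of_notMem_maximalSubmodules hlP)
    refine (isAlmostGorenstein_iff (Q := Q) hCM hdim).2 ⟨scale w⁻¹ L, hLr.scale _, ?_, ?_, ?_⟩
    · rw [colonMax_scale]
      exact scale_covBy_scale hL
    · rw [mem_scale, inv_inv, mul_one, hw]
      exact hl
    · intro q hq
      rw [mem_scale, inv_inv] at hq
      have := (endMax R Q).mul_mem hwC (hLC hq)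
      rw [Units.inv_mul_cancel_left] at this
      rw [hC]
      exact this

/-- If `R` is not a discrete valuation ring and `L ⊇ 𝔪` is a canonical fractional ideal, then
`𝔪 ⊆ 𝔪 L`, since `L : 𝔪 L = R : 𝔪 = 𝔪 : 𝔪` multiplies `𝔪` into `L`. -/
lemma maxFrac_le_mul {x : R} (hxm : x ∈ maximalIdeal R) (hx : x ∈ nonZeroDivisors R)
    (hC : colonMax (1 : Submodule R Q) = colonMax (maxFrac R Q)) {L : Submodule R Q}
    (hLr : IsRegularFractional L) (hL : L ⋖ colonMax L) (hmL : maxFrac R Q ≤ L) :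
    maxFrac R Q ≤ L * maxFrac R Q := by
  rw [← div_div_cancel_of_covBy hLr hL (hLr.mul (isRegularFractional_maxFrac hxm hx)),
    div_mul_eq, div_self_of_covBy hLr hL]
  rintro _ ⟨a, ha, rfl⟩
  refine Submodule.mem_div_iff_forall_mul_mem.2 fun q hq => hmL ?_
  have hq' : q ∈ colonMax (1 : Submodule R Q) := fun b hb => by
    rw [Algebra.smul_def, mul_comm]
    exact Submodule.mem_div_iff_forall_mul_mem.1 hq _ (algebraMap_mem_maxFrac hb)
  rw [Algebra.linearMap_apply, ← Algebra.smul_def]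
  exact (hC ▸ hq') a ha

end EndMax

/-! ### Fiber products over the residue field -/

/-- `A` is the fiber product of the local rings `R` and `S` over their common residue field: it maps
onto both of them, embeds into `R × S`, and contains `𝔪 × 𝔫`. -/
structure IsResidueFiberProduct (A R S : Type*) [CommRing A] [IsLocalRing A] [CommRing R]
    [IsLocalRing R] [CommRing S] [IsLocalRing S] [Algebra A R] [Algebra A S] : Prop where
  surjective_left : Function.Surjective (algebraMap A R)
  surjective_right : Function.Surjective (algebraMap A S)
  eq_zero : ∀ a : A, algebraMap A R a = 0 → algebraMap A S a = 0 → a = 0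
  exists_lift : ∀ r ∈ maximalIdeal R, ∀ s ∈ maximalIdeal S,
    ∃ a ∈ maximalIdeal A, algebraMap A R a = r ∧ algebraMap A S a = s

lemma mem_maximalIdeal_of_surjective {A R : Type*} [CommRing A] [IsLocalRing A] [CommRing R]
    [IsLocalRing R] {f : A →+* R} (hf : Function.Surjective f) {a : A} (ha : a ∈ maximalIdeal A) :
    f a ∈ maximalIdeal R := by
  refine (mem_maximalIdeal _).2 fun hu => ?_
  obtain ⟨r, hr⟩ := hu.exists_right_inv
  obtain ⟨b, rfl⟩ := hf r
  have hu' : IsUnit (1 - a * b) :=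
    (isUnit_or_isUnit_one_sub_self (a * b)).resolve_left fun h =>
      (mem_maximalIdeal a).1 ha (isUnit_of_mul_isUnit_left h)
  have := hu'.map f
  rw [map_sub, map_mul, hr, map_one, sub_self] at this
  exact not_isUnit_zero this

lemma isNoetherian_of_surjective_algebraMap {A R : Type*} [CommRing A] [CommRing R] [Algebra A R]
    [IsNoetherianRing R] (h : Function.Surjective (algebraMap A R)) : IsNoetherian A R := by
  refine ⟨fun N => ?_⟩
  let I : Ideal R :=
    { N with
      smul_mem' := fun r n hn => by
        obtain ⟨a, rfl⟩ := h r
        rw [smul_eq_mul, ← Algebra.smul_def]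
        exact N.smul_mem a hn }
  exact ((IsNoetherian.noetherian I).restrictScalars_of_surjective h : (I.restrictScalars A).FG)

/-- If `N = K + R v` with `v ∉ K` and `𝔪 v ⊆ K`, then `N / K` is simple. -/
lemma covBy_of_forall {R M : Type*} [CommRing R] [IsLocalRing R] [AddCommGroup M] [Module R M]
    {K N : Submodule R M} (hKN : K ≤ N) {v : M} (hv : v ∈ N) (hvK : v ∉ K) (hvm : v ∈ colonMax K)
    (h : ∀ q ∈ N, ∃ b : R, q - b • v ∈ K) : K ⋖ N := by
  refine ⟨lt_of_le_of_ne hKN fun h' => hvK (h' ▸ hv), fun N' h1 h2 => h2.not_ge fun q hq => ?_⟩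
  have hvN' : v ∈ N' := by
    obtain ⟨p, hp, hpK⟩ := SetLike.exists_of_lt h1
    obtain ⟨b, hb⟩ := h p (h2.le hp)
    have hu : IsUnit b := not_not.1 fun hb' => hpK (by
      have := K.add_mem hb (hvm b ((mem_maximalIdeal b).2 hb'))
      rwa [sub_add_cancel] at this)
    obtain ⟨u, rfl⟩ := hu
    have := N'.sub_mem hp (h1.le hb)
    rw [sub_sub_cancel] at this
    have := N'.smul_mem (↑u⁻¹ : R) this
    rwa [smul_smul, Units.inv_mul, one_smul] at this
  obtain ⟨b, hb⟩ := h q hq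
  have := N'.add_mem (h1.le hb) (N'.smul_mem b hvN')
  rwa [sub_add_cancel] at this

lemma exists_sub_smul_mem {R M : Type*} [CommRing R] [AddCommGroup M] [Module R M]
    {K N : Submodule R M} (h : K ⋖ N) {v : M} (hv : v ∈ N) (hvK : v ∉ K) {q : M} (hq : q ∈ N) :
    ∃ b : R, q - b • v ∈ K := by
  have hsup : K ⊔ Submodule.span R {v} = N := by
    refine (h.eq_or_eq le_sup_left (sup_le h.le ?_)).resolve_left fun h' => hvK ?_
    · rwa [Submodule.span_singleton_le_iff_mem]
    · rw [← h']
      exact Submodule.mem_sup_right (Submodule.mem_span_singleton_self v)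
  rw [← hsup] at hq
  obtain ⟨k, hk, _, hb, rfl⟩ := Submodule.mem_sup.1 hq
  obtain ⟨b, rfl⟩ := Submodule.mem_span_singleton.1 hb
  exact ⟨b, by rwa [add_sub_cancel_right]⟩

namespace IsResidueFiberProduct

variable {A R S : Type u} [CommRing A] [IsLocalRing A] [CommRing R] [IsLocalRing R] [CommRing S]
  [IsLocalRing S] [Algebra A R] [Algebra A S]

lemma symm (h : IsResidueFiberProduct A R S) : IsResidueFiberProduct A S R where
  surjective_left := h.surjective_right
  surjective_right := h.surjective_left
  eq_zero a h1 h2 := h.eq_zero a h2 h1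
  exists_lift s hs r hr := by
    obtain ⟨a, ha, h1, h2⟩ := h.exists_lift r hr s hs
    exact ⟨a, ha, h2, h1⟩

lemma algebraMap_mem (h : IsResidueFiberProduct A R S) {a : A} (ha : a ∈ maximalIdeal A) :
    algebraMap A R a ∈ maximalIdeal R :=
  mem_maximalIdeal_of_surjective h.surjective_left ha

lemma isNoetherianRing (h : IsResidueFiberProduct A R S) [IsNoetherianRing R]
    [IsNoetherianRing S] : IsNoetherianRing A := by
  have := isNoetherian_of_surjective_algebraMap h.surjective_left
  have := isNoetherian_of_surjective_algebraMap h.surjective_right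
  exact isNoetherian_of_injective ((Algebra.linearMap A R).prod (Algebra.linearMap A S))
    (by
      rw [injective_iff_map_eq_zero]
      intro a ha
      exact h.eq_zero a (congrArg Prod.fst ha) (congrArg Prod.snd ha))

/-- A prime ideal of `A` contains the kernel of one of the two projections. -/
lemma ker_le_or_ker_le (h : IsResidueFiberProduct A R S) {P : Ideal A} (hP : P.IsPrime) :
    RingHom.ker (algebraMap A R) ≤ P ∨ RingHom.ker (algebraMap A S) ≤ P := by
  by_contra! hn
  obtain ⟨⟨a, ha, haP⟩, ⟨b, hb, hbP⟩⟩ :=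
    And.intro (SetLike.not_le_iff_exists.1 hn.1) (SetLike.not_le_iff_exists.1 hn.2)
  rw [RingHom.mem_ker] at ha hb
  have : a * b = 0 := h.eq_zero _ (by rw [map_mul, ha, zero_mul]) (by rw [map_mul, hb, mul_zero])
  exact (hP.mem_or_mem (this ▸ P.zero_mem : a * b ∈ P)).elim haP hbP

lemma maximalIdeal_le_ker_sup_ker (h : IsResidueFiberProduct A R S) :
    maximalIdeal A ≤ RingHom.ker (algebraMap A R) ⊔ RingHom.ker (algebraMap A S) := by
  intro a ha
  obtain ⟨b, -, hb1, hb2⟩ := h.exists_lift _ (h.algebraMap_mem ha) 0 (zero_mem _)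
  refine Submodule.mem_sup.2 ⟨a - b, ?_, b, hb2, sub_add_cancel a b⟩
  rw [RingHom.mem_ker, map_sub, hb1, sub_self]

lemma isMaximal_or_mem_minimalPrimes (h : IsResidueFiberProduct A R S) [Ring.KrullDimLE 1 R]
    {P : Ideal A} (hP : P.IsPrime) (hPR : RingHom.ker (algebraMap A R) ≤ P) :
    P ∈ minimalPrimes A ∨ P.IsMaximal := by
  by_cases hPS : RingHom.ker (algebraMap A S) ≤ P
  · right
    rw [← (maximalIdeal.isMaximal A).eq_of_le hP.ne_top
      (h.maximalIdeal_le_ker_sup_ker.trans (sup_le hPR hPS))]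
    exact maximalIdeal.isMaximal A
  have hf := h.surjective_left
  have hcomap : (P.map (algebraMap A R)).comap (algebraMap A R) = P := by
    rw [Ideal.comap_map_of_surjective' _ hf, sup_eq_left]
    exact hPR
  have hP' : (P.map (algebraMap A R)).IsPrime := Ideal.map_isPrime_of_surjective hf hPR
  rcases Ring.krullDimLE_one_iff.1 ‹_› _ hP' with hmin | hmax
  · left
    refine ⟨⟨hP, bot_le⟩, fun q hq hqP => ?_⟩
    have hqR : RingHom.ker (algebraMap A R) ≤ q :=
      (h.ker_le_or_ker_le hq.1).resolve_right fun h' => hPS (h'.trans hqP)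
    have hq1 := hq.1
    have := hmin.2 ⟨Ideal.map_isPrime_of_surjective hf hqR, bot_le⟩ (Ideal.map_mono hqP)
    rw [← hcomap]
    refine (Ideal.comap_mono this).trans ?_
    rw [Ideal.comap_map_of_surjective' _ hf, sup_eq_left.2 hqR]
  · right
    rw [← hcomap]
    exact Ideal.comap_isMaximal_of_surjective _ hf

lemma krullDimLE_one (h : IsResidueFiberProduct A R S) [Ring.KrullDimLE 1 R]
    [Ring.KrullDimLE 1 S] : Ring.KrullDimLE 1 A :=
  Ring.krullDimLE_one_iff.2 fun _ hP => (h.ker_le_or_ker_le hP).elim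
    (h.isMaximal_or_mem_minimalPrimes hP) (h.symm.isMaximal_or_mem_minimalPrimes hP)

lemma ringKrullDim_eq_one (h : IsResidueFiberProduct A R S) (hR : ringKrullDim R = 1)
    (hS : ringKrullDim S = 1) : ringKrullDim A = 1 := by
  have := krullDimLE_one_of_eq hR
  have := krullDimLE_one_of_eq hS
  have := h.krullDimLE_one
  refine le_antisymm ?_ (hR ▸ ringKrullDim_le_of_surjective _ h.surjective_left)
  exact_mod_cast Ring.krullDimLE_iff.1 this

lemma algebraMap_mem_nonZeroDivisors (h : IsResidueFiberProduct A R S) {x : R}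
    (hxm : x ∈ maximalIdeal R) (hx : x ∈ nonZeroDivisors R) {a : A} (ha : a ∈ nonZeroDivisors A) :
    algebraMap A R a ∈ nonZeroDivisors R := by
  refine mem_nonZeroDivisors_iff_right.2 fun r hr => ?_
  obtain ⟨b, -, hb1, hb2⟩ := h.exists_lift (r * x) (Ideal.mul_mem_left _ r hxm) 0 (zero_mem _)
  have hab : b * a = 0 := h.eq_zero _
    (by rw [map_mul, hb1, mul_right_comm, hr, zero_mul]) (by rw [map_mul, hb2, zero_mul])
  rw [mem_nonZeroDivisors_iff_right.1 ha b hab, map_zero] at hb1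
  exact mem_nonZeroDivisors_iff_right.1 hx r hb1.symm

lemma exists_nonZeroDivisor (h : IsResidueFiberProduct A R S) {x : R} (hxm : x ∈ maximalIdeal R)
    (hx : x ∈ nonZeroDivisors R) {y : S} (hym : y ∈ maximalIdeal S) (hy : y ∈ nonZeroDivisors S) :
    ∃ a ∈ maximalIdeal A, algebraMap A R a = x ∧ algebraMap A S a = y ∧ a ∈ nonZeroDivisors A := by
  obtain ⟨a, ha, h1, h2⟩ := h.exists_lift x hxm y hym
  refine ⟨a, ha, h1, h2, mem_nonZeroDivisors_iff_right.2 fun b hb => h.eq_zero b ?_ ?_⟩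
  · exact mem_nonZeroDivisors_iff_right.1 hx _ (by rw [← h1, ← map_mul, hb, map_zero])
  · exact mem_nonZeroDivisors_iff_right.1 hy _ (by rw [← h2, ← map_mul, hb, map_zero])

lemma isCohenMacaulayLocal (h : IsResidueFiberProduct A R S) (hR : IsCohenMacaulayLocal R)
    (hRdim : ringKrullDim R = 1) (hS : IsCohenMacaulayLocal S) (hSdim : ringKrullDim S = 1) :
    IsCohenMacaulayLocal A := by
  obtain ⟨x, hxm, hx⟩ := hR.exists_nonZeroDivisor hRdim
  obtain ⟨y, hym, hy⟩ := hS.exists_nonZeroDivisor hSdim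
  have := hR.1
  have := hS.1
  have hA := h.isNoetherianRing
  obtain ⟨a, ham, -, -, ha⟩ := h.exists_nonZeroDivisor hxm hx hym hy
  refine ⟨hA, inferInstance, [a], by simpa using ham,
    isRegular_singleton ham fun b c hbc => ?_, by simp [h.ringKrullDim_eq_one hRdim hSdim]⟩
  have : (b - c) * a = 0 := by
    rw [sub_mul, mul_comm b, mul_comm c]
    exact sub_eq_zero.2 hbc
  exact sub_eq_zero.1 (mem_nonZeroDivisors_iff_right.1 ha _ this)

/-- The fiber product is not a discrete valuation ring. -/
lemma colonMax_one_eq {Q : Type u} [CommRing Q] [Algebra A Q] [IsFractionRing A Q]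
    (h : IsResidueFiberProduct A R S) {x : R} (hxm : x ∈ maximalIdeal R)
    (hx : x ∈ nonZeroDivisors R) {y : S} (hym : y ∈ maximalIdeal S) (hy : y ∈ nonZeroDivisors S) :
    colonMax (1 : Submodule A Q) = colonMax (maxFrac A Q) := by
  refine (exists_scale_eq_or_colonMax_one_eq (R := A) Q).resolve_left ?_
  rintro ⟨w, hw⟩
  have hwm : (w : Q) ∈ maxFrac A Q := by
    rw [hw, mem_scale, Units.inv_mul]
    exact Submodule.one_le.1 le_rfl
  obtain ⟨a, ham, haw⟩ := hwm
  rw [Algebra.linearMap_apply] at haw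
  have ha : a ∈ nonZeroDivisors A := mem_nonZeroDivisors_iff_right.2 fun b hb => by
    refine IsFractionRing.injective A Q ?_
    rw [map_zero, ← Units.mul_left_eq_zero w, ← haw, ← map_mul, hb, map_zero]
  -- the generator `a = (r, s)` of the maximal ideal would divide `(r, 0)`
  obtain ⟨b, hbm, hb1, hb2⟩ := h.exists_lift _ (h.algebraMap_mem ham) 0 (zero_mem _)
  have hbw : algebraMap A Q b ∈ scale w 1 := hw ▸ algebraMap_mem_maxFrac hbm
  rw [mem_scale] at hbw
  obtain ⟨c, hc⟩ := Submodule.mem_one.1 hbw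
  have hbc : b = a * c := IsFractionRing.injective A Q (by
    rw [map_mul, haw, hc, Units.mul_inv_cancel_left])
  have hc1 : algebraMap A R (1 - c) = 0 := by
    refine mem_nonZeroDivisors_iff_right.1 (h.algebraMap_mem_nonZeroDivisors hxm hx ha) _ ?_
    rw [map_sub, map_one, sub_mul, one_mul, mul_comm, ← map_mul, ← hbc, hb1, sub_self]
  have hc2 : algebraMap A S c = 0 := by
    refine mem_nonZeroDivisors_iff_right.1 (h.symm.algebraMap_mem_nonZeroDivisors hym hy ha) _ ?_
    rw [mul_comm, ← map_mul, ← hbc, hb2]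
  rcases isUnit_or_isUnit_one_sub_self c with hu | hu
  · exact (hu.map (algebraMap A S)).ne_zero hc2
  · exact (hu.map (algebraMap A R)).ne_zero hc1

section FractionRing

variable {QR QS : Type u} [CommRing QR] [CommRing QS] [Algebra R QR] [Algebra S QS]
  [IsFractionRing R QR] [IsFractionRing S QS] [Algebra A QR] [Algebra A QS] [IsScalarTower A R QR]
  [IsScalarTower A S QS]

/-- The total fraction ring of the fiber product is `Q(R) × Q(S)`. -/
lemma isFractionRing (h : IsResidueFiberProduct A R S) {x : R} (hxm : x ∈ maximalIdeal R)
    (hx : x ∈ nonZeroDivisors R) {y : S} (hym : y ∈ maximalIdeal S) (hy : y ∈ nonZeroDivisors S) :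
    IsFractionRing A (QR × QS) where
  map_units := by
    rintro ⟨a, ha⟩
    rw [Prod.isUnit_iff]
    refine ⟨?_, ?_⟩
    · change IsUnit (algebraMap A QR a)
      rw [IsScalarTower.algebraMap_apply A R QR]
      exact IsLocalization.map_units QR ⟨_, h.algebraMap_mem_nonZeroDivisors hxm hx ha⟩
    · change IsUnit (algebraMap A QS a)
      rw [IsScalarTower.algebraMap_apply A S QS]
      exact IsLocalization.map_units QS ⟨_, h.symm.algebraMap_mem_nonZeroDivisors hym hy ha⟩
  surj := by
    rintro ⟨p, q⟩
    obtain ⟨⟨r, u, hu⟩, hp⟩ := IsLocalization.surj (nonZeroDivisors R) p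
    obtain ⟨⟨s, v, hv⟩, hq⟩ := IsLocalization.surj (nonZeroDivisors S) q
    obtain ⟨d, -, hd1, hd2, hd⟩ := h.exists_nonZeroDivisor (Ideal.mul_mem_left _ u hxm)
      (mul_mem hu hx) (Ideal.mul_mem_left _ v hym) (mul_mem hv hy)
    obtain ⟨c, -, hc1, hc2⟩ := h.exists_lift _ (Ideal.mul_mem_left _ r hxm) _
      (Ideal.mul_mem_left _ s hym)
    refine ⟨⟨c, d, hd⟩, Prod.ext ?_ ?_⟩
    · change p * algebraMap A QR d = algebraMap A QR c
      rw [IsScalarTower.algebraMap_apply A R QR, IsScalarTower.algebraMap_apply A R QR, hd1, hc1,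
        map_mul, map_mul, ← mul_assoc]
      exact congrArg (· * algebraMap R QR x) hp
    · change q * algebraMap A QS d = algebraMap A QS c
      rw [IsScalarTower.algebraMap_apply A S QS, IsScalarTower.algebraMap_apply A S QS, hd2, hc2,
        map_mul, map_mul, ← mul_assoc]
      exact congrArg (· * algebraMap S QS y) hq
  exists_of_eq := by
    intro a b hab
    refine ⟨1, ?_⟩
    have h1 : algebraMap A QR a = algebraMap A QR b := congrArg Prod.fst hab
    have h2 : algebraMap A QS a = algebraMap A QS b := congrArg Prod.snd hab
    rw [IsScalarTower.algebraMap_apply A R QR, IsScalarTower.algebraMap_apply A R QR] at h1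
    rw [IsScalarTower.algebraMap_apply A S QS, IsScalarTower.algebraMap_apply A S QS] at h2
    rw [sub_eq_zero.1 (h.eq_zero (a - b)
      (by rw [map_sub, IsFractionRing.injective R QR h1, sub_self])
      (by rw [map_sub, IsFractionRing.injective S QS h2, sub_self]))]

lemma mem_maxFrac_prod (h : IsResidueFiberProduct A R S) {q : QR × QS} :
    q ∈ maxFrac A (QR × QS) ↔ q.1 ∈ maxFrac R QR ∧ q.2 ∈ maxFrac S QS := by
  constructor
  · rintro ⟨a, ha, rfl⟩
    exact ⟨⟨_, h.algebraMap_mem ha, (IsScalarTower.algebraMap_apply A R QR a).symm⟩,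
      ⟨_, h.symm.algebraMap_mem ha, (IsScalarTower.algebraMap_apply A S QS a).symm⟩⟩
  · obtain ⟨p, q⟩ := q
    rintro ⟨⟨r, hr, rfl⟩, ⟨s, hs, rfl⟩⟩
    obtain ⟨a, ha, h1, h2⟩ := h.exists_lift r hr s hs
    refine ⟨a, ha, Prod.ext ?_ ?_⟩
    · change algebraMap A QR a = algebraMap R QR r
      rw [IsScalarTower.algebraMap_apply A R QR, h1]
    · change algebraMap A QS a = algebraMap S QS s
      rw [IsScalarTower.algebraMap_apply A S QS, h2]

/-- The part of a fractional ideal `K` of the fiber product that lives on the factor `Q(R)`. -/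
def leftPart (h : IsResidueFiberProduct A R S) (K : Submodule A (QR × QS)) : Submodule R QR where
  carrier := {l | (l, 0) ∈ K}
  add_mem' {l m} hl hm := by
    have := K.add_mem hl hm
    rwa [Prod.mk_add_mk, add_zero] at this
  zero_mem' := K.zero_mem
  smul_mem' r l hl := by
    obtain ⟨a, rfl⟩ := h.surjective_left r
    have := K.smul_mem a hl
    rwa [Prod.smul_mk, smul_zero, ← algebraMap_smul R a l] at this

lemma mem_leftPart (h : IsResidueFiberProduct A R S) {K : Submodule A (QR × QS)} {l : QR} :
    l ∈ h.leftPart K ↔ (l, 0) ∈ K := Iff.rfl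

lemma mk_zero_mem_colonMax (h : IsResidueFiberProduct A R S) {K : Submodule A (QR × QS)} {l : QR} :
    (l, 0) ∈ colonMax K ↔ l ∈ colonMax (h.leftPart K) := by
  constructor
  · intro hl r hr
    obtain ⟨a, ha, h1, -⟩ := h.exists_lift r hr 0 (zero_mem _)
    have := hl a ha
    rwa [Prod.smul_mk, smul_zero, ← algebraMap_smul R a l, h1] at this
  · intro hl a ha
    have := hl _ (h.algebraMap_mem ha)
    rwa [algebraMap_smul, mem_leftPart, ← smul_zero a, ← Prod.smul_mk] at this

variable [IsNoetherianRing R] [Ring.KrullDimLE 1 R]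

/-- The left part `L` of a canonical fractional ideal `K` is canonical, as `(L : 𝔪) / L` embeds
into `(K : (𝔪 × 𝔫)) / K`. -/
lemma leftPart_covBy (h : IsResidueFiberProduct A R S) {x : R} (hxm : x ∈ maximalIdeal R)
    (hx : x ∈ nonZeroDivisors R) {K : Submodule A (QR × QS)} (hK : K ⋖ colonMax K)
    (hL : IsRegularFractional (h.leftPart K)) : h.leftPart K ⋖ colonMax (h.leftPart K) := by
  obtain ⟨v, hv, hvL⟩ := SetLike.not_le_iff_exists.1 (not_colonMax_le hxm hx hL)
  refine covBy_of_forall (le_colonMax _) hv hvL hv fun q hq => ?_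
  obtain ⟨b, hb⟩ := exists_sub_smul_mem hK (h.mk_zero_mem_colonMax.2 hv) hvL
    (h.mk_zero_mem_colonMax.2 hq)
  refine ⟨algebraMap A R b, ?_⟩
  rwa [Prod.smul_mk, smul_zero, Prod.mk_sub_mk, sub_zero, ← algebraMap_smul R b v] at hb

end FractionRing

end IsResidueFiberProduct

/-! ### Almost Gorenstein fiber products -/

namespace IsResidueFiberProduct

variable {A R S : Type u} [CommRing A] [IsLocalRing A] [CommRing R] [IsLocalRing R] [CommRing S]
  [IsLocalRing S] [Algebra A R] [Algebra A S]

section FractionRing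

variable {QR QS : Type u} [CommRing QR] [CommRing QS] [Algebra R QR] [Algebra S QS]
  [IsFractionRing R QR] [IsFractionRing S QS] [Algebra A QR] [Algebra A QS] [IsScalarTower A R QR]
  [IsScalarTower A S QS]

lemma mk_zero_mem_maxFrac (h : IsResidueFiberProduct A R S) {p : QR} (hp : p ∈ maxFrac R QR) :
    (p, (0 : QS)) ∈ maxFrac A (QR × QS) :=
  h.mem_maxFrac_prod.2 ⟨hp, zero_mem _⟩

lemma maxFrac_le_leftPart (h : IsResidueFiberProduct A R S) {K : Submodule A (QR × QS)}
    (hK : maxFrac A (QR × QS) ≤ K) : maxFrac R QR ≤ h.leftPart K := fun _ hp =>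
  hK (h.mk_zero_mem_maxFrac hp)

/-- The fractional ideal `L × M` of the fiber product. -/
def prodIdeal (L : Submodule R QR) (M : Submodule S QS) : Submodule A (QR × QS) :=
  (L.restrictScalars A).prod (M.restrictScalars A)

lemma maxFrac_le_prodIdeal (h : IsResidueFiberProduct A R S) {L : Submodule R QR}
    {M : Submodule S QS} (hL : maxFrac R QR ≤ L) (hM : maxFrac S QS ≤ M) :
    maxFrac A (QR × QS) ≤ prodIdeal L M := fun _ hq =>
  ⟨hL (h.mem_maxFrac_prod.1 hq).1, hM (h.mem_maxFrac_prod.1 hq).2⟩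

lemma mem_one_sup_prodIdeal {L : Submodule R QR} {M : Submodule S QS} {q : QR × QS} :
    q ∈ (1 : Submodule A (QR × QS)) ⊔ prodIdeal L M ↔ ∃ a : A,
      q.1 - algebraMap A QR a ∈ L ∧ q.2 - algebraMap A QS a ∈ M := by
  constructor
  · intro hq
    obtain ⟨_, h1, n, hn, rfl⟩ := Submodule.mem_sup.1 hq
    obtain ⟨a, rfl⟩ := Submodule.mem_one.1 h1
    refine ⟨a, ?_, ?_⟩
    · rw [Prod.fst_add, Prod.algebraMap_apply, add_sub_cancel_left]
      exact hn.1
    · rw [Prod.snd_add, Prod.algebraMap_apply, add_sub_cancel_left]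
      exact hn.2
  · rintro ⟨a, h1, h2⟩
    refine Submodule.mem_sup.2 ⟨algebraMap A _ a, Submodule.mem_one.2 ⟨a, rfl⟩, q - algebraMap A _ a,
      ⟨h1, h2⟩, add_sub_cancel _ _⟩

lemma mem_maximalIdeal_of_algebraMap_mem {L : Submodule R QR} (hL : (1 : QR) ∉ L) {a : A}
    (ha : algebraMap A QR a ∈ L) : a ∈ maximalIdeal A := by
  refine (mem_maximalIdeal a).2 fun hu => hL ?_
  obtain ⟨u, rfl⟩ := hu
  have := (L.restrictScalars A).smul_mem (↑u⁻¹ : A) ha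
  rwa [Algebra.smul_def, ← map_mul, Units.inv_mul, map_one] at this

lemma mem_colonMax_of_mem_colonMax_sup (h : IsResidueFiberProduct A R S) {L : Submodule R QR}
    {M : Submodule S QS} (hmL : maxFrac R QR ≤ L) (hM1 : (1 : QS) ∉ M) {q : QR × QS}
    (hq : q ∈ colonMax ((1 : Submodule A (QR × QS)) ⊔ prodIdeal L M)) : q.1 ∈ colonMax L := by
  intro r hr
  obtain ⟨b, hbm, hb1, hb2⟩ := h.exists_lift r hr 0 (zero_mem _)
  obtain ⟨a, ha1, ha2⟩ := mem_one_sup_prodIdeal.1 (hq b hbm)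
  have hs2 : (b • q).2 = 0 := by
    change b • q.2 = 0
    rw [← algebraMap_smul S b, hb2, zero_smul]
  rw [hs2, zero_sub, neg_mem_iff] at ha2
  have ham := mem_maximalIdeal_of_algebraMap_mem hM1 ha2
  have haL : algebraMap A QR a ∈ L := by
    rw [IsScalarTower.algebraMap_apply A R QR]
    exact hmL (algebraMap_mem_maxFrac (h.algebraMap_mem ham))
  have := L.add_mem ha1 haL
  rw [sub_add_cancel] at this
  change b • q.1 ∈ L at this
  rwa [← algebraMap_smul R b, hb1] at this

/-- If `L` and `M` are canonical fractional ideals of `R` and `S` not containing `1`, with `𝔪 ⊆ L`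
and `𝔫 ⊆ M`, then `A + L × M` is one of the fiber product `A`: both `A + L × M` and `(0, 1)` are
needed to generate `(L : 𝔪) × (M : 𝔫) = (L + R) × (M + S)`. -/
lemma one_sup_prodIdeal_covBy (h : IsResidueFiberProduct A R S) {L : Submodule R QR}
    {M : Submodule S QS} (hL : L ⋖ colonMax L) (hmL : maxFrac R QR ≤ L) (hL1 : (1 : QR) ∉ L)
    (hM : M ⋖ colonMax M) (hmM : maxFrac S QS ≤ M) (hM1 : (1 : QS) ∉ M) :
    (1 : Submodule A (QR × QS)) ⊔ prodIdeal L M ⋖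
      colonMax ((1 : Submodule A (QR × QS)) ⊔ prodIdeal L M) := by
  have hv : ((0 : QR), (1 : QS)) ∈ colonMax ((1 : Submodule A (QR × QS)) ⊔ prodIdeal L M) := by
    intro a ha
    refine Submodule.mem_sup_right ⟨?_, ?_⟩
    · rw [Prod.smul_mk, smul_zero]
      exact L.zero_mem
    · rw [Prod.smul_mk, ← Algebra.algebraMap_eq_smul_one, IsScalarTower.algebraMap_apply A S QS]
      exact hmM (algebraMap_mem_maxFrac (h.symm.algebraMap_mem ha))
  refine covBy_of_forall (le_colonMax _) hv (fun h1 => ?_) hv fun q hq => ?_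
  · obtain ⟨a, ha1, ha2⟩ := mem_one_sup_prodIdeal.1 h1
    rw [zero_sub, neg_mem_iff] at ha1
    have ham := mem_maximalIdeal_of_algebraMap_mem hL1 ha1
    refine hM1 ?_
    have haM : algebraMap A QS a ∈ M := by
      rw [IsScalarTower.algebraMap_apply A S QS]
      exact hmM (algebraMap_mem_maxFrac (h.symm.algebraMap_mem ham))
    have := M.add_mem ha2 haM
    rwa [sub_add_cancel] at this
  · have hq1 := h.mem_colonMax_of_mem_colonMax_sup hmL hM1 hq
    have hq2 : q.2 ∈ colonMax M := by
      refine h.symm.mem_colonMax_of_mem_colonMax_sup (q := q.swap) hmM hL1 fun a ha => ?_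
      obtain ⟨b, hb1, hb2⟩ := mem_one_sup_prodIdeal.1 (hq a ha)
      exact mem_one_sup_prodIdeal.2 ⟨b, hb2, hb1⟩
    obtain ⟨r, hr⟩ := exists_sub_smul_mem hL (one_mem_colonMax hmL) hL1 hq1
    obtain ⟨s, hs⟩ := exists_sub_smul_mem hM (one_mem_colonMax hmM) hM1 hq2
    obtain ⟨a, rfl⟩ := h.surjective_left r
    obtain ⟨b, rfl⟩ := h.surjective_right s
    rw [algebraMap_smul, ← Algebra.algebraMap_eq_smul_one] at hr hs
    refine ⟨b - a, mem_one_sup_prodIdeal.2 ⟨a, ?_, ?_⟩⟩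
    · rwa [Prod.smul_mk, smul_zero, Prod.fst_sub, sub_zero]
    · rw [Prod.smul_mk, Prod.snd_sub, ← Algebra.algebraMap_eq_smul_one, map_sub]
      convert hs using 1
      ring

end FractionRing

/-- If `R` and `S` are almost Gorenstein, with canonical ideals `L` and `M` below `𝔪 : 𝔪` and
`𝔫 : 𝔫`, then `K = A + L × M` is a canonical ideal of `A` with `(𝔪 × 𝔫) K ⊆ A`. -/
theorem isAlmostGorenstein (h : IsResidueFiberProduct A R S) [Infinite (ResidueField R)]
    [Infinite (ResidueField S)] (hR : IsAlmostGorenstein R) (hS : IsAlmostGorenstein S) :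
    IsAlmostGorenstein A := by
  obtain ⟨x, hxm, hx⟩ := hR.1.exists_nonZeroDivisor hR.2.1
  obtain ⟨y, hym, hy⟩ := hS.1.exists_nonZeroDivisor hS.2.1
  have := hR.1.1
  have := hS.1.1
  have := krullDimLE_one_of_eq hR.2.1
  have := krullDimLE_one_of_eq hS.2.1
  have hA := h.isCohenMacaulayLocal hR.1 hR.2.1 hS.1 hS.2.1
  have hAdim := h.ringKrullDim_eq_one hR.2.1 hS.2.1
  have := hA.1
  have := krullDimLE_one_of_eq hAdim
  obtain ⟨z, hzm, hz⟩ := hA.exists_nonZeroDivisor hAdim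
  let QR := FractionRing R
  let QS := FractionRing S
  have : IsFractionRing A (QR × QS) := h.isFractionRing hxm hx hym hy
  obtain ⟨L, -, hL, hmL, hL1, hLC⟩ := hR.hasCanonicalBelowEndMax (Q := QR)
  obtain ⟨M, -, hM, hmM, hM1, hMC⟩ := hS.hasCanonicalBelowEndMax (Q := QS)
  have h1K : (1 : QR × QS) ∈ (1 : Submodule A (QR × QS)) ⊔ prodIdeal L M :=
    Submodule.mem_sup_left (Submodule.one_le.1 le_rfl)
  have hK : (1 : Submodule A (QR × QS)) ⊔ prodIdeal L M ≤ colonMax (maxFrac A (QR × QS)) := by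
    refine sup_le (Submodule.one_le.2 (one_mem_colonMax le_rfl)) fun q hq a ha => ?_
    refine h.mem_maxFrac_prod.2 ⟨?_, ?_⟩
    · have := hLC hq.1 _ (h.algebraMap_mem ha)
      rwa [algebraMap_smul] at this
    · have := hMC hq.2 _ (h.symm.algebraMap_mem ha)
      rwa [algebraMap_smul] at this
  exact (isAlmostGorenstein_iff (Q := QR × QS) hA hAdim).2
    ⟨_, ⟨fg_of_le (colonMax_fg hzm hz (isRegularFractional_maxFrac hzm hz)) hK, 1, h1K⟩,
      h.one_sup_prodIdeal_covBy hL hmL hL1 hM hmM hM1, h1K,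
      hK.trans fun q hq a ha => maxFrac_le_one (hq a ha)⟩

/-- If the fiber product `A` is almost Gorenstein with canonical ideal `K`, the left part
`L = {l | (l, 0) ∈ K}` is a canonical ideal of `R` with `𝔪 ⊆ L ⊆ 𝔪 : 𝔪`. -/
theorem isAlmostGorenstein_left (h : IsResidueFiberProduct A R S) [Infinite (ResidueField R)]
    (hR : IsCohenMacaulayLocal R) (hRdim : ringKrullDim R = 1) (hS : IsCohenMacaulayLocal S)
    (hSdim : ringKrullDim S = 1) (hA : IsAlmostGorenstein A) : IsAlmostGorenstein R := by
  obtain ⟨x, hxm, hx⟩ := hR.exists_nonZeroDivisor hRdim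
  obtain ⟨y, hym, hy⟩ := hS.exists_nonZeroDivisor hSdim
  have := hR.1
  have := hS.1
  have := hA.1.1
  have := krullDimLE_one_of_eq hRdim
  have := krullDimLE_one_of_eq hSdim
  have := krullDimLE_one_of_eq hA.2.1
  let QR := FractionRing R
  let QS := FractionRing S
  have : IsFractionRing A (QR × QS) := h.isFractionRing hxm hx hym hy
  obtain ⟨K, -, hK, h1K, hKA⟩ := (isAlmostGorenstein_iff (Q := QR × QS) hA.1 hA.2.1).1 hA
  rw [h.colonMax_one_eq hxm hx hym hy] at hKA
  have hmL : maxFrac R QR ≤ h.leftPart K :=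
    h.maxFrac_le_leftPart (maxFrac_le_one.trans (Submodule.one_le.2 h1K))
  have hLC : h.leftPart K ≤ colonMax (maxFrac R QR) := fun l hl r hr => by
    obtain ⟨a, ha, h1, -⟩ := h.exists_lift r hr 0 (zero_mem _)
    have := (h.mem_maxFrac_prod.1 (hKA hl a ha)).1
    rwa [Prod.smul_mk, ← algebraMap_smul R a l, h1] at this
  have hLr : IsRegularFractional (h.leftPart K) :=
    ⟨fg_of_le (colonMax_fg hxm hx (isRegularFractional_maxFrac hxm hx)) hLC, regUnit QR hx,
      hmL (algebraMap_mem_maxFrac hxm)⟩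
  have hL := h.leftPart_covBy hxm hx hK hLr
  by_cases h1 : (1 : QR) ∈ h.leftPart K
  · exact (isAlmostGorenstein_iff (Q := QR) hR hRdim).2
      ⟨_, hLr, hL, h1, hLC.trans fun q hq a ha => maxFrac_le_one (hq a ha)⟩
  · exact HasCanonicalBelowEndMax.isAlmostGorenstein hR hRdim ⟨_, hLr, hL, hmL, h1, hLC⟩

end IsResidueFiberProduct

/-! ### Generalized Gorenstein rings -/

lemma exists_linearEquiv_finsupp {A : Type u} [CommRing A] (I : Ideal A) [I.IsMaximal] {M : Type u}
    [AddCommGroup M] [Module A M] (hM : ∀ a ∈ I, ∀ m : M, a • m = 0) :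
    ∃ ι : Type u, Nonempty (M ≃ₗ[A] (ι →₀ A ⧸ I)) := by
  have htor : Module.IsTorsionBySet A M (I : Set A) := fun m a => hM a a.2 m
  let _ := htor.module
  let _ := Ideal.Quotient.field I
  exact ⟨_, ⟨(Module.Basis.ofVectorSpace (A ⧸ I) M).repr.restrictScalars A⟩⟩

lemma isGorensteinLocal_of_isCanonicalModule {A : Type u} [CommRing A] [IsLocalRing A]
    [IsNoetherianRing A] (h : IsCanonicalModule A (1 : Submodule A (FractionRing A))) :
    IsGorensteinLocal A := by
  exact ⟨‹_›, (h.of_linearEquiv (oneEquiv A (FractionRing A)).symm).finiteInjectiveDimension⟩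

lemma mem_canonicalConductor {A : Type u} [CommRing A] {K : Submodule A (FractionRing A)} {a : A} :
    a ∈ canonicalConductor A K ↔ ∀ t ∈ Algebra.adjoin A (K : Set (FractionRing A)),
      a • t ∈ (1 : Submodule A (FractionRing A)) :=
  Submodule.mem_colon

/-- If `A` is almost Gorenstein but not a discrete valuation ring, a canonical ideal `K ∋ 1` with
`𝔪 K ⊆ A` lies in `𝔪 : 𝔪`, so that it is integral over `A` and has conductor `A : A[K] = 𝔪`. -/
theorem IsAlmostGorenstein.isGeneralizedGorenstein {A : Type u} [CommRing A] [IsLocalRing A]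
    (h : IsAlmostGorenstein A)
    (hC : colonMax (1 : Submodule A (FractionRing A)) = colonMax (maxFrac A (FractionRing A))) :
    IsGeneralizedGorenstein A := by
  obtain ⟨hCM, hdim, -⟩ := id h
  have := hCM.1
  have := krullDimLE_one_of_eq hdim
  obtain ⟨x, hxm, hx⟩ := hCM.exists_nonZeroDivisor hdim
  obtain ⟨K, hKr, hK, h1K, hKA⟩ :=
    (isAlmostGorenstein_iff (Q := FractionRing A) hCM hdim).1 h
  have hcan := isCanonicalModule_of_covBy hdim hxm hx hKr hK
  rw [hC] at hKA
  have hfin := moduleFinite_endMax (Q := FractionRing A) hxm hx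
  refine ⟨hCM, hdim, K, ⟨Submodule.one_le.2 h1K, fun q hq => ?_, hcan⟩, ?_⟩
  · exact (IsIntegral.of_finite A (⟨q, hKA hq⟩ : endMax A (FractionRing A))).map
      (endMax A (FractionRing A)).val
  by_cases hG : IsGorensteinLocal A
  · exact Or.inl hG
  refine Or.inr ⟨hG, ?_⟩
  have hcond : canonicalConductor A K = maximalIdeal A := by
    refine le_antisymm (le_maximalIdeal fun htop => hG ?_) fun a ha => ?_
    · have hK1 : K = 1 := le_antisymm (fun q hq => by
        have h1 : (1 : A) ∈ canonicalConductor A K := htop ▸ Submodule.mem_top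
        have := mem_canonicalConductor.1 h1 q (Algebra.subset_adjoin hq)
        rwa [one_smul] at this) (Submodule.one_le.2 h1K)
      exact isGorensteinLocal_of_isCanonicalModule (hK1 ▸ hcan)
    · have hle : Algebra.adjoin A (K : Set (FractionRing A)) ≤ endMax A (FractionRing A) :=
        Algebra.adjoin_le hKA
      exact mem_canonicalConductor.2 fun t ht => maxFrac_le_one (hle ht a ha)
  rw [hcond]
  refine exists_linearEquiv_finsupp _ fun a ha m => ?_
  obtain ⟨κ, rfl⟩ := Submodule.Quotient.mk_surjective _ m
  rw [← Submodule.Quotient.mk_smul, Submodule.Quotient.mk_eq_zero]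
  exact maxFrac_le_one (hKA κ.2 a ha)

/-! ### Generalized Gorenstein fiber products -/

section LinearCombination

variable {A M ι : Type*} [CommRing A] [AddCommGroup M] [Module A M]

lemma linearCombination_sub_linearCombination_mem {X : Submodule A M} {k k' : ι → M}
    (h : ∀ i, k i - k' i ∈ X) (c : ι →₀ A) :
    Finsupp.linearCombination A k c - Finsupp.linearCombination A k' c ∈ X := by
  rw [Finsupp.linearCombination_apply, Finsupp.linearCombination_apply, Finsupp.sum, Finsupp.sum,
    ← Finset.sum_sub_distrib]
  exact X.sum_mem fun i _ => by
    rw [← smul_sub]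
    exact X.smul_mem _ (h i)

/-- A free `A / 𝔞`-module is generated by elements whose only relations over `A` are those with
coefficients in `𝔞`. -/
lemma exists_linearCombination_of_linearEquiv {𝔞 : Ideal A} (e : M ≃ₗ[A] (ι →₀ A ⧸ 𝔞)) :
    ∃ m : ι → M, (∀ q, ∃ c, q = Finsupp.linearCombination A m c) ∧
      ∀ c, Finsupp.linearCombination A m c = 0 → ∀ i, c i ∈ 𝔞 := by
  let m : ι → M := fun i => e.symm (Finsupp.single i 1)
  have key : ∀ c : ι →₀ A, e (Finsupp.linearCombination A m c) =
      c.mapRange (Ideal.Quotient.mk 𝔞) (map_zero _) := by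
    intro c
    induction c using Finsupp.induction_linear with
    | zero => simp
    | add f g hf hg => rw [map_add, map_add, hf, hg, Finsupp.mapRange_add (map_add _)]
    | single i a =>
      rw [Finsupp.linearCombination_single, map_smul, LinearEquiv.apply_symm_apply,
        Finsupp.smul_single, Finsupp.mapRange_single, Algebra.smul_def, mul_one]
      rfl
  refine ⟨m, fun q => ?_, fun c hc i => ?_⟩
  · obtain ⟨c, hc⟩ := Finsupp.mapRange_surjective _ (map_zero _)
      (Ideal.Quotient.mk_surjective (I := 𝔞)) (e q)
    exact ⟨c, e.injective (by rw [key, hc])⟩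
  · have := key c
    rw [hc, map_zero] at this
    have := DFunLike.congr_fun this i
    rw [Finsupp.mapRange_apply, Finsupp.coe_zero, Pi.zero_apply] at this
    exact Ideal.Quotient.eq_zero_iff_mem.1 this.symm

end LinearCombination

section Integral

variable {R Q : Type u} [CommRing R] [IsLocalRing R] [CommRing Q] [Algebra R Q]

lemma maxFrac_mul_eq (N : Submodule R Q) : maxFrac R Q * N = maximalIdeal R • N := by
  refine le_antisymm (Submodule.mul_le.2 ?_) (Submodule.smul_le.2 fun a ha n hn => ?_)
  · rintro _ ⟨a, ha, rfl⟩ n hn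
    rw [Algebra.linearMap_apply, ← Algebra.smul_def]
    exact Submodule.smul_mem_smul ha hn
  · rw [Algebra.smul_def]
    exact Submodule.mul_mem_mul (algebraMap_mem_maxFrac ha) hn

lemma one_notMem_maxFrac_mul_integralClosure (hinj : Function.Injective (algebraMap R Q)) :
    (1 : Q) ∉ maxFrac R Q * Subalgebra.toSubmodule (integralClosure R Q) := by
  intro h
  have hker : RingHom.ker (algebraMap R (integralClosure R Q)) ≤ maximalIdeal R := by
    intro a ha
    have h0 : algebraMap R Q a = 0 := congrArg Subtype.val ((RingHom.mem_ker).1 ha)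
    rw [hinj (h0.trans (map_zero _).symm)]
    exact zero_mem _
  obtain ⟨P, hP, hPm⟩ := Ideal.exists_ideal_over_maximal_of_isIntegral
    (S := integralClosure R Q) (maximalIdeal R) hker
  have hle : maxFrac R Q * Subalgebra.toSubmodule (integralClosure R Q) ≤
      (P.restrictScalars R).map (integralClosure R Q).val.toLinearMap := by
    refine Submodule.mul_le.2 ?_
    rintro _ ⟨a, ha, rfl⟩ b hb
    refine ⟨algebraMap R _ a * ⟨b, hb⟩, Ideal.mul_mem_right _ _ ?_, rfl⟩
    exact Ideal.mem_comap.1 (hPm ▸ ha)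
  obtain ⟨c, hc, hc1⟩ := hle h
  have : c = 1 := Subtype.ext hc1
  exact (Ideal.ne_top_iff_one P).1 hP.ne_top (this ▸ hc)

/-- A homomorphism along a local homomorphism `A → R` maps `𝔪 K`, for `K` integral, into the
extension of the maximal ideal to the integral closure of `R`. -/
lemma map_mem_maxFrac_mul_integralClosure {A Q' : Type u} [CommRing A] [IsLocalRing A]
    [Algebra A R] [CommRing Q'] [Algebra A Q'] [Algebra A Q] [IsScalarTower A R Q]
    (hAR : ∀ a ∈ maximalIdeal A, algebraMap A R a ∈ maximalIdeal R) (φ : Q' →ₐ[A] Q)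
    {K : Submodule A Q'} (hK : K ≤ Subalgebra.toSubmodule (integralClosure A Q')) {q : Q'}
    (hq : q ∈ maxFrac A Q' * K) :
    φ q ∈ maxFrac R Q * Subalgebra.toSubmodule (integralClosure R Q) := by
  induction hq using Submodule.mul_induction_on' with
  | mem_mul_mem p hp k hk =>
    obtain ⟨a, ha, rfl⟩ := hp
    rw [map_mul, Algebra.linearMap_apply, AlgHom.commutes, IsScalarTower.algebraMap_apply A R Q]
    exact Submodule.mul_mem_mul (algebraMap_mem_maxFrac (hAR a ha))
      (IsIntegral.tower_top (A := R) (IsIntegral.map φ (hK hk)))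
  | add p _ q _ hp hq =>
    rw [map_add]
    exact Submodule.add_mem _ hp hq

lemma map_mem_maxFrac_mul {A Q' : Type u} [CommRing A] [IsLocalRing A] [CommRing Q'] [Algebra A Q']
    {i : Q →+ Q'} (hi : ∀ p q, i (p * q) = i p * i q)
    (him : ∀ p ∈ maxFrac R Q, i p ∈ maxFrac A Q') {L : Submodule R Q} {N : Submodule A Q'}
    (hiN : ∀ l ∈ L, i l ∈ N) {p : Q} (hp : p ∈ L * maxFrac R Q) : i p ∈ maxFrac A Q' * N := by
  induction hp using Submodule.mul_induction_on' with
  | mem_mul_mem l hl p hp =>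
    rw [hi, mul_comm (i l)]
    exact Submodule.mul_mem_mul (him p hp) (hiN l hl)
  | add p _ q _ hp hq =>
    rw [map_add]
    exact Submodule.add_mem _ hp hq

end Integral

/-- In a discrete valuation ring, `𝔪` is the only canonical fractional ideal containing `𝔪` but
not `1`. -/
lemma le_maxFrac_of_scale {R Q : Type u} [CommRing R] [IsLocalRing R] [CommRing Q] [Algebra R Q]
    {w : Qˣ} (hw : maxFrac R Q = scale w 1) {L : Submodule R Q} (hLfg : L.FG)
    (hL : L ⋖ colonMax L) (hmL : maxFrac R Q ≤ L) (h1 : (1 : Q) ∉ L) : L ≤ maxFrac R Q := by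
  have hwm : (w : Q) ∈ maxFrac R Q := by
    rw [hw, mem_scale, Units.inv_mul]
    exact Submodule.one_le.1 le_rfl
  refine Submodule.le_of_le_smul_of_le_jacobson_bot hLfg (maximalIdeal_le_jacobson ⊥) fun l hl => ?_
  have hl' : ((w⁻¹ : Qˣ) : Q) * l ∈ colonMax L := by
    intro a ha
    have : algebraMap R Q a ∈ scale w 1 := hw ▸ algebraMap_mem_maxFrac ha
    rw [mem_scale] at this
    obtain ⟨r, hr⟩ := Submodule.mem_one.1 this
    rw [Algebra.smul_def, mul_left_comm, ← mul_assoc, ← hr, ← Algebra.smul_def]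
    exact L.smul_mem r hl
  obtain ⟨b, hb⟩ := exists_sub_smul_mem hL (one_mem_colonMax hmL) h1 hl'
  rw [← maxFrac_mul_eq]
  have h2 := Submodule.mul_mem_mul hwm hb
  rw [mul_sub, Units.mul_inv_cancel_left, mul_smul_comm, mul_one] at h2
  have := Submodule.add_mem_sup ((maxFrac R Q).smul_mem b hwm) h2
  rwa [add_sub_cancel] at this

namespace IsResidueFiberProduct

variable {A R S : Type u} [CommRing A] [IsLocalRing A] [CommRing R] [IsLocalRing R] [CommRing S]
  [IsLocalRing S] [Algebra A R] [Algebra A S]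
  {QR QS : Type u} [CommRing QR] [CommRing QS] [Algebra R QR] [Algebra S QS]
  [IsFractionRing R QR] [IsFractionRing S QS] [Algebra A QR] [Algebra A QS] [IsScalarTower A R QR]
  [IsScalarTower A S QS]

lemma mk_one_zero_mem_colonMax (h : IsResidueFiberProduct A R S) {K : Submodule A (QR × QS)}
    (hmK : maxFrac A (QR × QS) ≤ K) : ((1 : QR), (0 : QS)) ∈ colonMax K :=
  h.mk_zero_mem_colonMax.2 (one_mem_colonMax (h.maxFrac_le_leftPart hmK))

/-- A canonical fractional ideal `K ∋ 1` not containing the idempotent `(1, 0)` decomposes as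
`A + L × M`. -/
lemma exists_sub_mem_leftPart (h : IsResidueFiberProduct A R S) {K : Submodule A (QR × QS)}
    (hK : K ⋖ colonMax K) (hmK : maxFrac A (QR × QS) ≤ K) (h1 : (1 : QR) ∉ h.leftPart K)
    {q : QR × QS} (hq : q ∈ K) : ∃ a : A, q.1 - algebraMap A QR a ∈ h.leftPart K := by
  have hq' : (q.1, (0 : QS)) ∈ colonMax K := by
    refine h.mk_zero_mem_colonMax.2 fun r hr => ?_
    obtain ⟨a, -, h1, h2⟩ := h.exists_lift r hr 0 (zero_mem _)
    have : a • q = (r • q.1, 0) := Prod.ext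
      (by rw [Prod.smul_fst, ← algebraMap_smul R a, h1])
      (by rw [Prod.smul_snd, ← algebraMap_smul S a, h2, zero_smul])
    rw [mem_leftPart, ← this]
    exact K.smul_mem a hq
  obtain ⟨a, ha⟩ := exists_sub_smul_mem hK (h.mk_one_zero_mem_colonMax hmK) h1 hq'
  refine ⟨a, ?_⟩
  rwa [Prod.smul_mk, smul_zero, Prod.mk_sub_mk, sub_zero, ← Algebra.algebraMap_eq_smul_one] at ha

variable [IsNoetherianRing R] [Ring.KrullDimLE 1 R] [IsNoetherianRing A]
  [IsFractionRing A (QR × QS)]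

lemma leftPart_fg (h : IsResidueFiberProduct A R S) {K : Submodule A (QR × QS)} (hK : K.FG) :
    (h.leftPart K).FG := by
  refine Submodule.FG.of_restrictScalars A ?_
  refine Submodule.fg_of_fg_map_injective (LinearMap.inl A QR QS) LinearMap.inl_injective
    (fg_of_le hK ?_)
  rintro _ ⟨l, hl, rfl⟩
  exact hl

/-- Let `L` be the left part of the canonical ideal `K` and let `𝔞` be the largest ideal of `A`
stable under `K`. If `R` is a discrete valuation ring, then `L = 𝔪` and `𝔞` contains `𝔪 × 0`. In
the other case `𝔪 ⊆ 𝔪 L`. -/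
lemma maxFrac_le_mul_or_ker_le (h : IsResidueFiberProduct A R S) {x : R}
    (hxm : x ∈ maximalIdeal R) (hx : x ∈ nonZeroDivisors R) {K : Submodule A (QR × QS)}
    (hKfg : K.FG) (hK : K ⋖ colonMax K) (hmK : maxFrac A (QR × QS) ≤ K)
    (h1 : (1 : QR) ∉ h.leftPart K) {𝔞 : Ideal A}
    (hmax : ∀ 𝔟 : Ideal A, (∀ b ∈ 𝔟, ∀ q ∈ K, ∃ c ∈ 𝔟, algebraMap A (QR × QS) c = b • q) → 𝔟 ≤ 𝔞) :
    maxFrac R QR ≤ h.leftPart K * maxFrac R QR ∨ RingHom.ker (algebraMap A S) ≤ 𝔞 := by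
  have hmL := h.maxFrac_le_leftPart hmK
  have hLr : IsRegularFractional (h.leftPart K) :=
    ⟨h.leftPart_fg hKfg, regUnit QR hx, hmL (algebraMap_mem_maxFrac hxm)⟩
  have hL := h.leftPart_covBy hxm hx hK hLr
  obtain ⟨w, hw⟩ | hC := exists_scale_eq_or_colonMax_one_eq (R := R) QR
  · right
    have hLm := le_maxFrac_of_scale hw hLr.fg hL hmL h1
    refine hmax _ fun b hb q hq => ?_
    rw [RingHom.mem_ker] at hb
    have hbm : b ∈ maximalIdeal A := (mem_maximalIdeal b).2 fun hu =>
      (hu.map (algebraMap A S)).ne_zero hb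
    obtain ⟨a, ha⟩ := h.exists_sub_mem_leftPart hK hmK h1 hq
    obtain ⟨r, -, hr⟩ := hLm ha
    rw [Algebra.linearMap_apply] at hr
    obtain ⟨c, -, hc1, hc2⟩ := h.exists_lift _
      (Ideal.mul_mem_right (algebraMap A R a + r) _ (h.algebraMap_mem hbm)) 0 (zero_mem _)
    refine ⟨c, hc2, Prod.ext ?_ ?_⟩
    · rw [Prod.algebraMap_apply, Prod.smul_fst, IsScalarTower.algebraMap_apply A R QR, hc1, map_mul,
        map_add, hr, ← IsScalarTower.algebraMap_apply, ← IsScalarTower.algebraMap_apply,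
        add_sub_cancel, Algebra.smul_def]
    · rw [Prod.algebraMap_apply, Prod.smul_snd, IsScalarTower.algebraMap_apply A S QS, hc2, map_zero,
        ← algebraMap_smul S b, hb, zero_smul]
  · exact Or.inl (maxFrac_le_mul hxm hx hC hLr hL hmL)

end IsResidueFiberProduct

/-! ### The conductor of a generalized Gorenstein fiber product -/

namespace IsResidueFiberProduct

variable {A R S : Type u} [CommRing A] [IsLocalRing A] [CommRing R] [IsLocalRing R] [CommRing S]
  [IsLocalRing S] [Algebra A R] [Algebra A S]
  {QR QS : Type u} [CommRing QR] [CommRing QS] [Algebra R QR] [Algebra S QS]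
  [IsFractionRing R QR] [IsFractionRing S QS] [Algebra A QR] [Algebra A QS] [IsScalarTower A R QR]
  [IsScalarTower A S QS]

/-- Modulo the extension of the maximal ideal to the integral closure, the idempotent `(1, 0)` is
not congruent to an element of `A`. -/
lemma mk_one_zero_sub_notMem (h : IsResidueFiberProduct A R S) {K : Submodule A (QR × QS)}
    (hK : K ≤ Subalgebra.toSubmodule (integralClosure A (QR × QS))) (a : A) :
    ((1 : QR), (0 : QS)) - algebraMap A (QR × QS) a ∉ maxFrac A (QR × QS) * K := by
  intro ha
  have h1 := map_mem_maxFrac_mul_integralClosure (fun _ => h.algebraMap_mem)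
    (AlgHom.fst A QR QS) hK ha
  have h2 := map_mem_maxFrac_mul_integralClosure (fun _ => h.symm.algebraMap_mem)
    (AlgHom.snd A QR QS) hK ha
  rw [map_sub, AlgHom.commutes] at h1 h2
  rw [AlgHom.fst_apply] at h1
  rw [AlgHom.snd_apply, zero_sub, neg_mem_iff] at h2
  by_cases hu : IsUnit a
  · obtain ⟨u, rfl⟩ := hu
    refine one_notMem_maxFrac_mul_integralClosure (IsFractionRing.injective S QS) ?_
    have := Submodule.smul_mem _ (algebraMap A S ↑u⁻¹) h2
    rwa [Algebra.smul_def, ← IsScalarTower.algebraMap_apply, ← map_mul, Units.inv_mul,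
      map_one] at this
  · refine one_notMem_maxFrac_mul_integralClosure (IsFractionRing.injective R QR) ?_
    have h3 : algebraMap A QR a ∈
        maxFrac R QR * Subalgebra.toSubmodule (integralClosure R QR) := by
      rw [IsScalarTower.algebraMap_apply A R QR, ← mul_one (algebraMap R QR _)]
      exact Submodule.mul_mem_mul
        (algebraMap_mem_maxFrac (h.algebraMap_mem ((mem_maximalIdeal a).2 hu)))
        (one_mem (integralClosure R QR))
    have := Submodule.add_mem _ h1 h3
    rwa [sub_add_cancel] at this

variable [IsNoetherianRing R] [Ring.KrullDimLE 1 R] [IsNoetherianRing S] [Ring.KrullDimLE 1 S]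
  [IsNoetherianRing A] [IsFractionRing A (QR × QS)]

/-- The core of the argument for generalized Gorenstein fiber products. Let `K ∋ 1` be an integral
canonical fractional ideal of `A`, let `𝔞` be the largest ideal of `A` stable under `K`, and suppose
that `K / A` is a free `A / 𝔞`-module. Then `𝔞` contains the maximal ideal. -/
theorem maximalIdeal_le_of_free (h : IsResidueFiberProduct A R S) (hAdim : ringKrullDim A = 1)
    {x : R} (hxm : x ∈ maximalIdeal R) (hx : x ∈ nonZeroDivisors R) {y : S}
    (hym : y ∈ maximalIdeal S) (hy : y ∈ nonZeroDivisors S) {K : Submodule A (QR × QS)}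
    (hKcan : IsCanonicalModule A K) (h1K : (1 : QR × QS) ∈ K)
    (hKint : K ≤ Subalgebra.toSubmodule (integralClosure A (QR × QS))) {𝔞 : Ideal A}
    (h𝔞 : ∀ a ∈ 𝔞, ∀ q ∈ K, ∃ c ∈ 𝔞, algebraMap A (QR × QS) c = a • q)
    (hmax : ∀ 𝔟 : Ideal A, (∀ b ∈ 𝔟, ∀ q ∈ K, ∃ c ∈ 𝔟, algebraMap A (QR × QS) c = b • q) → 𝔟 ≤ 𝔞)
    {ι : Type*} {k : ι → QR × QS} (hkK : ∀ i, k i ∈ K)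
    (hspan : ∀ q ∈ K, ∃ c : ι →₀ A, q - Finsupp.linearCombination A k c ∈ (1 : Submodule A (QR × QS)))
    (hind : ∀ c : ι →₀ A, Finsupp.linearCombination A k c ∈ (1 : Submodule A (QR × QS)) →
      ∀ i, c i ∈ 𝔞) : maximalIdeal A ≤ 𝔞 := by
  by_contra hne
  have := krullDimLE_one_of_eq hAdim
  obtain ⟨z, hzm, -, -, hz⟩ := h.exists_nonZeroDivisor hxm hx hym hy
  have hreg : ∃ z ∈ maximalIdeal A, z ∈ nonZeroDivisors A := ⟨z, hzm, hz⟩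
  have hK := hKcan.covBy hAdim hreg
  have hKfg : K.FG := Module.Finite.iff_fg.1 hKcan.maximalCohenMacaulay.1
  have hmK : maxFrac A (QR × QS) ≤ K := maxFrac_le_one.trans (Submodule.one_le.2 h1K)
  -- the class of `(1, 0)` would be a socle element of `K / A`, hence lie in `𝔪 (K / A)`
  have h1L : (1 : QR) ∉ h.leftPart K := by
    intro hmem
    obtain ⟨c, hc⟩ := hspan _ hmem
    have hcm : ∀ i, c i ∈ maximalIdeal A := by
      by_contra! hc'
      obtain ⟨i, hi⟩ := hc'
      refine hne fun j hj => ?_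
      have hj1 : j • ((1 : QR), (0 : QS)) ∈ (1 : Submodule A (QR × QS)) := by
        rw [Prod.smul_mk, smul_zero, ← Algebra.algebraMap_eq_smul_one,
          IsScalarTower.algebraMap_apply A R QR]
        exact maxFrac_le_one (h.mk_zero_mem_maxFrac (algebraMap_mem_maxFrac (h.algebraMap_mem hj)))
      have hj2 := Submodule.sub_mem _ hj1 (Submodule.smul_mem _ j hc)
      rw [smul_sub, sub_sub_cancel, ← map_smul] at hj2
      have := hind _ hj2 i
      rw [Finsupp.smul_apply, smul_eq_mul] at this
      obtain ⟨u, hu⟩ := not_not.1 hi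
      rw [← hu] at this
      simpa using 𝔞.mul_mem_right (↑u⁻¹) this
    obtain ⟨a, ha⟩ := Submodule.mem_one.1 hc
    refine h.mk_one_zero_sub_notMem hKint a ?_
    rw [ha, sub_sub_cancel, Finsupp.linearCombination_apply]
    refine Submodule.sum_mem _ fun i _ => ?_
    change c i • k i ∈ _
    rw [Algebra.smul_def]
    exact Submodule.mul_mem_mul (algebraMap_mem_maxFrac (hcm i)) (hkK i)
  -- the same canonical ideal, with the roles of `R` and `S` exchanged
  have : IsFractionRing A (QS × QR) := h.symm.isFractionRing hym hy hxm hx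
  let e : (QS × QR) ≃ₗ[A] (QR × QS) := LinearEquiv.prodComm A QS QR
  let K' : Submodule A (QS × QR) := K.comap e.toLinearMap
  have hK'can : IsCanonicalModule A K' := hKcan.of_linearEquiv (e.ofSubmodule' K).symm
  have hK' := hK'can.covBy hAdim hreg
  have hK'fg : K'.FG := Module.Finite.iff_fg.1 hK'can.maximalCohenMacaulay.1
  have h1K' : (1 : QS × QR) ∈ K' := h1K
  have hmK' : maxFrac A (QS × QR) ≤ K' := maxFrac_le_one.trans (Submodule.one_le.2 h1K')
  have h1M : (1 : QS) ∉ h.symm.leftPart K' := by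
    intro hmem
    refine h1L ?_
    have := K.sub_mem h1K (show ((0 : QR), (1 : QS)) ∈ K from hmem)
    rwa [show (1 : QR × QS) - (0, 1) = (1, 0) from Prod.ext (sub_zero _) (sub_self _)] at this
  -- `N = L × M`, so that `K = A + N` and `N ∩ A = 𝔪 × 𝔫`
  let N : Submodule A (QR × QS) := prodIdeal (h.leftPart K) (h.symm.leftPart K')
  have hL0 : ∀ l ∈ h.leftPart K, (l, (0 : QS)) ∈ N := fun l hl => ⟨hl, zero_mem _⟩
  have hM0 : ∀ m ∈ h.symm.leftPart K', ((0 : QR), m) ∈ N := fun m hm => ⟨zero_mem _, hm⟩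
  have hNK : N ≤ K := fun q hq => by
    have := K.add_mem (show (q.1, (0 : QS)) ∈ K from hq.1) (show ((0 : QR), q.2) ∈ K from hq.2)
    rwa [Prod.mk_add_mk, add_zero, zero_add] at this
  have hKN : ∀ q ∈ K, ∃ a : A, q - algebraMap A (QR × QS) a ∈ N := fun q hq => by
    obtain ⟨a, ha⟩ := h.exists_sub_mem_leftPart hK hmK h1L hq
    refine ⟨a, ha, ?_⟩
    have := K.sub_mem (K.sub_mem hq (Submodule.one_le.2 h1K (Submodule.mem_one.2 ⟨a, rfl⟩))) ha
    rw [show q - algebraMap A (QR × QS) a - (q.1 - algebraMap A QR a, 0) =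
      (0, (q - algebraMap A (QR × QS) a).2) from Prod.ext (sub_self _) (sub_zero _)] at this
    exact this
  have hmN : maxFrac A (QR × QS) ≤ N :=
    h.maxFrac_le_prodIdeal (h.maxFrac_le_leftPart hmK) (h.symm.maxFrac_le_leftPart hmK')
  have hN1 : ∀ a : A, algebraMap A (QR × QS) a ∈ N → a ∈ maximalIdeal A := fun a ha =>
    mem_maximalIdeal_of_algebraMap_mem h1L ha.1
  let Fa : Submodule A (QR × QS) := Submodule.map (Algebra.linearMap A (QR × QS)) 𝔞
  -- `𝔪 × 𝔫 ⊆ (𝔪 × 𝔫) N + 𝔞`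
  have hle : maxFrac A (QR × QS) ≤ maxFrac A (QR × QS) * N ⊔ Fa := by
    have hleft : ∀ p ∈ maxFrac R QR, (p, (0 : QS)) ∈ maxFrac A (QR × QS) * N ⊔ Fa := by
      intro p hp
      rcases h.maxFrac_le_mul_or_ker_le hxm hx hKfg hK hmK h1L hmax with h' | h'
      · exact Submodule.mem_sup_left (map_mem_maxFrac_mul (i := AddMonoidHom.inl QR QS)
          (fun p q => by simp) (fun p hp => h.mk_zero_mem_maxFrac hp) hL0 (h' hp))
      · obtain ⟨r, hr, rfl⟩ := hp
        obtain ⟨a, -, ha1, ha2⟩ := h.exists_lift r hr 0 (zero_mem _)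
        refine Submodule.mem_sup_right ⟨a, h' ha2, Prod.ext ?_ ?_⟩
        · exact (IsScalarTower.algebraMap_apply A R QR a).trans (by rw [ha1]; rfl)
        · exact (IsScalarTower.algebraMap_apply A S QS a).trans (by rw [ha2, map_zero])
    have hright : ∀ p ∈ maxFrac S QS, ((0 : QR), p) ∈ maxFrac A (QR × QS) * N ⊔ Fa := by
      intro p hp
      rcases h.symm.maxFrac_le_mul_or_ker_le hym hy hK'fg hK' hmK' h1M (𝔞 := 𝔞) (by
        refine fun 𝔟 h𝔟 => hmax 𝔟 fun b hb q hq => ?_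
        obtain ⟨c, hc, hc'⟩ := h𝔟 b hb q.swap hq
        exact ⟨c, hc, congrArg Prod.swap hc'⟩) with h' | h'
      · exact Submodule.mem_sup_left (map_mem_maxFrac_mul (i := AddMonoidHom.inr QR QS)
          (fun p q => by simp) (fun p hp => h.mem_maxFrac_prod.2 ⟨zero_mem _, hp⟩) hM0 (h' hp))
      · obtain ⟨s, hs, rfl⟩ := hp
        obtain ⟨a, -, ha1, ha2⟩ := h.exists_lift 0 (zero_mem _) s hs
        refine Submodule.mem_sup_right ⟨a, h' ha1, Prod.ext ?_ ?_⟩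
        · exact (IsScalarTower.algebraMap_apply A R QR a).trans (by rw [ha1, map_zero])
        · exact (IsScalarTower.algebraMap_apply A S QS a).trans (by rw [ha2]; rfl)
    intro q hq
    have := Submodule.add_mem _ (hleft _ (h.mem_maxFrac_prod.1 hq).1)
      (hright _ (h.mem_maxFrac_prod.1 hq).2)
    rwa [Prod.mk_add_mk, add_zero, zero_add] at this
  -- generators of `K / A` lifted to `N`
  choose b hb using fun i => hKN (k i) (hkK i)
  let k' : ι → QR × QS := fun i => k i - algebraMap A (QR × QS) (b i)
  have hdiff : ∀ c, Finsupp.linearCombination A k c - Finsupp.linearCombination A k' c ∈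
      (1 : Submodule A (QR × QS)) := linearCombination_sub_linearCombination_mem fun i => by
    rw [sub_sub_cancel]
    exact Submodule.mem_one.2 ⟨b i, rfl⟩
  have hlcN : ∀ c, Finsupp.linearCombination A k' c ∈ N := fun c => by
    rw [Finsupp.linearCombination_apply]
    exact Submodule.sum_mem _ fun i _ => N.smul_mem _ (hb i)
  have hNle : N ≤ LinearMap.range (Finsupp.linearCombination A k') ⊔ Fa := by
    refine Submodule.le_of_le_smul_of_le_jacobson_bot (fg_of_le hKfg hNK)
      (maximalIdeal_le_jacobson ⊥) fun q hq => ?_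
    obtain ⟨c, hc⟩ := hspan q (hNK hq)
    have h1 := Submodule.add_mem _ hc (hdiff c)
    rw [sub_add_sub_cancel] at h1
    obtain ⟨a, ha⟩ := Submodule.mem_one.1 h1
    have ham : a ∈ maximalIdeal A := hN1 a (ha ▸ N.sub_mem hq (hlcN c))
    have h2 := hle (algebraMap_mem_maxFrac (Q := QR × QS) ham)
    rw [ha, maxFrac_mul_eq, sup_comm] at h2
    rw [sup_assoc]
    have := Submodule.add_mem_sup
      (LinearMap.mem_range_self (Finsupp.linearCombination A k') c) h2
    rwa [add_sub_cancel] at this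
  -- the coefficients of an element of `𝔪 × 𝔫` lie in `𝔞`
  refine hne fun j hj => ?_
  obtain ⟨_, ⟨c, rfl⟩, _, ⟨d, hd, rfl⟩, hcd⟩ := Submodule.mem_sup.1
    (hNle (hmN (algebraMap_mem_maxFrac (Q := QR × QS) hj)))
  have hc1 : Finsupp.linearCombination A k c ∈ (1 : Submodule A (QR × QS)) := by
    have h1 : Finsupp.linearCombination A k' c ∈ (1 : Submodule A (QR × QS)) := by
      rw [eq_sub_of_add_eq hcd, Algebra.linearMap_apply, ← map_sub]
      exact Submodule.mem_one.2 ⟨_, rfl⟩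
    have := Submodule.add_mem _ (hdiff c) h1
    rwa [sub_add_cancel] at this
  have hmem : algebraMap A (QR × QS) j ∈ Fa := by
    rw [← hcd, Finsupp.linearCombination_apply]
    refine Submodule.add_mem _ (Submodule.sum_mem _ fun i _ => ?_) ⟨d, hd, rfl⟩
    obtain ⟨a, ha, ha'⟩ := h𝔞 _ (hind c hc1 i) _ (hNK (hb i))
    exact ⟨a, ha, ha'⟩
  obtain ⟨j', hj', hjj'⟩ := hmem
  rwa [← IsFractionRing.injective A (QR × QS) hjj']

end IsResidueFiberProduct

/-! ### The conductor of a canonical ideal -/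

section Conductor

variable {A : Type u} [CommRing A] {K : Submodule A (FractionRing A)}

lemma exists_mem_canonicalConductor {a : A} (ha : a ∈ canonicalConductor A K)
    {q : FractionRing A} (hq : q ∈ K) :
    ∃ c ∈ canonicalConductor A K, algebraMap A (FractionRing A) c = a • q := by
  obtain ⟨c, hc⟩ := Submodule.mem_one.1
    (mem_canonicalConductor.1 ha q (Algebra.subset_adjoin hq))
  refine ⟨c, mem_canonicalConductor.2 fun t ht => ?_, hc⟩
  rw [Algebra.smul_def, hc, smul_mul_assoc]
  exact mem_canonicalConductor.1 ha _ (mul_mem (Algebra.subset_adjoin hq) ht)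

/-- The conductor `A : A[K]` is the largest ideal of `A` stable under `K`. -/
lemma le_canonicalConductor {𝔟 : Ideal A}
    (h : ∀ b ∈ 𝔟, ∀ q ∈ K, ∃ c ∈ 𝔟, algebraMap A (FractionRing A) c = b • q) :
    𝔟 ≤ canonicalConductor A K := by
  have key : ∀ t ∈ Algebra.adjoin A (K : Set (FractionRing A)), ∀ b ∈ 𝔟, ∃ c ∈ 𝔟,
      algebraMap A (FractionRing A) c = b • t := by
    intro t ht
    induction ht using Algebra.adjoin_induction with
    | mem q hq => exact fun b hb => h b hb q hq
    | algebraMap r =>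
      exact fun b hb => ⟨b * r, Ideal.mul_mem_right _ _ hb, by rw [Algebra.smul_def, map_mul]⟩
    | add p q _ _ hp hq =>
      intro b hb
      obtain ⟨c, hc, hc'⟩ := hp b hb
      obtain ⟨d, hd, hd'⟩ := hq b hb
      exact ⟨c + d, 𝔟.add_mem hc hd, by rw [map_add, hc', hd', smul_add]⟩
    | mul p q _ _ hp hq =>
      intro b hb
      obtain ⟨c, hc, hc'⟩ := hp b hb
      obtain ⟨d, hd, hd'⟩ := hq c hc
      exact ⟨d, hd, by rw [hd', Algebra.smul_def, hc', smul_mul_assoc]⟩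
  intro b hb
  refine mem_canonicalConductor.2 fun t ht => ?_
  obtain ⟨c, -, hc⟩ := key t ht b hb
  exact Submodule.mem_one.2 ⟨c, hc⟩

end Conductor

/-- A one-dimensional Gorenstein local ring is almost Gorenstein. -/
lemma IsGorensteinLocal.isAlmostGorenstein {A : Type u} [CommRing A] [IsLocalRing A]
    (h : IsGorensteinLocal A) (hCM : IsCohenMacaulayLocal A) (hdim : ringKrullDim A = 1) :
    IsAlmostGorenstein A := by
  have := hCM.1
  have := krullDimLE_one_of_eq hdim
  obtain ⟨x, hxm, hx⟩ := hCM.exists_nonZeroDivisor hdim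
  have hcan := (isCanonicalModule_self hCM hdim h.2 hxm hx).of_linearEquiv
    (oneEquiv A (FractionRing A))
  exact (isAlmostGorenstein_iff (Q := FractionRing A) hCM hdim).2
    ⟨1, isRegularFractional_one, hcan.covBy hdim ⟨x, hxm, hx⟩, Submodule.one_le.1 le_rfl,
      le_colonMax 1⟩

/-- A generalized Gorenstein fiber product is Gorenstein, or its conductor `A : A[K]` is the maximal
ideal, in which case the fractional canonical ideal `K` satisfies `(𝔪 × 𝔫) K ⊆ A`. -/
theorem IsResidueFiberProduct.isAlmostGorenstein_of_isGeneralizedGorenstein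
    {A R S : Type u} [CommRing A] [IsLocalRing A] [CommRing R] [IsLocalRing R] [CommRing S]
    [IsLocalRing S] [Algebra A R] [Algebra A S] (h : IsResidueFiberProduct A R S)
    (hR : IsCohenMacaulayLocal R) (hRdim : ringKrullDim R = 1) (hS : IsCohenMacaulayLocal S)
    (hSdim : ringKrullDim S = 1) (hA : IsGeneralizedGorenstein A) : IsAlmostGorenstein A := by
  obtain ⟨hCM, hdim, K, hK, hG | ⟨-, ι, ⟨e⟩⟩⟩ := hA
  · exact hG.isAlmostGorenstein hCM hdim
  obtain ⟨x, hxm, hx⟩ := hR.exists_nonZeroDivisor hRdim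
  obtain ⟨y, hym, hy⟩ := hS.exists_nonZeroDivisor hSdim
  have := hR.1
  have := hS.1
  have := hCM.1
  have := krullDimLE_one_of_eq hRdim
  have := krullDimLE_one_of_eq hSdim
  have := krullDimLE_one_of_eq hdim
  have : IsFractionRing A (FractionRing R × FractionRing S) := h.isFractionRing hxm hx hym hy
  have h1K : (1 : FractionRing A) ∈ K := Submodule.one_le.1 hK.one_le
  -- transport to `Q(R) × Q(S)`
  let φ : FractionRing A ≃ₐ[A] FractionRing R × FractionRing S :=
    IsLocalization.algEquiv (nonZeroDivisors A) _ _
  have hφ : ∀ q c, φ q = algebraMap A _ c ↔ q = algebraMap A _ c := fun q c => by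
    rw [← φ.commutes c, φ.injective.eq_iff]
  have hφ1 : ∀ q, φ q ∈ (1 : Submodule A (FractionRing R × FractionRing S)) ↔
      q ∈ (1 : Submodule A (FractionRing A)) := fun q => by
    rw [Submodule.mem_one, Submodule.mem_one]
    exact exists_congr fun c => by rw [eq_comm, hφ, eq_comm]
  obtain ⟨m, hm, hm0⟩ := exists_linearCombination_of_linearEquiv e
  choose κ hκ using fun i => Submodule.Quotient.mk_surjective _ (m i)
  have hlc : ∀ c : ι →₀ A, Submodule.mkQ _ (Finsupp.linearCombination A κ c) =
      Finsupp.linearCombination A m c := fun c =>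
    (LinearMap.map_finsupp_linearCombination _ c).trans
      (congrArg (fun v => Finsupp.linearCombination A v c) (funext hκ))
  have hφlc : ∀ c : ι →₀ A, Finsupp.linearCombination A (fun i => φ (κ i)) c =
      φ (Finsupp.linearCombination A κ c : K) := fun c =>
    (LinearMap.map_finsupp_linearCombination (φ.toLinearMap ∘ₗ K.subtype) c).symm
  have hle : maximalIdeal A ≤ canonicalConductor A K := by
    refine h.maximalIdeal_le_of_free hdim hxm hx hym hy (K := K.map φ.toLinearMap)
      (hK.isCanonicalModule.of_linearEquiv (φ.toLinearEquiv.submoduleMap K))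
      ⟨1, h1K, map_one φ⟩ ?_ ?_ ?_ (k := fun i => φ (κ i)) (fun i => ⟨_, (κ i).2, rfl⟩) ?_ ?_
    · rintro _ ⟨q, hq, rfl⟩
      exact IsIntegral.map φ (hK.le_integralClosure hq)
    · rintro a ha _ ⟨q, hq, rfl⟩
      obtain ⟨c, hc, hc'⟩ := exists_mem_canonicalConductor ha hq
      refine ⟨c, hc, ?_⟩
      rw [← φ.commutes, hc', map_smul]
      rfl
    · refine fun 𝔟 h𝔟 => le_canonicalConductor fun b hb q hq => ?_
      obtain ⟨c, hc, hc'⟩ := h𝔟 b hb (φ q) ⟨q, hq, rfl⟩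
      exact ⟨c, hc, ((hφ _ _).1 ((map_smul φ b q).trans hc'.symm)).symm⟩
    · rintro _ ⟨q, hq, rfl⟩
      obtain ⟨c, hc⟩ := hm (Submodule.mkQ _ ⟨q, hq⟩)
      refine ⟨c, ?_⟩
      rw [← hlc, ← sub_eq_zero, ← map_sub, Submodule.mkQ_apply, Submodule.Quotient.mk_eq_zero] at hc
      rw [hφlc]
      have := (hφ1 _).2 hc
      rwa [Submodule.subtype_apply, Submodule.coe_sub, map_sub] at this
    · intro c hc
      rw [hφlc, hφ1] at hc
      refine hm0 c ?_
      rw [← hlc, Submodule.mkQ_apply, Submodule.Quotient.mk_eq_zero]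
      exact hc
  have hcov := hK.isCanonicalModule.covBy hdim (hCM.exists_nonZeroDivisor hdim)
  exact (isAlmostGorenstein_iff (Q := FractionRing A) hCM hdim).2
    ⟨K, ⟨Module.Finite.iff_fg.1 hK.isCanonicalModule.maximalCohenMacaulay.1, 1, h1K⟩, hcov, h1K,
      fun q hq a ha => mem_canonicalConductor.1 (hle ha) q (Algebra.subset_adjoin hq)⟩

/-! ### The ring `R ×_k S` -/

section ResidueFiberProduct

variable {R S : Type u} [CommRing R] [IsLocalRing R] [CommRing S] [IsLocalRing S] {k : Type v}
  [Field k] (eR : ResidueField R ≃+* k) (eS : ResidueField S ≃+* k)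

lemma residueMap_surjective (e : ResidueField R ≃+* k) : Function.Surjective (residueMap e) :=
  e.surjective.comp residue_surjective

lemma residueMap_eq_zero_iff (e : ResidueField R ≃+* k) {r : R} :
    residueMap e r = 0 ↔ r ∈ maximalIdeal R := by
  rw [← residue_eq_zero_iff]
  exact e.map_eq_zero_iff

/-- The first projection makes `R` an algebra over `R ×_k S`. -/
abbrev residueFiberProduct.algebraLeft : Algebra (residueFiberProduct eR eS) R :=
  ((RingHom.fst R S).comp (residueFiberProduct eR eS).subtype).toAlgebra

/-- The second projection makes `S` an algebra over `R ×_k S`. -/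
abbrev residueFiberProduct.algebraRight : Algebra (residueFiberProduct eR eS) S :=
  ((RingHom.snd R S).comp (residueFiberProduct eR eS).subtype).toAlgebra

attribute [local instance] residueFiberProduct.algebraLeft residueFiberProduct.algebraRight

lemma isResidueFiberProduct : IsResidueFiberProduct (residueFiberProduct eR eS) R S where
  surjective_left r := by
    obtain ⟨s, hs⟩ := residueMap_surjective eS (residueMap eR r)
    exact ⟨⟨(r, s), hs.symm⟩, rfl⟩
  surjective_right s := by
    obtain ⟨r, hr⟩ := residueMap_surjective eR (residueMap eS s)
    exact ⟨⟨(r, s), hr⟩, rfl⟩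
  eq_zero a h1 h2 := Subtype.ext (Prod.ext h1 h2)
  exists_lift r hr s hs := by
    refine ⟨⟨(r, s), ((residueMap_eq_zero_iff eR).2 hr).trans ((residueMap_eq_zero_iff eS).2 hs).symm⟩,
      ?_, rfl, rfl⟩
    exact (mem_maximalIdeal _).2 fun hu => (mem_maximalIdeal r).1 hr
      (hu.map (algebraMap (residueFiberProduct eR eS) R))

end ResidueFiberProduct

theorem theorem4p15 {R S : Type u} [CommRing R] [IsLocalRing R] [CommRing S] [IsLocalRing S]
    (hR : IsCohenMacaulayLocal R) (hRdim : ringKrullDim R = 1)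
    (hS : IsCohenMacaulayLocal S) (hSdim : ringKrullDim S = 1)
    {k : Type v} [Field k] [Infinite k]
    (eR : ResidueField R ≃+* k) (eS : ResidueField S ≃+* k)
    (hQ : IsGorensteinRing (FractionRing (residueFiberProduct eR eS)))
    (hK : HasCanonicalModule (residueFiberProduct eR eS)) :
    List.TFAE [
      IsAlmostGorenstein (residueFiberProduct eR eS),
      IsGeneralizedGorenstein (residueFiberProduct eR eS),
      IsAlmostGorenstein R ∧ IsAlmostGorenstein S] := by
  let _ := residueFiberProduct.algebraLeft eR eS
  let _ := residueFiberProduct.algebraRight eR eS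
  have h := isResidueFiberProduct eR eS
  have : Infinite (ResidueField R) := Infinite.of_injective eR.symm eR.symm.injective
  have : Infinite (ResidueField S) := Infinite.of_injective eS.symm eS.symm.injective
  obtain ⟨x, hxm, hx⟩ := hR.exists_nonZeroDivisor hRdim
  obtain ⟨y, hym, hy⟩ := hS.exists_nonZeroDivisor hSdim
  tfae_have 1 → 2 := fun hA => by
    have := hA.1.1
    exact hA.isGeneralizedGorenstein (h.colonMax_one_eq hxm hx hym hy)
  tfae_have 2 → 1 := h.isAlmostGorenstein_of_isGeneralizedGorenstein hR hRdim hS hSdim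
  tfae_have 1 → 3 := fun hA => ⟨h.isAlmostGorenstein_left hR hRdim hS hSdim hA,
    h.symm.isAlmostGorenstein_left hS hSdim hR hRdim hA⟩
  tfae_have 3 → 1 := fun hRS => h.isAlmostGorenstein hRS.1 hRS.2
  tfae_finish

end
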